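/- **Setting.** Let $\mu$ be a partition contained in an $a\times b$ rectangle. For a cell in row $i$ and column $j$ ($i,j\ge 1$) put $t=j-i$. Let $v_1<\dots<v_N$ be the positions $t$ of the inner corners of $\mu$ (the upper left vertices of the cells that can be added to $\mu$) and $u_1<\dots<u_{N-1}$ those of its outer corners (the lower right vertices of the cells that can be removed), so $v_1<u_1<v_2<\dots<u_{N-1}<v_N$; put $u_0=-a$, $u_N=b$. Here the vertex with $x$ rows above it and $y$ columns to its left has position $y-x$. Let $$B(t)=\tfrac12\sum_{i=1}^N|t-v_i|-\tfrac12\sum_{i=1}^{N-1}|t-u_i| .$$ A skew plane partition $\pi$ is an array of integers $\pi_{ij}\ge 0$, $(i,j)\in (a\times b)/\mu$, with $\pi_{ij}\ge\pi_{i+r,j+s}$ for $r,s\ge 0$; put $\pi_{ij}=0$ for cells $(i,j)\notin\mu$ outside the box. Let $|\pi_t|=\sum_i\pi_{i,t+i}$. For $0\le q_t<1$ ($-a<t<b$) let $Z=\sum_\pi\prod_{t}q_t^{|\pi_t|}$ and let $\pi$ have probability $Z^{-1}\prod_t q_t^{|\pi_t|}$. The horizontal tiles of $\pi$ are centred at the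 points of $\sigma(\pi)=\{(j-i,\ \pi_{ij}-\tfrac{i+j-1}2): (i,j)\in\mathbb N^2\setminus\mu\}$; all of them lie in the lattice $\mathcal L=\{(t,h): t\in\mathbb Z,\ h+\tfrac t2+\tfrac12\in\mathbb Z\}$. Let $\rho_{h,t}(\pi)=1$ if $(t,h)\in\sigma(\pi)$ and $0$ otherwise, and let $\langle\cdot\rangle$ be the expectation. For $(t,h)\in\mathcal L$ the number $j=h+B(t)$ is a half-integer. For $m\in\mathbb Z+\frac12$ put $m\in D^+$, $\varepsilon(m)=+$, if $v_i<m<u_i$ for some $1\le i\le N$, and $m\in D^-$, $\varepsilon(m)=-$, if $u_i<m<v_{i+1}$ for some $0\le i\le N-1$. Let $x^+_m$ ($m\in D^+$) and $x^-_m$ ($m\in D^-$) be positive numbers such that $$\frac{x^+_{m+1}}{x^+_m}=q_{m+\frac12}\ (v_i<m<u_i-1,\ 1\le i\le N),\qquad \frac{x^-_m}{x^-_{m+1}}=q_{m+\frac12}\ (u_i<m<v_{i+1}-1,\ 0\le i\le N-1),$$ $$x^+_{u_i-\frac12}x^-_{u_i+\frac12}=q_{u_i}^{-1}\ (1\le i\le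 N-1),\qquad x^-_{v_i-\frac12}x^+_{v_i+\frac12}=q_{v_i}\ (-a<v_i<b).$$ Let $F$ be the fermionic Fock space, with orthonormal basis $v_S=\underline{s_1}\wedge\underline{s_2}\wedge\cdots$, where $S=\{s_1>s_2>\cdots\}\subset\mathbb Z+\frac12$ differs from $\{k\le-\frac12\}$ by finitely many elements. Let $\psi_k$ be the exterior multiplication by $\underline k$ on the left, $\psi_k^*$ its adjoint, $v_0^{(c)}=\underline{c-\tfrac12}\wedge\underline{c-\tfrac32}\wedge\cdots$ for $c\in\mathbb Z$, $\alpha_n=\sum_k\psi_{k+n}\psi^*_k$ for $n\neq 0$, and $\Gamma_\pm(x)=\exp\big(\sum_{n\ge1}\frac{x^n}n\alpha_{\pm n}\big)$, as formal power series in $x$. A matrix element of a product of vertex operators and fermions is a power series in the variables of the vertex operators, and it is evaluated at the given numbers $x_m^\pm$. Products over $m$ are ordered with $m$ decreasing from left to right. **Theorem.** The sum $Z$ converges, the power series of the matrix elements in (1) and (2) converge absolutely, and the following holds. 1. For every $c\in\mathbb Z$ (in particular for $c=0$) $$Z=\Big(\prod_{u_0<m<u_N}\Gamma_{-\varepsilon(m)}(x_m^{\varepsilon(m)})\,v_0^{(c)},v_0^{(c)}\Big),\qquad\text{and}\qquad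 Z=\prod_{m_1<m_2,\ m_1\in D^-,\ m_2\in D^+}(1-x^-_{m_1}x^+_{m_2})^{-1}.$$ 2. If $(t_i,h_i)\in\mathcal L$, $t_1>\dots>t_n$ and $j_i=h_i+B(t_i)$, then $$\langle\rho_{h_1,t_1}\cdots\rho_{h_n,t_n}\rangle=\frac1Z\Big(\prod_{m>t_1}\Gamma_{-\varepsilon(m)}(x_m^{\varepsilon(m)})\,\psi_{j_1}\psi_{j_1}^*\prod_{t_2<m<t_1}\Gamma_{-\varepsilon(m)}(x_m^{\varepsilon(m)})\,\psi_{j_2}\psi_{j_2}^*\cdots\psi_{j_n}\psi^*_{j_n}\prod_{m<t_n}\Gamma_{-\varepsilon(m)}(x_m^{\varepsilon(m)})\,v_0^{(0)},v_0^{(0)}\Big),$$ where all $m$ are restricted to $u_0<m<u_N$. 3. For pairwise distinct points $(t_i,h_i)\in\mathcal L$, $1\le i\le n$, $$\langle\rho_{h_1,t_1}\cdots\rho_{h_n,t_n}\rangle=\det\big(K((t_i,h_i),(t_k,h_k))\big)_{1\le i,k\le n},$$ $$K((t_1,h_1),(t_2,h_2))=\frac1{(2\pi i)^2}\oint_{|z|=r}\oint_{|w|=s}\frac{\Phi_-(z,t_1)\Phi_+(w,t_2)}{\Phi_+(z,t_1)\Phi_-(w,t_2)}\,\frac{\sqrt{zw}}{z-w}\,z^{-h_1-B(t_1)}\,w^{h_2+B(t_2)}\,\frac{dz\,dw}{zw},$$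 where $\sqrt{zw}\,z^{-j_1}w^{j_2}/(zw)$ stands for $z^{-j_1-\frac12}w^{j_2-\frac12}$ (integer exponents), $$\Phi_+(z,t)=\prod_{m>t,\ m\in D^+}(1-zx^+_m),\qquad \Phi_-(z,t)=\prod_{m<t,\ m\in D^-}(1-z^{-1}x^-_m),$$ and $r,s>0$ are any radii with $r<R(t_1)=\min_{m>t_1,\,m\in D^+}(x_m^+)^{-1}$, $s>R^*(t_2)=\max_{m<t_2,\,m\in D^-}x_m^-$ (the empty minimum is $\infty$, the empty maximum is $0$), and $s<r$ if $t_1\ge t_2$, $s>r$ if $t_1<t_2$. Such radii exist for all $t_1,t_2\in\mathbb Z$. -/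

import Mathlib

/-!
Half-integers `m = n + 1/2` are encoded throughout by the integer `n = m - 1/2`.
This applies to the positions `m` of the vertex operators, to the labels of the basis
vectors of `V`, and to the indices of the fermions.  So `t < m` reads `t ≤ n`,
and `m < t` reads `n < t`, for an integer `t`.
-/

noncomputable section

namespace SkewPP

/-! ### Inner shapes, corners and skew plane partitions -/

/-- Positions `t = j - i` of the inner corners of the inner shape `μ`: the upper left vertices of
the cells that can be added to `μ` (rows `i` and columns `j` are counted from `0`). -/
def innerCorners (μ : YoungDiagram) : Set ℤ :=
  {t | ∃ i j : ℕ, t = (j : ℤ) - i ∧ (i, j) ∉ μ ∧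
    (∀ i', i' + 1 = i → (i', j) ∈ μ) ∧ (∀ j', j' + 1 = j → (i, j') ∈ μ)}

/-- Positions `t = j - i` of the outer corners of `μ`: the lower right vertices of
the cells that can be removed from `μ`. -/
def outerCorners (μ : YoungDiagram) : Set ℤ :=
  {t | ∃ i j : ℕ, t = (j : ℤ) - i ∧ (i, j) ∈ μ ∧ (i + 1, j) ∉ μ ∧ (i, j + 1) ∉ μ}

/-- An inner shape `μ` inside an `a × b` box, with its inner corners
`v 1 < ⋯ < v N` and outer corners `u 1 < ⋯ < u (N - 1)` listed in increasing order, and with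
`u 0 = -a`, `u N = b`.  Other values of `v` and `u` are not used. -/
structure SkewShape where
  a : ℕ
  b : ℕ
  μ : YoungDiagram
  fits : ∀ i j : ℕ, (i, j) ∈ μ → i < a ∧ j < b
  N : ℕ
  v : ℕ → ℤ
  u : ℕ → ℤ
  u_zero : u 0 = -(a : ℤ)
  u_last : u N = (b : ℤ)
  interlace : ∀ i, 1 ≤ i → i < N → v i < u i ∧ u i < v (i + 1)
  inner_eq : v '' Set.Icc 1 N = innerCorners μ
  outer_eq : u '' Set.Ico 1 N = outerCorners μ

namespace SkewShape

/-- `B(t) = (1/2) ∑ |t - v_i| - (1/2) ∑ |t - u_i|`. -/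
def B (P : SkewShape) (t : ℤ) : ℚ :=
  (1 / 2) * ∑ i ∈ Finset.Icc 1 P.N, |(t : ℚ) - P.v i| -
    (1 / 2) * ∑ i ∈ Finset.Ico 1 P.N, |(t : ℚ) - P.u i|

/-- `D⁺`: half-integers `m` with `v_i < m < u_i` for some `1 ≤ i ≤ N`. -/
def Dplus (P : SkewShape) : Set ℤ :=
  {n | ∃ i, 1 ≤ i ∧ i ≤ P.N ∧ P.v i ≤ n ∧ n < P.u i}

/-- `D⁻`: half-integers `m` with `u_i < m < v_{i+1}` for some `0 ≤ i ≤ N - 1`. -/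
def Dminus (P : SkewShape) : Set ℤ :=
  {n | ∃ i, i < P.N ∧ P.u i ≤ n ∧ n < P.v (i + 1)}

end SkewShape

/-- Skew plane partitions with inner shape `μ` and outer shape the `a × b` box.  The array is
extended by `0` to all cells that are not in the skew shape. -/
structure SkewPlanePartition (P : SkewShape) where
  entry : ℕ → ℕ → ℕ
  entry_eq_zero : ∀ i j, ¬ (i < P.a ∧ j < P.b ∧ (i, j) ∉ P.μ) → entry i j = 0
  mono : ∀ i j r s, (i, j) ∉ P.μ → i + r < P.a → j + s < P.b →
    entry (i + r) (j + s) ≤ entry i j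

/-- `|π_t| = ∑_i π_{i,t+i}`, the size of the diagonal slice `λ(t)`. -/
def sliceSize {P : SkewShape} (π : SkewPlanePartition P) (t : ℤ) : ℕ :=
  ∑ c ∈ (Finset.range P.a ×ˢ Finset.range P.b).filter (fun c => (c.2 : ℤ) - c.1 = t),
    π.entry c.1 c.2

/-- The weight `∏_t q_t^{|π_t|}`; the slices with `t ≤ -a` or `t ≥ b` are empty. -/
def weight {P : SkewShape} (q : ℤ → ℝ) (π : SkewPlanePartition P) : ℝ :=
  ∏ t ∈ Finset.Ioo (-(P.a : ℤ)) (P.b : ℤ), q t ^ sliceSize π t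

/-- The partition function `Z`. -/
def partitionFunction (P : SkewShape) (q : ℤ → ℝ) : ℝ :=
  ∑' π : SkewPlanePartition P, weight q π

/-- The set `σ(π)` of the centres `(t, h)` of the horizontal tiles.  A cell in row `i` and column
`j` (counted from `0`) gives the tile `(j - i, π_{ij} - (i + j + 1) / 2)`; all cells of the
quadrant outside `μ` count, those beyond the box carry height `0`. -/
def tiles {P : SkewShape} (π : SkewPlanePartition P) : Set (ℤ × ℚ) :=
  {p | ∃ i j : ℕ, (i, j) ∉ P.μ ∧
    p = ((j : ℤ) - i, (π.entry i j : ℚ) - ((i : ℚ) + j + 1) / 2)}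

/-- The lattice of possible tile centres: `h + t/2 + 1/2` is an integer. -/
def IsSite (p : ℤ × ℚ) : Prop := ∃ k : ℤ, p.2 + (p.1 : ℚ) / 2 + 1 / 2 = k

open scoped Classical in
/-- The local function `ρ_{h,t}(π)`. -/
def localDensity {P : SkewShape} (p : ℤ × ℚ) (π : SkewPlanePartition P) : ℝ :=
  if p ∈ tiles π then 1 else 0

/-- The correlation function `⟨ρ_{h_1,t_1} ⋯ ρ_{h_n,t_n}⟩`. -/
def correlation (P : SkewShape) (q : ℤ → ℝ) {n : ℕ} (p : Fin n → ℤ × ℚ) : ℝ :=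
  (1 / partitionFunction P q) *
    ∑' π : SkewPlanePartition P, (∏ i, localDensity (p i) π) * weight q π

/-- The positive parameters `x⁺_m` (`m ∈ D⁺`) and `x⁻_m` (`m ∈ D⁻`) are related to the `q_t`. -/
structure IsVertexParam (P : SkewShape) (q xp xm : ℤ → ℝ) : Prop where
  xp_pos : ∀ n ∈ P.Dplus, 0 < xp n
  xm_pos : ∀ n ∈ P.Dminus, 0 < xm n
  /-- `x⁺_{m+1} / x⁺_m = q_{m+1/2}` for `v_i < m < u_i - 1`. -/
  ratio_plus : ∀ i, 1 ≤ i → i ≤ P.N → ∀ n, P.v i ≤ n → n + 1 < P.u i →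
    xp (n + 1) / xp n = q (n + 1)
  /-- `x⁺_{u_i-1/2} x⁻_{u_i+1/2} = q_{u_i}⁻¹`. -/
  at_outer : ∀ i, 1 ≤ i → i < P.N → xp (P.u i - 1) * xm (P.u i) = (q (P.u i))⁻¹
  /-- `x⁻_{v_i-1/2} x⁺_{v_i+1/2} = q_{v_i}`, when `v_i` is not on the boundary of the box. -/
  at_inner : ∀ i, 1 ≤ i → i ≤ P.N → -(P.a : ℤ) < P.v i → P.v i < P.b →
    xm (P.v i - 1) * xp (P.v i) = q (P.v i)
  /-- `x⁻_m / x⁻_{m+1} = q_{m+1/2}` for `u_i < m < v_{i+1} - 1`. -/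
  ratio_minus : ∀ i, i < P.N → ∀ n, P.u i ≤ n → n + 1 < P.v (i + 1) →
    xm n / xm (n + 1) = q (n + 1)

open scoped Classical in
/-- The pairs `(m₁, m₂)` with `m₁ < m₂`, `m₁ ∈ D⁻`, `m₂ ∈ D⁺`. -/
def orderedPairs (P : SkewShape) : Finset (ℤ × ℤ) :=
  (Finset.Ico (-(P.a : ℤ)) (P.b : ℤ) ×ˢ Finset.Ico (-(P.a : ℤ)) (P.b : ℤ)).filter
    fun m => m.1 < m.2 ∧ m.1 ∈ P.Dminus ∧ m.2 ∈ P.Dplus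

/-! ### The fermionic Fock space, the Clifford algebra and the vertex operators -/

/-- The index sets `S` of the basis vectors `v_S`: `S` differs from `{k ≤ -1/2}` by finitely
many elements. -/
@[ext] structure Maya where
  carrier : Set ℤ
  finite_pos : (carrier \ Set.Iio 0).Finite
  finite_neg : (Set.Iio 0 \ carrier).Finite

/-- The fermionic Fock space with basis `v_S`. -/
abbrev Fock : Type := Maya →₀ ℂ

/-- The basis vector `v_S`. -/
def basisVec (S : Maya) : Fock := Finsupp.single S 1

/-- The symmetric scalar product in which the `v_S` are orthonormal. -/
def pairing (v w : Fock) : ℂ := v.sum fun S c => c * w S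

/-- Adjoin `k` to `S`. -/
def Maya.adjoin (k : ℤ) (S : Maya) : Maya :=
  ⟨insert k S.carrier,
    (S.finite_pos.insert k).subset (by
      rintro x ⟨hx | hx, h0⟩
      · exact Or.inl hx
      · exact Or.inr ⟨hx, h0⟩),
    S.finite_neg.subset fun _ hx => ⟨hx.1, fun h => hx.2 (Or.inr h)⟩⟩

/-- Remove `k` from `S`. -/
def Maya.remove (k : ℤ) (S : Maya) : Maya :=
  ⟨S.carrier \ {k}, S.finite_pos.subset fun _ hx => ⟨hx.1.1, hx.2⟩,
    (S.finite_neg.insert k).subset (by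
      rintro x ⟨h0, hx⟩
      by_cases hk : x = k
      · exact Or.inl hk
      · exact Or.inr ⟨h0, fun h => hx ⟨h, hk⟩⟩)⟩

/-- The sign `(-1)^l` with `l` the number of elements of `S` larger than `k`. -/
def wedgeSign (k : ℤ) (S : Maya) : ℂ := (-1) ^ (S.carrier ∩ Set.Ioi k).ncard

open scoped Classical in
/-- `ψ_k`: exterior multiplication on the left by the basis vector `k`. -/
def psi (k : ℤ) : Module.End ℂ Fock :=
  Finsupp.linearCombination ℂ fun S : Maya =>
    if k ∈ S.carrier then (0 : Fock) else wedgeSign k S • basisVec (S.adjoin k)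

open scoped Classical in
/-- `ψ*_k`: removes the factor `k`, with sign, or gives `0` when `k ∉ S`. -/
def psiStar (k : ℤ) : Module.End ℂ Fock :=
  Finsupp.linearCombination ℂ fun S : Maya =>
    if k ∈ S.carrier then wedgeSign k S • basisVec (S.remove k) else (0 : Fock)

/-- `α_n = ∑_k ψ_{k+n} ψ*_k` for `n ≠ 0`; on each `v_S` only finitely many terms are nonzero. -/
def alpha (n : ℤ) : Module.End ℂ Fock :=
  Finsupp.linearCombination ℂ fun S : Maya =>
    ∑ᶠ k : ℤ, psi (k + n) (psiStar k (basisVec S))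

/-- The exponential `∑_k A^k / k!` of a formal power series `A` without constant term, with
coefficients in a (noncommutative) complex algebra. -/
def expSeries {R : Type*} [Ring R] [Algebra ℂ R] (A : PowerSeries R) : PowerSeries R :=
  PowerSeries.mk fun n =>
    ∑ k ∈ Finset.range (n + 1), ((k.factorial : ℂ)⁻¹) • PowerSeries.coeff n (A ^ k)

/-- `Γ₊(x) = exp (∑_{n ≥ 1} (x^n / n) α_n)`, a formal power series in `x`. -/
def GammaPlus : PowerSeries (Module.End ℂ Fock) :=
  expSeries (PowerSeries.mk fun n => if n = 0 then 0 else ((n : ℂ)⁻¹) • alpha (n : ℤ))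

/-- `Γ₋(x) = exp (∑_{n ≥ 1} (x^n / n) α_{-n})`, a formal power series in `x`. -/
def GammaMinus : PowerSeries (Module.End ℂ Fock) :=
  expSeries (PowerSeries.mk fun n => if n = 0 then 0 else ((n : ℂ)⁻¹) • alpha (-(n : ℤ)))

/-- The vacuum vector `v_0^{(c)}` of charge `c`: the wedge of all `k ≤ c - 1/2`. -/
def vacuum (c : ℤ) : Fock :=
  basisVec ⟨Set.Iio c,
    (Set.finite_Ico 0 c).subset fun _ hx => ⟨not_lt.mp hx.2, hx.1⟩,
    (Set.finite_Ico c 0).subset fun _ hx => ⟨not_lt.mp hx.2, hx.1⟩⟩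

/-- A factor of an operator product: a formal power series in a variable of its own, and the
number to be substituted for that variable. -/
abbrev Factor : Type := ℂ × PowerSeries (Module.End ℂ Fock)

/-- An operator without variable, as a factor. -/
def constFactor (A : Module.End ℂ Fock) : Factor := (1, PowerSeries.C A)

/-- The term of multidegree `n` of the power series
`(A_1(x_1) A_2(x_2) ⋯ A_l(x_l) v, w)`. -/
def matrixTerm (W : List Factor) (v w : Fock) (n : Fin W.length → ℕ) : ℂ :=
  (∏ i, (W.get i).1 ^ n i) *
    pairing ((List.ofFn fun i => PowerSeries.coeff (n i) (W.get i).2).prod v) w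

/-- The matrix element `(A_1(x_1) ⋯ A_l(x_l) v, w)`, as the sum of its power series. -/
def matrixElement (W : List Factor) (v w : Fock) : ℂ :=
  ∑' n : Fin W.length → ℕ, matrixTerm W v w n

open scoped Classical in
/-- `Γ_{-ε(m)}(x_m^{ε(m)})`. -/
def vertexFactor (P : SkewShape) (xp xm : ℤ → ℝ) (n : ℤ) : Factor :=
  if n ∈ P.Dplus then ((xp n : ℂ), GammaMinus) else ((xm n : ℂ), GammaPlus)

/-- `∏ Γ_{-ε(m)}(x_m^{ε(m)})` over the half-integers `m` with `s < m < t` and `-a < m < b`,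
with `m` decreasing from left to right. -/
def vertexWord (P : SkewShape) (xp xm : ℤ → ℝ) (s t : ℤ) : List Factor :=
  (List.range (min t P.b - max s (-(P.a : ℤ))).toNat).map fun k : ℕ =>
    vertexFactor P xp xm (min t P.b - 1 - k)

/-- For a list `(t_1, j_1), (t_2, j_2), …, (t_n, j_n)` the operator product
`∏_{t_1 < m < T} Γ ψ_{j_1} ψ*_{j_1} ∏_{t_2 < m < t_1} Γ ψ_{j_2} ψ*_{j_2} ⋯
ψ_{j_n} ψ*_{j_n} ∏_{-a < m < t_n} Γ`. -/
def correlationWord (P : SkewShape) (xp xm : ℤ → ℝ) : ℤ → List (ℤ × ℤ) → List Factor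
  | T, [] => vertexWord P xp xm (-(P.a : ℤ)) T
  | T, (t, j) :: L =>
      vertexWord P xp xm t T ++ [constFactor (psi j), constFactor (psiStar j)] ++
        correlationWord P xp xm t L

/-- The fermion index `j = h + B(t)` of a site `(t, h)`.  It is a half-integer, encoded by
`j - 1/2`. -/
def mode (P : SkewShape) (p : ℤ × ℚ) : ℤ := ⌊p.2 + P.B p.1⌋

/-! ### The correlation kernel -/

open scoped Classical in
/-- `Φ₊(z,t) = ∏_{m > t, m ∈ D⁺} (1 - z x⁺_m)`. -/
def PhiPlus (P : SkewShape) (xp : ℤ → ℝ) (z : ℂ) (t : ℤ) : ℂ :=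
  ∏ n ∈ (Finset.Ico (-(P.a : ℤ)) (P.b : ℤ)).filter (fun n => t ≤ n ∧ n ∈ P.Dplus),
    (1 - z * (xp n : ℂ))

open scoped Classical in
/-- `Φ₋(z,t) = ∏_{m < t, m ∈ D⁻} (1 - z⁻¹ x⁻_m)`. -/
def PhiMinus (P : SkewShape) (xm : ℤ → ℝ) (z : ℂ) (t : ℤ) : ℂ :=
  ∏ n ∈ (Finset.Ico (-(P.a : ℤ)) (P.b : ℤ)).filter (fun n => n < t ∧ n ∈ P.Dminus),
    (1 - z⁻¹ * (xm n : ℂ))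

/-- Admissible radii of the circles `|z| = r`, `|w| = s` for the pair of times `t₁, t₂`:
`r < R(t₁)`, `s > R*(t₂)`, and `s < r` if `t₁ ≥ t₂`, `s > r` if `t₁ < t₂`. -/
structure AdmissibleRadii (P : SkewShape) (xp xm : ℤ → ℝ) (t₁ t₂ : ℤ) (r s : ℝ) : Prop where
  r_pos : 0 < r
  s_pos : 0 < s
  r_lt : ∀ n ∈ P.Dplus, t₁ ≤ n → r < |xp n|⁻¹
  lt_s : ∀ n ∈ P.Dminus, n < t₂ → |xm n| < s
  s_lt_r : t₂ ≤ t₁ → s < r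
  r_lt_s : t₁ < t₂ → r < s

/-- The kernel, with the integrals over `|z| = r` and `|w| = s`.  With `j_k = h_k + B(t_k)`
the factor `√(zw) z^{-j₁} w^{j₂} / (zw)` is `z^{-(j₁ + 1/2)} w^{j₂ - 1/2}`, with integer
exponents. -/
def kernel (P : SkewShape) (xp xm : ℤ → ℝ) (p₁ p₂ : ℤ × ℚ) (r s : ℝ) : ℂ :=
  (1 / (2 * (Real.pi : ℂ) * Complex.I) ^ 2) *
    ∮ z in C(0, r), ∮ w in C(0, s),
      (PhiMinus P xm z p₁.1 * PhiPlus P xp w p₂.1) /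
          (PhiPlus P xp z p₁.1 * PhiMinus P xm w p₂.1) *
        (1 / (z - w)) * z ^ (-(mode P p₁ + 1)) * w ^ (mode P p₂)

end SkewPP

end

/-!
The proof encodes a skew plane partition by its diagonal slices and computes with operators on the
fermionic Fock space.

**Combinatorics.** The slices of a skew plane partition at neighbouring positions interlace. Which of
the two is the larger one is decided by the step of the boundary path of `μ` between the positions
(`StepRight`, which distinguishes `D⁺` from `D⁻`), and interlacing characterizes skew plane partitions
(`exists_path_eq`). A slice is recorded by its index set; by the formula `B_eq` for the profile of
`μ`, the elements of the index set at position `t` are the modes of the tiles at `t`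
(`modeIndicator_path`). As `q_t` is the quotient of the parameters of the neighbouring vertex
operators (`IsVertexParam.q_eq`), summation by parts turns the weight of a skew plane partition into
a product over the steps of its path (`IsVertexParam.prod_stepWeight`).

**The Pieri rule.** The coefficients of `Γ₊` and `Γ₋` have matrix elements `1` for interlacing index
sets and `0` otherwise (`gp_apply`, `gm_apply`). Both the operators and the interlacing matrices
satisfy commutation relations with the fermions (`PieriRel`), and these together with one vacuum
matrix element determine them, because a matrix that commutes with all fermions is a scalar
(`matrix_eq_zero_of_commute`). As `ψ_j ψ*_j` is the indicator of the mode `j`, all terms of the matrix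
elements in question are nonnegative, and the matrix elements are sums over paths of diagrams
(`NonnegParam.correlationWord`, `IsVertexParam.pathSum_eq`), that is, over skew plane partitions.

**The algebra of vertex operators.** All vertex operators `Γ(x)` are replaced by the power series
`Γ(x s)` in one formal variable `s`. Normal ordering (`GM_mul_GP`, `wordOp_eq`) gives the product
formula. A fermion moved through a vertex operator is smeared with a power series in `s` of Laurent
polynomials, its symbol, so that a product of fermions and vertex operators becomes a product of
fermions with symbols `fNormal`, `gNormal` times the vertex operators (`wordE_correlationWord`).
Wick's theorem (`wick`) then gives the vacuum expectation value as a determinant of power series in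
`s` (`vev_correlationWord`).

**Convergence.** The parameters `1 / x⁺_m`, `x⁻_m` form a strictly increasing sequence
(`IsVertexParam.param_lt`), so the product formula converges at `s = 1`. Since all terms are
nonnegative, this proves the absolute convergence of all series in question, and values may be
computed at `s = 1` (`HasValue`). The entries of the determinant are constant terms of products of
normally convergent Laurent series, truncated to exponents of one sign; truncation is a Cauchy
integral, inside or outside the circle according to the order of the times
(`Represents.cauchy`, `AdmissibleRadii.hasValue_of_le`, `AdmissibleRadii.hasValue_of_lt`). At equal
times the symbols of `ψ` and `ψ*` are inverse to each other, so both truncations give the same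
entries for distinct modes (`neg_ctH_posH_eq`), and points in any order are reduced to weakly
decreasing times by a permutation (`IsVertexParam.correlation_eq_det`).
-/

noncomputable section

open scoped Classical

namespace SkewPP

/-! ### Fermions and counting functions -/

/-- The number of elements of `S` that are at least `j`. -/
def Maya.count (S : Maya) (j : ℤ) : ℕ := (S.carrier ∩ Set.Ici j).ncard

lemma Maya.finite_inter_Ici (S : Maya) (j : ℤ) : (S.carrier ∩ Set.Ici j).Finite := by
  refine (S.finite_pos.union (Set.finite_Ico j 0)).subset ?_
  rintro x ⟨hx, hj⟩
  by_cases h : x < 0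
  · exact Or.inr ⟨hj, h⟩
  · exact Or.inl ⟨hx, h⟩

lemma Maya.count_step (S : Maya) (j : ℤ) :
    S.count j = S.count (j + 1) + if j ∈ S.carrier then 1 else 0 := by
  unfold Maya.count
  split_ifs with h
  · rw [← Set.ncard_insert_of_notMem (a := j) (by simp) (S.finite_inter_Ici _)]
    congr 1
    ext x
    simp only [Set.mem_inter_iff, Set.mem_Ici, Set.mem_insert_iff]
    constructor
    · rintro ⟨h1, h2⟩
      rcases eq_or_lt_of_le h2 with h3 | h3
      · exact Or.inl h3.symm
      · exact Or.inr ⟨h1, h3⟩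
    · rintro (rfl | ⟨h1, h2⟩)
      · exact ⟨h, le_rfl⟩
      · exact ⟨h1, by omega⟩
  · rw [add_zero]
    congr 1
    ext x
    simp only [Set.mem_inter_iff, Set.mem_Ici]
    constructor
    · rintro ⟨h1, h2⟩
      refine ⟨h1, ?_⟩
      rcases eq_or_lt_of_le h2 with h3 | h3
      · exact absurd (h3 ▸ h1) h
      · exact h3
    · rintro ⟨h1, h2⟩
      exact ⟨h1, by omega⟩

lemma Maya.mem_adjoin {k x : ℤ} {S : Maya} :
    x ∈ (S.adjoin k).carrier ↔ x = k ∨ x ∈ S.carrier := Iff.rfl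

lemma Maya.mem_remove {k x : ℤ} {S : Maya} :
    x ∈ (S.remove k).carrier ↔ x ∈ S.carrier ∧ x ≠ k := Iff.rfl

lemma Maya.mem_adjoin_self (k : ℤ) (S : Maya) : k ∈ (S.adjoin k).carrier := Or.inl rfl

lemma Maya.notMem_remove_self (k : ℤ) (S : Maya) : k ∉ (S.remove k).carrier := fun h => h.2 rfl

lemma Maya.remove_adjoin {k : ℤ} {S : Maya} (h : k ∉ S.carrier) :
    (S.adjoin k).remove k = S := by
  ext x
  simp only [Maya.mem_adjoin, Maya.mem_remove]
  constructor
  · tauto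
  · intro hx
    exact ⟨Or.inr hx, fun e => h (e ▸ hx)⟩

lemma Maya.adjoin_remove {k : ℤ} {S : Maya} (h : k ∈ S.carrier) :
    (S.remove k).adjoin k = S := by
  ext x
  simp only [Maya.mem_adjoin, Maya.mem_remove]
  constructor
  · rintro (rfl | h) <;> tauto
  · tauto

lemma Maya.eq_remove_iff {k : ℤ} {S T : Maya} (h : k ∉ S.carrier) :
    T = S.adjoin k ↔ k ∈ T.carrier ∧ T.remove k = S := by
  constructor
  · rintro rfl
    exact ⟨Or.inl rfl, Maya.remove_adjoin h⟩
  · rintro ⟨h1, rfl⟩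
    exact (Maya.adjoin_remove h1).symm

lemma Maya.count_adjoin {l : ℤ} {S : Maya} (h : l ∉ S.carrier) (j : ℤ) :
    (S.adjoin l).count j = S.count j + if j ≤ l then 1 else 0 := by
  unfold Maya.count
  split_ifs with hj
  · rw [← Set.ncard_insert_of_notMem (a := l) (fun hl => h hl.1) (S.finite_inter_Ici _)]
    congr 1
    ext x
    simp only [Set.mem_inter_iff, Set.mem_Ici, Set.mem_insert_iff, Maya.mem_adjoin]
    constructor
    · tauto
    · rintro (rfl | h) <;> tauto
  · rw [add_zero]
    congr 1
    ext x
    simp only [Set.mem_inter_iff, Set.mem_Ici, Maya.mem_adjoin]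
    constructor
    · rintro ⟨rfl | h1, h2⟩ <;> tauto
    · tauto

lemma Maya.count_remove {l : ℤ} {S : Maya} (h : l ∈ S.carrier) (j : ℤ) :
    S.count j = (S.remove l).count j + if j ≤ l then 1 else 0 := by
  conv_lhs => rw [← Maya.adjoin_remove h]
  exact Maya.count_adjoin (Maya.notMem_remove_self _ _) j

lemma wedgeSign_eq (k : ℤ) (S : Maya) : wedgeSign k S = (-1) ^ S.count (k + 1) := rfl

lemma wedgeSign_mul_self (k : ℤ) (S : Maya) : wedgeSign k S * wedgeSign k S = 1 := by
  rw [wedgeSign_eq, ← mul_pow]; simp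

lemma wedgeSign_ne_zero (k : ℤ) (S : Maya) : wedgeSign k S ≠ 0 := by
  rw [wedgeSign_eq]; exact pow_ne_zero _ (by norm_num)

lemma wedgeSign_adjoin {l : ℤ} {S : Maya} (h : l ∉ S.carrier) (k : ℤ) :
    wedgeSign k (S.adjoin l) = wedgeSign k S * if k < l then -1 else 1 := by
  rw [wedgeSign_eq, wedgeSign_eq, Maya.count_adjoin h, pow_add]
  congr 1
  by_cases hk : k < l
  · rw [if_pos hk, if_pos (by omega), pow_one]
  · rw [if_neg hk, if_neg (by omega), pow_zero]

lemma wedgeSign_remove {l : ℤ} {S : Maya} (h : l ∈ S.carrier) (k : ℤ) :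
    wedgeSign k (S.remove l) = wedgeSign k S * if k < l then -1 else 1 := by
  conv_rhs => rw [← Maya.adjoin_remove h, wedgeSign_adjoin (Maya.notMem_remove_self _ _)]
  split_ifs <;> ring

/-- The coefficient of `v_T` in `ψ_k v`. -/
lemma psi_apply (k : ℤ) (v : Fock) (T : Maya) :
    psi k v T = if k ∈ T.carrier then wedgeSign k T * v (T.remove k) else 0 := by
  induction v using Finsupp.induction_linear with
  | zero => simp
  | add f g hf hg =>
    rw [map_add, Finsupp.add_apply, hf, hg, Finsupp.add_apply]
    split_ifs <;> ring
  | single S c =>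
    simp only [psi, Finsupp.linearCombination_single, basisVec]
    by_cases hS : k ∈ S.carrier
    · rw [if_pos hS, smul_zero]
      split_ifs with h
      · rw [Finsupp.single_eq_of_ne, mul_zero]; rfl
        rintro rfl
        exact hS.2 rfl
      · rfl
    · rw [if_neg hS]
      simp only [Finsupp.smul_single, Finsupp.single_apply, smul_eq_mul, mul_one]
      by_cases h : S.adjoin k = T
      · have h' := (Maya.eq_remove_iff hS).1 h.symm
        rw [if_pos h, if_pos h'.1, if_pos h'.2.symm, ← h'.2, wedgeSign_remove h'.1]
        simp [mul_comm]
      · rw [if_neg h]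
        split_ifs with h1 h2
        · exact absurd ((Maya.eq_remove_iff hS).2 ⟨h1, h2.symm⟩).symm h
        · simp
        · rfl

/-- The coefficient of `v_T` in `ψ*_k v`. -/
lemma psiStar_apply (k : ℤ) (v : Fock) (T : Maya) :
    psiStar k v T = if k ∈ T.carrier then 0 else wedgeSign k T * v (T.adjoin k) := by
  induction v using Finsupp.induction_linear with
  | zero => simp
  | add f g hf hg =>
    rw [map_add, Finsupp.add_apply, hf, hg, Finsupp.add_apply]
    split_ifs <;> ring
  | single S c =>
    simp only [psiStar, Finsupp.linearCombination_single, basisVec]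
    by_cases hS : k ∈ S.carrier
    · rw [if_pos hS]
      simp only [Finsupp.smul_single, Finsupp.single_apply, smul_eq_mul, mul_one]
      by_cases hT : k ∈ T.carrier
      · rw [if_pos hT, if_neg]
        rintro rfl
        exact hT.2 rfl
      · rw [if_neg hT]
        by_cases h : S = T.adjoin k
        · subst h
          rw [Maya.remove_adjoin hT, if_pos rfl, if_pos rfl, wedgeSign_adjoin hT]
          simp [mul_comm]
        · rw [if_neg h, if_neg, mul_zero]
          rintro rfl
          exact h (Maya.adjoin_remove hS).symm
    · rw [if_neg hS, smul_zero]
      split_ifs with h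
      · rfl
      · rw [Finsupp.single_eq_of_ne, mul_zero]; rfl
        rintro rfl
        exact hS (Or.inl rfl)

lemma psi_basisVec_of_notMem {k : ℤ} {S : Maya} (h : k ∉ S.carrier) :
    psi k (basisVec S) = wedgeSign k S • basisVec (S.adjoin k) := by
  simp [psi, basisVec, h]

lemma psi_basisVec_of_mem {k : ℤ} {S : Maya} (h : k ∈ S.carrier) :
    psi k (basisVec S) = 0 := by
  simp [psi, basisVec, h]

lemma psiStar_basisVec_of_mem {k : ℤ} {S : Maya} (h : k ∈ S.carrier) :
    psiStar k (basisVec S) = wedgeSign k S • basisVec (S.remove k) := by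
  simp [psiStar, basisVec, h]

lemma psiStar_basisVec_of_notMem {k : ℤ} {S : Maya} (h : k ∉ S.carrier) :
    psiStar k (basisVec S) = 0 := by
  simp [psiStar, basisVec, h]

/-- The canonical anticommutation relations, here and in the next two lemmas. -/
lemma psi_mul_psi (k l : ℤ) : psi k * psi l = -(psi l * psi k) := by
  ext S T
  by_cases hkl : k = l
  · subst hkl
    have : ∀ v, psi k (psi k v) T = 0 := fun v => by
      rw [psi_apply, psi_apply]
      simp [Maya.mem_remove]
    simp [this]
  simp only [LinearMap.coe_comp, Function.comp_apply, Module.End.mul_apply,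
    LinearMap.neg_apply, Finsupp.neg_apply, psi_apply, Maya.mem_remove]
  by_cases hk : k ∈ T.carrier <;> by_cases hl : l ∈ T.carrier <;>
    simp only [hk, hl, hkl, Ne.symm hkl, ne_eq, not_false_eq_true, and_self, if_true, if_false,
      and_true, neg_zero, mul_zero]
  rw [wedgeSign_remove hk, wedgeSign_remove hl]
  have e : (T.remove k).remove l = (T.remove l).remove k := by
    ext x; simp only [Maya.mem_remove]; tauto
  rw [e]
  rcases lt_or_gt_of_ne hkl with h | h
  · rw [if_pos h, if_neg h.not_gt]; ring
  · rw [if_pos h, if_neg h.not_gt]; ring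

lemma psiStar_mul_psi (l k : ℤ) :
    psiStar l * psi k = -(psi k * psiStar l) + if k = l then 1 else 0 := by
  ext S T
  simp only [LinearMap.coe_comp, Function.comp_apply, Module.End.mul_apply, LinearMap.add_apply,
    Finsupp.add_apply, LinearMap.neg_apply, Finsupp.neg_apply, psi_apply, psiStar_apply,
    Maya.mem_remove, Maya.mem_adjoin]
  by_cases hkl : k = l
  · subst hkl
    by_cases hk : k ∈ T.carrier
    · simp only [hk, if_true, ne_eq, not_true_eq_false, and_false, if_false, Module.End.one_apply,
        Maya.adjoin_remove hk]
      rw [wedgeSign_remove hk, if_neg (lt_irrefl k), mul_one, ← mul_assoc, wedgeSign_mul_self]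
      ring
    · simp only [hk, if_true, if_false, Module.End.one_apply, Maya.remove_adjoin hk, true_or]
      rw [wedgeSign_adjoin hk, if_neg (lt_irrefl k), mul_one, ← mul_assoc, wedgeSign_mul_self]
      ring
  · by_cases hk : k ∈ T.carrier <;> by_cases hl : l ∈ T.carrier <;>
      simp only [hk, hl, hkl, Ne.symm hkl, ne_eq, not_false_eq_true, if_true, if_false, and_true,
        neg_zero, mul_zero, or_true, or_false, LinearMap.zero_apply, Finsupp.coe_zero,
        Pi.zero_apply, add_zero]
    rw [wedgeSign_remove hk, wedgeSign_adjoin hl]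
    have e : (T.adjoin l).remove k = (T.remove k).adjoin l := by
      ext x; simp only [Maya.mem_remove, Maya.mem_adjoin]
      constructor
      · tauto
      · rintro (rfl | h)
        · exact ⟨Or.inl rfl, Ne.symm hkl⟩
        · tauto
    rw [e]
    rcases lt_or_gt_of_ne hkl with h | h
    · rw [if_pos h, if_neg h.not_gt]; ring
    · rw [if_pos h, if_neg h.not_gt]; ring

lemma psiStar_mul_psiStar (k l : ℤ) : psiStar k * psiStar l = -(psiStar l * psiStar k) := by
  ext S T
  by_cases hkl : k = l
  · subst hkl
    have : ∀ v, psiStar k (psiStar k v) T = 0 := fun v => by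
      rw [psiStar_apply, psiStar_apply]
      simp [Maya.mem_adjoin]
    simp [this]
  simp only [LinearMap.coe_comp, Function.comp_apply, Module.End.mul_apply,
    LinearMap.neg_apply, Finsupp.neg_apply, psiStar_apply, Maya.mem_adjoin]
  by_cases hk : k ∈ T.carrier <;> by_cases hl : l ∈ T.carrier <;>
    simp only [hk, hl, hkl, Ne.symm hkl, or_false, or_true, if_true, if_false, neg_zero, mul_zero]
  rw [wedgeSign_adjoin hk, wedgeSign_adjoin hl]
  have e : (T.adjoin k).adjoin l = (T.adjoin l).adjoin k := by
    ext x; simp only [Maya.mem_adjoin]; tauto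
  rw [e]
  rcases lt_or_gt_of_ne hkl with h | h
  · rw [if_pos h, if_neg h.not_gt]; ring
  · rw [if_pos h, if_neg h.not_gt]; ring

/-- The index set of the vacuum vector of charge `c`. -/
def vac (c : ℤ) : Maya :=
  ⟨Set.Iio c,
    (Set.finite_Ico 0 c).subset fun _ hx => ⟨not_lt.mp hx.2, hx.1⟩,
    (Set.finite_Ico c 0).subset fun _ hx => ⟨not_lt.mp hx.2, hx.1⟩⟩

lemma mem_vac {c k : ℤ} : k ∈ (vac c).carrier ↔ k < c := Iff.rfl

/-- The set of places where `S` differs from the vacuum of charge `0`. -/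
def Maya.diff (S : Maya) : Set ℤ := (S.carrier \ Set.Iio 0) ∪ (Set.Iio 0 \ S.carrier)

lemma Maya.diff_finite (S : Maya) : S.diff.Finite := S.finite_pos.union S.finite_neg

/-- Induction on index sets: start from the vacuum, and adjoin nonnegative or remove
negative elements. -/
lemma Maya.induction {p : Maya → Prop} (h0 : p (vac 0))
    (h1 : ∀ S k, 0 ≤ k → k ∉ S.carrier → p S → p (S.adjoin k))
    (h2 : ∀ S k, k < 0 → k ∈ S.carrier → p S → p (S.remove k)) (S : Maya) : p S := by
  induction hn : S.diff.ncard generalizing S with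
  | zero =>
    rw [Set.ncard_eq_zero S.diff_finite] at hn
    suffices S = vac 0 by rw [this]; exact h0
    ext x
    have hx : x ∉ S.diff := by rw [hn]; simp
    simp only [Maya.diff, Set.mem_union, Set.mem_sdiff, Set.mem_Iio, not_or, not_and, not_not] at hx
    rw [mem_vac]
    constructor
    · exact hx.1
    · exact hx.2
  | succ n ih =>
    obtain ⟨k, hk⟩ : S.diff.Nonempty := by
      rw [← Set.ncard_pos S.diff_finite]; omega
    have key : ∀ T : Maya, T.diff = S.diff \ {k} → p T := fun T hT => ih T (by
      rw [hT, Set.ncard_sdiff_singleton_of_mem hk, hn]; rfl)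
    rcases hk with ⟨h, h'⟩ | ⟨h, h'⟩
    · rw [← Maya.adjoin_remove h]
      refine h1 _ _ (not_lt.1 h') (Maya.notMem_remove_self _ _) (key _ ?_)
      ext x
      simp only [Maya.diff, Set.mem_union, Set.mem_sdiff, Set.mem_Iio, Maya.mem_remove,
        Set.mem_singleton_iff] at *
      by_cases hx : x = k
      · subst hx; tauto
      · tauto
    · rw [← Maya.remove_adjoin h']
      refine h2 _ _ h (Or.inl rfl) (key _ ?_)
      ext x
      simp only [Maya.diff, Set.mem_union, Set.mem_sdiff, Set.mem_Iio, Maya.mem_adjoin,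
        Set.mem_singleton_iff] at *
      by_cases hx : x = k
      · subst hx; tauto
      · tauto

/-- A version of Schur's lemma: a matrix that commutes with all fermions and has vanishing vacuum
entry is zero.  The columns of the matrix need not be finitely supported. -/
lemma matrix_eq_zero_of_commute {X : Maya → Maya → ℂ}
    (h1 : ∀ j S T, j ∉ S.carrier → j ∉ T.carrier →
      wedgeSign j S * X (S.adjoin j) (T.adjoin j) = wedgeSign j T * X S T)
    (h2 : ∀ j S T, j ∈ S.carrier → j ∉ T.carrier → X S T = 0)
    (h3 : ∀ j S T, j ∉ S.carrier → j ∈ T.carrier → X S T = 0)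
    (h0 : X (vac 0) (vac 0) = 0) (S T : Maya) : X S T = 0 := by
  have diag : ∀ S, X S S = 0 := by
    refine Maya.induction h0 ?_ ?_
    · intro S k _ hk hS
      have := h1 k S S hk hk
      rw [hS, mul_zero] at this
      exact (mul_eq_zero.1 this).resolve_left (wedgeSign_ne_zero _ _)
    · intro S k _ hk hS
      have := h1 k (S.remove k) (S.remove k) (Maya.notMem_remove_self _ _) (Maya.notMem_remove_self _ _)
      rw [Maya.adjoin_remove hk, hS, mul_zero] at this
      exact (mul_eq_zero.1 this.symm).resolve_left (wedgeSign_ne_zero _ _)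
  by_cases hST : S = T
  · rw [hST]; exact diag T
  · have : ∃ x, ¬ (x ∈ S.carrier ↔ x ∈ T.carrier) := by
      by_contra h
      push Not at h
      exact hST (Maya.ext (Set.ext h))
    obtain ⟨x, hx⟩ := this
    by_cases hS : x ∈ S.carrier
    · exact h2 x S T hS (by tauto)
    · exact h3 x S T hS (by tauto)

/-- An operator that commutes with all fermions and has vanishing vacuum expectation is zero. -/
lemma end_eq_zero_of_commute {X : Module.End ℂ Fock} (h1 : ∀ j, X * psi j = psi j * X)
    (h2 : ∀ j, X * psiStar j = psiStar j * X) (h0 : X (basisVec (vac 0)) (vac 0) = 0) :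
    X = 0 := by
  have e1 : ∀ j S T, X (psi j (basisVec S)) T = psi j (X (basisVec S)) T := fun j S T => by
    have := congrArg (fun Y : Module.End ℂ Fock => Y (basisVec S) T) (h1 j)
    simpa using this
  have e2 : ∀ j S T, X (psiStar j (basisVec S)) T = psiStar j (X (basisVec S)) T :=
    fun j S T => by
      have := congrArg (fun Y : Module.End ℂ Fock => Y (basisVec S) T) (h2 j)
      simpa using this
  have key : ∀ S T, X (basisVec S) T = 0 := by
    refine matrix_eq_zero_of_commute (X := fun S T => X (basisVec S) T) ?_ ?_ ?_ h0
    · intro j S T hS hT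
      have := e1 j S (T.adjoin j)
      rw [psi_basisVec_of_notMem hS, map_smul, Finsupp.smul_apply, psi_apply,
        if_pos (Maya.mem_adjoin_self _ _), Maya.remove_adjoin hT, wedgeSign_adjoin hT, if_neg (lt_irrefl _),
        mul_one] at this
      exact this
    · intro j S T hS hT
      have := e1 j S (T.adjoin j)
      rw [psi_basisVec_of_mem hS, map_zero, psi_apply, if_pos (Maya.mem_adjoin_self _ _),
        Maya.remove_adjoin hT] at this
      exact (mul_eq_zero.1 this.symm).resolve_left (wedgeSign_ne_zero _ _)
    · intro j S T hS hT
      have := e2 j S (T.remove j)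
      rw [psiStar_basisVec_of_notMem hS, map_zero, psiStar_apply, if_neg (Maya.notMem_remove_self _ _),
        Maya.adjoin_remove hT] at this
      exact (mul_eq_zero.1 this.symm).resolve_left (wedgeSign_ne_zero _ _)
  ext S T
  exact key S T

/-! ### The bosonic operators -/

/-- The sum defining `α_n v_S` is finite: only particles near the surface of `S` can jump by `n`. -/
lemma alpha_support_finite (n : ℤ) (hn : n ≠ 0) (S : Maya) :
    (Function.support fun k : ℤ => psi (k + n) (psiStar k (basisVec S))).Finite := by
  have hsub : (Function.support fun k : ℤ => psi (k + n) (psiStar k (basisVec S))) ⊆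
      {k | k ∈ S.carrier ∧ k + n ∉ S.carrier} := by
    intro k hk
    rw [Function.mem_support] at hk
    by_cases h : k ∈ S.carrier
    · refine ⟨h, fun h' => hk ?_⟩
      rw [psiStar_basisVec_of_mem h, map_smul, psi_basisVec_of_mem, smul_zero]
      exact ⟨h', fun e => hn (by simpa using e)⟩
    · exact absurd (by rw [psiStar_basisVec_of_notMem h, map_zero]) hk
  refine Set.Finite.subset ?_ hsub
  refine ((S.finite_pos.union (S.finite_neg.preimage (f := fun k : ℤ => k + n) ?_)).union
    (Set.finite_Ico (-n) 0)).subset ?_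
  · exact (add_left_injective n).injOn
  · rintro k ⟨h1, h2⟩
    simp only [Set.mem_union, Set.mem_sdiff, Set.mem_Iio, Set.mem_preimage, Set.mem_Ico]
    by_cases a : k < 0 <;> by_cases b : k + n < 0
    · exact Or.inl (Or.inr ⟨b, h2⟩)
    · exact Or.inr ⟨by omega, a⟩
    · exact Or.inl (Or.inl ⟨h1, a⟩)
    · exact Or.inl (Or.inl ⟨h1, a⟩)

/-- On a given vector, `α_n` is a finite sum over all sufficiently large windows. -/
lemma alpha_eq_sum (n : ℤ) (hn : n ≠ 0) (v : Fock) :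
    ∃ K : Finset ℤ, ∀ K', K ⊆ K' → alpha n v = ∑ k ∈ K', psi (k + n) (psiStar k v) := by
  induction v using Finsupp.induction_linear with
  | zero => exact ⟨∅, fun K' _ => by simp⟩
  | add f g hf hg =>
    obtain ⟨K1, h1⟩ := hf
    obtain ⟨K2, h2⟩ := hg
    refine ⟨K1 ∪ K2, fun K' hK => ?_⟩
    rw [map_add, h1 K' (Finset.union_subset_left hK), h2 K' (Finset.union_subset_right hK),
      ← Finset.sum_add_distrib]
    simp
  | single S c =>
    refine ⟨(alpha_support_finite n hn S).toFinset, fun K' hK => ?_⟩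
    have e : Finsupp.single S c = c • basisVec S := by simp [basisVec]
    rw [e, map_smul]
    simp only [map_smul, ← Finset.smul_sum]
    congr 1
    simp only [alpha, basisVec, Finsupp.linearCombination_single, one_smul]
    refine finsum_eq_sum_of_support_subset _ fun k hk => ?_
    exact hK ((alpha_support_finite n hn S).mem_toFinset.2 hk)

lemma alpha_mul_psi (n : ℤ) (hn : n ≠ 0) (j : ℤ) :
    alpha n * psi j = psi j * alpha n + psi (j + n) := by
  refine LinearMap.ext fun v => ?_
  obtain ⟨K1, h1⟩ := alpha_eq_sum n hn v
  obtain ⟨K2, h2⟩ := alpha_eq_sum n hn (psi j v)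
  set K := insert j (K1 ∪ K2) with hK
  have hj : j ∈ K := Finset.mem_insert_self _ _
  have hK1 : K1 ⊆ K := fun x hx => by simp [hK, hx]
  have hK2 : K2 ⊆ K := fun x hx => by simp [hK, hx]
  simp only [Module.End.mul_apply, LinearMap.add_apply]
  rw [h1 K hK1, h2 K hK2, map_sum]
  have e : ∀ k ∈ K, psi (k + n) (psiStar k (psi j v)) =
      psi j (psi (k + n) (psiStar k v)) + if k = j then psi (j + n) v else 0 := by
    intro k _
    have a1 := congrArg (fun Y : Module.End ℂ Fock => psi (k + n) (Y v)) (psiStar_mul_psi k j)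
    have a2 := congrArg (fun Y : Module.End ℂ Fock => Y (psiStar k v)) (psi_mul_psi (k + n) j)
    simp only [Module.End.mul_apply, LinearMap.add_apply, LinearMap.neg_apply, map_add,
      map_neg] at a1 a2
    rw [a1, a2, neg_neg]
    congr 1
    by_cases h : k = j
    · subst h; simp
    · simp [h, Ne.symm h]
  rw [Finset.sum_congr rfl e, Finset.sum_add_distrib, Finset.sum_ite_eq' K j, if_pos hj]

lemma alpha_mul_psiStar (n : ℤ) (hn : n ≠ 0) (j : ℤ) :
    alpha n * psiStar j = psiStar j * alpha n - psiStar (j - n) := by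
  refine LinearMap.ext fun v => ?_
  obtain ⟨K1, h1⟩ := alpha_eq_sum n hn v
  obtain ⟨K2, h2⟩ := alpha_eq_sum n hn (psiStar j v)
  set K := insert (j - n) (K1 ∪ K2) with hK
  have hj : j - n ∈ K := Finset.mem_insert_self _ _
  have hK1 : K1 ⊆ K := fun x hx => by simp [hK, hx]
  have hK2 : K2 ⊆ K := fun x hx => by simp [hK, hx]
  simp only [Module.End.mul_apply, LinearMap.sub_apply]
  rw [h1 K hK1, h2 K hK2, map_sum]
  have e : ∀ k ∈ K, psi (k + n) (psiStar k (psiStar j v)) =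
      psiStar j (psi (k + n) (psiStar k v)) - if k = j - n then psiStar (j - n) v else 0 := by
    intro k _
    have a1 := congrArg (fun Y : Module.End ℂ Fock => psi (k + n) (Y v)) (psiStar_mul_psiStar k j)
    have a2 := congrArg (fun Y : Module.End ℂ Fock => Y (psiStar k v)) (psiStar_mul_psi j (k + n))
    simp only [Module.End.mul_apply, LinearMap.add_apply, LinearMap.neg_apply,
      map_neg] at a1 a2
    rw [a1, a2]
    by_cases h : k = j - n
    · subst h; simp
    · have h' : k + n ≠ j := fun e => h (by omega)
      simp [h, h']
  rw [Finset.sum_congr rfl e, Finset.sum_sub_distrib, Finset.sum_ite_eq' K (j - n), if_pos hj]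

/-- `α_n` with `n > 0` raises the energy, so it has no component along the vacuum. -/
lemma alpha_apply_vac (n : ℤ) (hn : 0 < n) (v : Fock) : alpha n v (vac 0) = 0 := by
  obtain ⟨K, h⟩ := alpha_eq_sum n hn.ne' v
  rw [h K subset_rfl, Finsupp.finsetSum_apply]
  refine Finset.sum_eq_zero fun k _ => ?_
  rw [psi_apply, psiStar_apply]
  by_cases h1 : k + n ∈ (vac 0).carrier
  · have h2 : k ∈ ((vac 0).remove (k + n)).carrier := by
      rw [mem_vac] at h1
      exact Maya.mem_remove.2 ⟨mem_vac.2 (by omega), by omega⟩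
    rw [if_pos h1, if_pos h2, mul_zero]
  · rw [if_neg h1]

lemma alpha_vacuum (n : ℤ) (hn : n < 0) : alpha n (basisVec (vac 0)) = 0 := by
  obtain ⟨K, h⟩ := alpha_eq_sum n hn.ne (basisVec (vac 0))
  rw [h K subset_rfl]
  refine Finset.sum_eq_zero fun k _ => ?_
  by_cases h1 : k ∈ (vac 0).carrier
  · have h2 : k + n ∈ ((vac 0).remove k).carrier := by
      rw [mem_vac] at h1
      exact Maya.mem_remove.2 ⟨mem_vac.2 (by omega), by omega⟩
    rw [psiStar_basisVec_of_mem h1, map_smul, psi_basisVec_of_mem h2, smul_zero]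
  · rw [psiStar_basisVec_of_notMem h1, map_zero]

/-- If `[A, P]`, `[B, P]` and the iterated commutators of `A` and `B` with `P` do not depend on the
order, then `[A, B]` commutes with `P` (Jacobi identity). -/
lemma commutator_mul_of_mul {R : Type*} [Ring R] {A B P Q₁ Q₂ U : R} (h1 : A * P = P * A + Q₁)
    (h2 : B * P = P * B + Q₂) (h3 : A * Q₂ = Q₂ * A + U) (h4 : B * Q₁ = Q₁ * B + U) :
    (A * B - B * A) * P = P * (A * B - B * A) := by
  rw [sub_mul, mul_assoc, mul_assoc, h1, h2, mul_add, mul_add, ← mul_assoc, ← mul_assoc, h1, h2,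
    h3, h4]
  noncomm_ring

lemma commutator_mul_of_mul' {R : Type*} [Ring R] {A B P Q₁ Q₂ U : R} (h1 : A * P = P * A - Q₁)
    (h2 : B * P = P * B - Q₂) (h3 : A * Q₂ = Q₂ * A - U) (h4 : B * Q₁ = Q₁ * B - U) :
    (A * B - B * A) * P = P * (A * B - B * A) := by
  rw [sub_mul, mul_assoc, mul_assoc, h1, h2, mul_sub, mul_sub, ← mul_assoc, ← mul_assoc, h1, h2,
    h3, h4]
  noncomm_ring

/-- The operators `α_n` with `n` of a fixed sign commute. -/
lemma alpha_commute (m n : ℤ) (hmn : 0 < m * n) : Commute (alpha m) (alpha n) := by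
  have hm : m ≠ 0 := by rintro rfl; simp at hmn
  have hn : n ≠ 0 := by rintro rfl; simp at hmn
  -- the commutator commutes with all fermions, so it is a scalar, which the vacuum shows to vanish
  rw [commute_iff_eq, ← sub_eq_zero]
  refine end_eq_zero_of_commute ?_ ?_ ?_
  · intro j
    refine commutator_mul_of_mul (R := Module.End ℂ Fock) (alpha_mul_psi m hm j)
      (alpha_mul_psi n hn j) (alpha_mul_psi m hm (j + n)) ?_
    rw [show j + n + m = j + m + n by ring]
    exact alpha_mul_psi n hn (j + m)
  · intro j
    refine commutator_mul_of_mul' (R := Module.End ℂ Fock) (alpha_mul_psiStar m hm j)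
      (alpha_mul_psiStar n hn j) (alpha_mul_psiStar m hm (j - n)) ?_
    rw [show j - n - m = j - m - n by ring]
    exact alpha_mul_psiStar n hn (j - m)
  · rw [LinearMap.sub_apply, Finsupp.sub_apply, Module.End.mul_apply, Module.End.mul_apply]
    rcases lt_or_gt_of_ne hm with h | h
    · have h' : n < 0 := by nlinarith
      rw [alpha_vacuum m h, alpha_vacuum n h', map_zero, map_zero, sub_self]
    · have h' : 0 < n := by nlinarith
      rw [alpha_apply_vac m h, alpha_apply_vac n h', sub_self]

/-! ### Exponentials of power series over a noncommutative ring -/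

section ExpSeries

variable {R : Type*} [Ring R] [Algebra ℂ R]

/-- The derivation `s d/ds` of power series in `s`. -/
def eulerDeriv (f : PowerSeries R) : PowerSeries R :=
  PowerSeries.mk fun n => (n : ℂ) • PowerSeries.coeff n f

lemma eulerDeriv_mul (f g : PowerSeries R) :
    eulerDeriv (f * g) = eulerDeriv f * g + f * eulerDeriv g := by
  ext n
  simp only [eulerDeriv, map_add, PowerSeries.coeff_mk, PowerSeries.coeff_mul, Finset.smul_sum,
    ← Finset.sum_add_distrib]
  refine Finset.sum_congr rfl fun x hx => ?_
  rw [← Finset.HasAntidiagonal.mem_antidiagonal.1 hx, Nat.cast_add, add_smul, smul_mul_assoc, mul_smul_comm]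

lemma eulerDeriv_sub (f g : PowerSeries R) :
    eulerDeriv (f - g) = eulerDeriv f - eulerDeriv g := by
  ext n
  simp [eulerDeriv, smul_sub]

lemma eulerDeriv_C (r : R) : eulerDeriv (PowerSeries.C r) = 0 := by
  ext n
  simp only [eulerDeriv, PowerSeries.coeff_mk, PowerSeries.coeff_C, map_zero]
  split_ifs with h
  · simp [h]
  · simp

lemma commute_of_coeff {R : Type*} [Ring R] {f g : PowerSeries R}
    (h : ∀ i j, Commute (PowerSeries.coeff i f) (PowerSeries.coeff j g)) : Commute f g := by
  ext n
  rw [PowerSeries.coeff_mul, PowerSeries.coeff_mul, ← Finset.Nat.sum_antidiagonal_swap]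
  exact Finset.sum_congr rfl fun x _ => h _ _

lemma eulerDeriv_pow {f : PowerSeries R} (h : Commute (eulerDeriv f) f) (k : ℕ) :
    eulerDeriv (f ^ (k + 1)) = ((k + 1 : ℕ) : PowerSeries R) * (eulerDeriv f * f ^ k) := by
  induction k with
  | zero => simp
  | succ k ih =>
    rw [pow_succ, eulerDeriv_mul, ih, ← (h.pow_right (k + 1)).eq, Nat.cast_succ (k + 1), add_mul,
      one_mul, pow_succ f k]
    simp only [mul_assoc]

lemma coeff_pow_of_lt {R : Type*} [Ring R] {f : PowerSeries R} (h : PowerSeries.coeff 0 f = 0) (k : ℕ) :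
    ∀ n, n < k → PowerSeries.coeff n (f ^ k) = 0 := by
  induction k with
  | zero => intro n hn; omega
  | succ k ih =>
    intro n hn
    rw [pow_succ', PowerSeries.coeff_mul]
    refine Finset.sum_eq_zero fun x hx => ?_
    have := Finset.HasAntidiagonal.mem_antidiagonal.1 hx
    by_cases h0 : x.1 = 0
    · rw [h0, h, zero_mul]
    · rw [ih x.2 (by omega), mul_zero]

lemma coeff_expSeries {f : PowerSeries R} (h : PowerSeries.coeff 0 f = 0) (n K : ℕ)
    (hK : n < K) : PowerSeries.coeff n (expSeries f) =
      ∑ k ∈ Finset.range K, ((k.factorial : ℂ)⁻¹) • PowerSeries.coeff n (f ^ k) := by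
  rw [expSeries, PowerSeries.coeff_mk]
  refine Finset.sum_subset (Finset.range_mono hK) fun k _ hk => ?_
  rw [coeff_pow_of_lt h k n (by simpa using hk), smul_zero]

/-- The exponential `e^f` solves the differential equation `(e^f)' = f' e^f`. -/
lemma eulerDeriv_expSeries {f : PowerSeries R} (h : PowerSeries.coeff 0 f = 0)
    (hc : Commute (eulerDeriv f) f) :
    eulerDeriv (expSeries f) = eulerDeriv f * expSeries f := by
  ext n
  have h0 : PowerSeries.coeff 0 (eulerDeriv f) = 0 := by simp [eulerDeriv]
  rw [eulerDeriv, PowerSeries.coeff_mk, coeff_expSeries h n (n + 1) (Nat.lt_succ_self n),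
    Finset.smul_sum, Finset.sum_range_succ', PowerSeries.coeff_mul]
  have e1 : (n : ℂ) • (((Nat.factorial 0 : ℕ) : ℂ)⁻¹ • PowerSeries.coeff n (f ^ 0)) = 0 := by
    by_cases hn : n = 0
    · simp [hn]
    · simp [PowerSeries.coeff_one, hn]
  rw [e1, add_zero]
  have e2 : ∀ x ∈ Finset.HasAntidiagonal.antidiagonal n,
      PowerSeries.coeff x.1 (eulerDeriv f) * PowerSeries.coeff x.2 (expSeries f) =
      ∑ k ∈ Finset.range n, ((k.factorial : ℂ)⁻¹) •
        (PowerSeries.coeff x.1 (eulerDeriv f) * PowerSeries.coeff x.2 (f ^ k)) := by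
    intro x hx
    have := Finset.HasAntidiagonal.mem_antidiagonal.1 hx
    by_cases hx0 : x.1 = 0
    · simp [hx0, h0]
    · rw [coeff_expSeries h x.2 n (by omega), Finset.mul_sum]
      exact Finset.sum_congr rfl fun k _ => by rw [mul_smul_comm]
  rw [Finset.sum_congr rfl e2, Finset.sum_comm]
  refine Finset.sum_congr rfl fun k _ => ?_
  rw [← Finset.smul_sum, ← PowerSeries.coeff_mul, smul_comm]
  have e3 := congrArg (PowerSeries.coeff n) (eulerDeriv_pow hc k)
  rw [eulerDeriv, PowerSeries.coeff_mk] at e3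
  rw [e3, ← nsmul_eq_mul, map_nsmul, ← Nat.cast_smul_eq_nsmul ℂ, smul_smul, Nat.factorial_succ,
    Nat.cast_mul]
  congr 1
  have : ((k + 1 : ℕ) : ℂ) ≠ 0 := by exact_mod_cast Nat.succ_ne_zero k
  have : (k.factorial : ℂ) ≠ 0 := by exact_mod_cast k.factorial_ne_zero
  field_simp

/-- Solutions of `Y' = p Y` are determined by their constant terms. -/
lemma eq_zero_of_eulerDeriv {p Y : PowerSeries R} (hp : PowerSeries.coeff 0 p = 0)
    (hY : eulerDeriv Y = p * Y) (h0 : PowerSeries.coeff 0 Y = 0) : Y = 0 := by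
  ext n
  induction n using Nat.strong_induction_on with
  | _ n ih =>
    by_cases hn : n = 0
    · rw [hn, h0, map_zero]
    have h1 := congrArg (PowerSeries.coeff n) hY
    rw [eulerDeriv, PowerSeries.coeff_mk, PowerSeries.coeff_mul, Finset.sum_eq_zero] at h1
    · have hn' : (n : ℂ) ≠ 0 := by exact_mod_cast hn
      rw [map_zero, ← one_smul ℂ (PowerSeries.coeff n Y), ← inv_mul_cancel₀ hn', mul_smul, h1,
        smul_zero]
    · intro x hx
      have := Finset.HasAntidiagonal.mem_antidiagonal.1 hx
      by_cases hx0 : x.1 = 0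
      · rw [hx0, hp, zero_mul]
      · rw [ih x.2 (by omega), map_zero, mul_zero]

lemma coeff_zero_expSeries (f : PowerSeries R) : PowerSeries.coeff 0 (expSeries f) = 1 := by
  simp [expSeries]

/-- If `Φ' = [f', Φ]` then `e^f` intertwines the constant term of `Φ` with `Φ`. -/
lemma expSeries_mul_C {f Φ : PowerSeries R} (h : PowerSeries.coeff 0 f = 0)
    (hc : Commute (eulerDeriv f) f)
    (hΦ : eulerDeriv Φ = eulerDeriv f * Φ - Φ * eulerDeriv f) :
    expSeries f * PowerSeries.C (PowerSeries.coeff 0 Φ) = Φ * expSeries f := by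
  rw [← sub_eq_zero]
  refine eq_zero_of_eulerDeriv (p := eulerDeriv f) (by simp [eulerDeriv]) ?_ ?_
  · rw [eulerDeriv_sub, eulerDeriv_mul, eulerDeriv_mul, eulerDeriv_expSeries h hc, eulerDeriv_C,
      hΦ]
    noncomm_ring
  · have h1 := coeff_zero_expSeries f
    rw [PowerSeries.coeff_zero_eq_constantCoeff_apply] at h1
    simp [h1]

/-- The power series `∑_{n ≥ 1} (s^n / n) β_n`. -/
def logSeries (β : ℕ → R) : PowerSeries R :=
  PowerSeries.mk fun n => if n = 0 then 0 else ((n : ℂ)⁻¹) • β n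

lemma eulerDeriv_logSeries (β : ℕ → R) :
    eulerDeriv (logSeries β) = PowerSeries.mk fun n => if n = 0 then 0 else β n := by
  ext n
  simp only [eulerDeriv, logSeries, PowerSeries.coeff_mk]
  split_ifs with h
  · simp
  · rw [smul_smul, mul_inv_cancel₀ (by exact_mod_cast h), one_smul]

lemma commute_logSeries {β : ℕ → R}
    (hβ : ∀ m n, m ≠ 0 → n ≠ 0 → Commute (β m) (β n)) :
    Commute (eulerDeriv (logSeries β)) (logSeries β) := by
  refine commute_of_coeff fun i j => ?_
  rw [eulerDeriv_logSeries, logSeries, PowerSeries.coeff_mk, PowerSeries.coeff_mk]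
  split_ifs with h1 h2 h2
  · exact Commute.zero_left _
  · exact Commute.zero_left _
  · exact Commute.zero_right _
  · exact (hβ i j h1 h2).smul_right _

/-- If `[β_n, P_k] = P_{k+n}` then `Φ_k = ∑ s^n P_{k+n}` satisfies the equation of
`expSeries_mul_C`, and `Φ_0 = P_0 + s Φ_1`. Comparing coefficients gives a relation with only two
terms. -/
lemma coeff_expSeries_logSeries_mul {β : ℕ → R}
    (hβ : ∀ m n, m ≠ 0 → n ≠ 0 → Commute (β m) (β n)) (P : ℕ → R)
    (hP : ∀ n k, n ≠ 0 → β n * P k = P k * β n + P (k + n)) (n : ℕ) :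
    PowerSeries.coeff (n + 1) (expSeries (logSeries β)) * P 0 =
      P 0 * PowerSeries.coeff (n + 1) (expSeries (logSeries β)) +
      PowerSeries.coeff n (expSeries (logSeries β)) * P 1 := by
  have key : ∀ k, expSeries (logSeries β) * PowerSeries.C (P k) =
      (PowerSeries.mk fun n => P (k + n)) * expSeries (logSeries β) := by
    intro k
    have := expSeries_mul_C (f := logSeries β) (Φ := PowerSeries.mk fun n => P (k + n))
      (by simp [logSeries]) (commute_logSeries hβ) (by
        rw [eulerDeriv_logSeries]
        ext n
        rw [eulerDeriv, PowerSeries.coeff_mk, PowerSeries.coeff_mk, map_sub,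
          PowerSeries.coeff_mul, PowerSeries.coeff_mul, ← Finset.Nat.sum_antidiagonal_swap (n := n)
          (f := fun x => PowerSeries.coeff x.1 (PowerSeries.mk fun n => P (k + n)) *
            PowerSeries.coeff x.2 (PowerSeries.mk fun n => if n = 0 then 0 else β n)),
          ← Finset.sum_sub_distrib]
        simp only [PowerSeries.coeff_mk, Prod.fst_swap, Prod.snd_swap]
        have : ∀ x ∈ Finset.HasAntidiagonal.antidiagonal n, (if x.1 = 0 then 0 else β x.1) * P (k + x.2) -
            P (k + x.2) * (if x.1 = 0 then 0 else β x.1) = if x.1 = 0 then 0 else P (k + n) := by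
          intro x hx
          have hx := Finset.HasAntidiagonal.mem_antidiagonal.1 hx
          split_ifs with h
          · simp
          · rw [hP _ _ h, add_sub_cancel_left]
            congr 1
            omega
        rw [Finset.sum_congr rfl this, Finset.Nat.sum_antidiagonal_eq_sum_range_succ_mk,
          Finset.sum_range_succ']
        simp [Nat.cast_smul_eq_nsmul])
    simpa using this
  have h1 := congrArg (PowerSeries.coeff (n + 1)) (key 0)
  have h2 := congrArg (PowerSeries.coeff n) (key 1)
  rw [PowerSeries.coeff_mul_C, PowerSeries.coeff_mul,
    Finset.Nat.sum_antidiagonal_succ] at h1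
  rw [PowerSeries.coeff_mul_C, PowerSeries.coeff_mul] at h2
  simp only [PowerSeries.coeff_mk, zero_add] at h1 h2
  rw [h1, h2]
  congr 1
  refine Finset.sum_congr rfl fun x _ => ?_
  rw [add_comm]

/-- The dual relation: if `[β_n, P_k] = -P_{k+n}` then `Φ = P_0 - s P_1` satisfies the equation of
`expSeries_mul_C`. -/
lemma coeff_expSeries_logSeries_mul_star {β : ℕ → R}
    (hβ : ∀ m n, m ≠ 0 → n ≠ 0 → Commute (β m) (β n)) (P : ℕ → R)
    (hP : ∀ n k, n ≠ 0 → β n * P k = P k * β n - P (k + n)) (n : ℕ) :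
    PowerSeries.coeff (n + 1) (expSeries (logSeries β)) * P 0 =
      P 0 * PowerSeries.coeff (n + 1) (expSeries (logSeries β)) -
      P 1 * PowerSeries.coeff n (expSeries (logSeries β)) := by
  have key : expSeries (logSeries β) * PowerSeries.C (P 0) =
      (PowerSeries.C (P 0) - PowerSeries.X * PowerSeries.C (P 1)) * expSeries (logSeries β) := by
    have := expSeries_mul_C (f := logSeries β)
      (Φ := PowerSeries.C (P 0) - PowerSeries.X * PowerSeries.C (P 1))
      (by simp [logSeries]) (commute_logSeries hβ) (by
        rw [eulerDeriv_logSeries]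
        ext n
        rw [mul_sub, sub_mul, ← mul_assoc, (PowerSeries.commute_X _).eq, mul_assoc, mul_assoc]
        rcases n with _ | n
        · simp [eulerDeriv]
        · simp only [eulerDeriv, PowerSeries.coeff_mk, map_sub, PowerSeries.coeff_succ_X_mul,
            PowerSeries.coeff_mul_C, PowerSeries.coeff_C_mul, PowerSeries.coeff_C,
            Nat.succ_ne_zero, if_false, zero_sub]
          rw [hP _ _ (Nat.succ_ne_zero n)]
          rcases n with _ | n
          · simp
          · simp only [Nat.succ_ne_zero, if_false]
            rw [hP _ _ (Nat.succ_ne_zero n), show 0 + (n + 1 + 1) = 1 + (n + 1) by omega]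
            simp [PowerSeries.coeff_X])
    simpa using this
  have h1 := congrArg (PowerSeries.coeff (n + 1)) key
  rw [sub_mul, mul_assoc, map_sub, PowerSeries.coeff_succ_X_mul, PowerSeries.coeff_C_mul,
    PowerSeries.coeff_C_mul, PowerSeries.coeff_mul_C] at h1
  exact h1

end ExpSeries

/-! ### Commutation of the vertex operators with fermions -/

lemma GammaPlus_eq : GammaPlus = expSeries (logSeries fun n => alpha (n : ℤ)) := rfl

lemma GammaMinus_eq : GammaMinus = expSeries (logSeries fun n => alpha (-(n : ℤ))) := rfl

/-- The coefficient of `x^n` in `Γ₊(x)`. -/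
def gp (n : ℕ) : Module.End ℂ Fock := PowerSeries.coeff n GammaPlus

/-- The coefficient of `x^n` in `Γ₋(x)`. -/
def gm (n : ℕ) : Module.End ℂ Fock := PowerSeries.coeff n GammaMinus

lemma alpha_commute_pos (m n : ℕ) (hm : m ≠ 0) (hn : n ≠ 0) :
    Commute (alpha (m : ℤ)) (alpha (n : ℤ)) :=
  alpha_commute _ _ (by positivity)

lemma alpha_commute_neg (m n : ℕ) (hm : m ≠ 0) (hn : n ≠ 0) :
    Commute (alpha (-(m : ℤ))) (alpha (-(n : ℤ))) :=
  alpha_commute _ _ (by rw [neg_mul_neg]; positivity)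

lemma gp_zero : gp 0 = 1 := coeff_zero_expSeries (R := Module.End ℂ Fock) _

lemma gm_zero : gm 0 = 1 := coeff_zero_expSeries (R := Module.End ℂ Fock) _

lemma gp_succ_mul_psi (n : ℕ) (j : ℤ) :
    gp (n + 1) * psi j = psi j * gp (n + 1) + gp n * psi (j + 1) := by
  have := coeff_expSeries_logSeries_mul (R := Module.End ℂ Fock) alpha_commute_pos
    (fun k : ℕ => psi (j + k)) (fun n k hn => by
      have := alpha_mul_psi n (by exact_mod_cast hn) (j + k)
      rw [this]; push_cast; rw [add_assoc]) n
  simpa [gp, gm, GammaPlus_eq, GammaMinus_eq] using this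

lemma gm_succ_mul_psi (n : ℕ) (j : ℤ) :
    gm (n + 1) * psi j = psi j * gm (n + 1) + gm n * psi (j - 1) := by
  have := coeff_expSeries_logSeries_mul (R := Module.End ℂ Fock) alpha_commute_neg
    (fun k : ℕ => psi (j - k)) (fun n k hn => by
      have := alpha_mul_psi (-n) (by simpa using hn) (j - k)
      rw [this]; push_cast; rw [← sub_eq_add_neg, sub_sub]) n
  simpa [gp, gm, GammaPlus_eq, GammaMinus_eq] using this

lemma gp_succ_mul_psiStar (n : ℕ) (j : ℤ) :
    gp (n + 1) * psiStar j = psiStar j * gp (n + 1) - psiStar (j - 1) * gp n := by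
  have := coeff_expSeries_logSeries_mul_star (R := Module.End ℂ Fock) alpha_commute_pos
    (fun k : ℕ => psiStar (j - k)) (fun n k hn => by
      have := alpha_mul_psiStar n (by exact_mod_cast hn) (j - k)
      rw [this]; push_cast; rw [sub_sub]) n
  simpa [gp, gm, GammaPlus_eq, GammaMinus_eq] using this

lemma gm_succ_mul_psiStar (n : ℕ) (j : ℤ) :
    gm (n + 1) * psiStar j = psiStar j * gm (n + 1) - psiStar (j + 1) * gm n := by
  have := coeff_expSeries_logSeries_mul_star (R := Module.End ℂ Fock) alpha_commute_neg
    (fun k : ℕ => psiStar (j + k)) (fun n k hn => by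
      have := alpha_mul_psiStar (-n) (by simpa using hn) (j + k)
      rw [this]; push_cast; rw [sub_neg_eq_add, add_assoc]) n
  simpa [gp, gm, GammaPlus_eq, GammaMinus_eq] using this

/-- The analogue of the identities of Newton, `n h_n = ∑ p_k h_{n-k}`. -/
lemma gp_newton (n : ℕ) :
    (n : ℂ) • gp n = ∑ x ∈ Finset.HasAntidiagonal.antidiagonal n,
      (if x.1 = 0 then 0 else alpha (x.1 : ℤ)) * gp x.2 := by
  have h := eulerDeriv_expSeries (R := Module.End ℂ Fock)
    (f := logSeries fun n => alpha (n : ℤ)) (by simp [logSeries])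
    (commute_logSeries alpha_commute_pos)
  have := congrArg (PowerSeries.coeff n) h
  rw [eulerDeriv_logSeries, eulerDeriv, PowerSeries.coeff_mk, PowerSeries.coeff_mul] at this
  simp only [PowerSeries.coeff_mk] at this
  exact this

lemma gm_newton (n : ℕ) :
    (n : ℂ) • gm n = ∑ x ∈ Finset.HasAntidiagonal.antidiagonal n,
      (if x.1 = 0 then 0 else alpha (-(x.1 : ℤ))) * gm x.2 := by
  have h := eulerDeriv_expSeries (R := Module.End ℂ Fock)
    (f := logSeries fun n => alpha (-(n : ℤ))) (by simp [logSeries])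
    (commute_logSeries alpha_commute_neg)
  have := congrArg (PowerSeries.coeff n) h
  rw [eulerDeriv_logSeries, eulerDeriv, PowerSeries.coeff_mk, PowerSeries.coeff_mul] at this
  simp only [PowerSeries.coeff_mk] at this
  exact this

/-- `Γ₊` fixes the vacuum from the left: all other coefficients have no vacuum component. -/
lemma gp_apply_vac (n : ℕ) (hn : n ≠ 0) (v : Fock) : gp n v (vac 0) = 0 := by
  have h := congrArg (fun A : Module.End ℂ Fock => A v (vac 0)) (gp_newton n)
  simp only [LinearMap.smul_apply, Finsupp.smul_apply, LinearMap.sum_apply,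
    Finsupp.finsetSum_apply, Module.End.mul_apply, smul_eq_mul] at h
  rw [Finset.sum_eq_zero] at h
  · exact (mul_eq_zero.1 h).resolve_left (by exact_mod_cast hn)
  · intro x _
    split_ifs with h0
    · simp
    · exact alpha_apply_vac _ (by positivity) _

/-- `Γ₋` fixes the vacuum. -/
lemma gm_vacuum (n : ℕ) (hn : n ≠ 0) : gm n (basisVec (vac 0)) = 0 := by
  induction n using Nat.strong_induction_on with
  | _ n ih =>
    have h := congrArg (fun A : Module.End ℂ Fock => A (basisVec (vac 0))) (gm_newton n)
    simp only [LinearMap.smul_apply, LinearMap.sum_apply, Module.End.mul_apply] at h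
    rw [Finset.sum_eq_zero] at h
    · exact (smul_eq_zero.1 h).resolve_left (by exact_mod_cast hn)
    · intro x hx
      have hx := Finset.HasAntidiagonal.mem_antidiagonal.1 hx
      split_ifs with h0
      · simp
      · by_cases h2 : x.2 = 0
        · rw [h2, gm_zero, Module.End.one_apply]
          exact alpha_vacuum _ (by have := Nat.pos_of_ne_zero h0; omega)
        · rw [ih x.2 (by omega) h2, map_zero]

/-! ### Partitions and index sets -/

/-- The energy of an index set, normalised to vanish on the vacuum of charge `0`. -/
def Maya.energy (S : Maya) : ℤ :=
  ∑ k ∈ S.finite_pos.toFinset, k - ∑ k ∈ S.finite_neg.toFinset, k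

lemma Maya.energy_adjoin {k : ℤ} {S : Maya} (h : k ∉ S.carrier) :
    (S.adjoin k).energy = S.energy + k := by
  unfold Maya.energy
  by_cases hk : k < 0
  · have e1 : (S.adjoin k).finite_pos.toFinset = S.finite_pos.toFinset := by
      ext x
      simp only [Set.Finite.mem_toFinset, Set.mem_sdiff, Set.mem_Iio, Maya.mem_adjoin]
      constructor
      · rintro ⟨rfl | h1, h2⟩
        · exact absurd hk h2
        · exact ⟨h1, h2⟩
      · tauto
    have e2 : S.finite_neg.toFinset = insert k (S.adjoin k).finite_neg.toFinset := by
      ext x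
      simp only [Set.Finite.mem_toFinset, Set.mem_sdiff, Set.mem_Iio, Maya.mem_adjoin,
        Finset.mem_insert]
      constructor
      · tauto
      · rintro (rfl | h1)
        · exact ⟨hk, h⟩
        · tauto
    rw [e1, e2, Finset.sum_insert]
    · ring
    · simp [Maya.mem_adjoin]
  · have e1 : (S.adjoin k).finite_pos.toFinset = insert k S.finite_pos.toFinset := by
      ext x
      simp only [Set.Finite.mem_toFinset, Set.mem_sdiff, Set.mem_Iio, Maya.mem_adjoin,
        Finset.mem_insert]
      constructor
      · tauto
      · rintro (rfl | h1)
        · exact ⟨Or.inl rfl, hk⟩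
        · tauto
    have e2 : (S.adjoin k).finite_neg.toFinset = S.finite_neg.toFinset := by
      ext x
      simp only [Set.Finite.mem_toFinset, Set.mem_sdiff, Set.mem_Iio, Maya.mem_adjoin]
      constructor
      · tauto
      · rintro ⟨h1, h2⟩
        refine ⟨h1, ?_⟩
        rintro (rfl | h3)
        · exact hk h1
        · exact h2 h3
    rw [e1, e2, Finset.sum_insert]
    · ring
    · simp [h]

lemma Maya.energy_remove {k : ℤ} {S : Maya} (h : k ∈ S.carrier) :
    (S.remove k).energy = S.energy - k := by
  have := Maya.energy_adjoin (Maya.notMem_remove_self k S)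
  rw [Maya.adjoin_remove h] at this
  omega

/-- A partition `λ_0 ≥ λ_1 ≥ ⋯`, with finitely many nonzero parts. -/
@[ext] structure Ptn where
  part : ℕ → ℕ
  anti : Antitone part
  eventually_zero : ∃ K, ∀ k, K ≤ k → part k = 0

/-- The positions `λ_k - k - 1 + c` of the particles of the partition `λ` in charge `c`. -/
def Ptn.pos (lam : Ptn) (c : ℤ) (k : ℕ) : ℤ := lam.part k - k - 1 + c

lemma Ptn.pos_strictAnti (lam : Ptn) (c : ℤ) : StrictAnti (lam.pos c) := by
  refine strictAnti_nat_of_succ_lt fun k => ?_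
  have := lam.anti (show k ≤ k + 1 by omega)
  simp only [Ptn.pos]
  push_cast
  omega

/-- The index set of charge `c` of a partition. -/
def Ptn.maya (c : ℤ) (lam : Ptn) : Maya where
  carrier := Set.range (lam.pos c)
  finite_pos := by
    refine ((Set.finite_Iio (lam.part 0 + c.toNat)).image (lam.pos c)).subset ?_
    rintro _ ⟨⟨k, rfl⟩, hk⟩
    refine ⟨k, ?_, rfl⟩
    have := lam.anti (Nat.zero_le k)
    simp only [Ptn.pos, Set.mem_Iio, not_lt] at hk ⊢
    omega
  finite_neg := by
    obtain ⟨K, hK⟩ := lam.eventually_zero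
    refine (Set.finite_Ico (c - K) 0).subset ?_
    rintro x ⟨hx, hx'⟩
    refine ⟨?_, hx⟩
    by_contra h
    refine hx' ⟨(c - 1 - x).toNat, ?_⟩
    rw [Ptn.pos, hK _ (by omega)]
    omega

lemma Ptn.mem_maya {c x : ℤ} {lam : Ptn} :
    x ∈ (lam.maya c).carrier ↔ ∃ k, lam.pos c k = x := Iff.rfl

/-- The `k`-th position is the largest `j` with more than `k` elements at or beyond `j`. -/
lemma Ptn.le_count_maya {c j : ℤ} {lam : Ptn} {k : ℕ} :
    k + 1 ≤ (lam.maya c).count j ↔ j ≤ lam.pos c k := by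
  constructor
  · intro h
    by_contra hj
    have h1 : ((lam.maya c).carrier ∩ Set.Ici j) ⊆ lam.pos c '' (Set.Iio k) := by
      rintro _ ⟨⟨i, rfl⟩, hi⟩
      refine ⟨i, ?_, rfl⟩
      by_contra hik
      have := (lam.pos_strictAnti c).antitone (not_lt.1 hik)
      simp only [Set.mem_Ici] at hi
      omega
    have h2 := Set.ncard_le_ncard h1 ((Set.finite_Iio k).image _)
    rw [Set.ncard_image_of_injective _ (lam.pos_strictAnti c).injective] at h2
    have h3 : (Set.Iio k).ncard = k := by
      rw [← Finset.coe_Iio, Set.ncard_coe_finset, Nat.card_Iio]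
    rw [h3] at h2
    rw [Maya.count] at h
    omega
  · intro h
    have h1 : lam.pos c '' (Set.Iic k) ⊆ ((lam.maya c).carrier ∩ Set.Ici j) := by
      rintro _ ⟨i, hi, rfl⟩
      exact ⟨⟨i, rfl⟩, h.trans ((lam.pos_strictAnti c).antitone hi)⟩
    have h2 := Set.ncard_le_ncard h1 (Maya.finite_inter_Ici _ _)
    rw [Set.ncard_image_of_injective _ (lam.pos_strictAnti c).injective] at h2
    have h3 : (Set.Iic k).ncard = k + 1 := by
      rw [← Finset.coe_Iic, Set.ncard_coe_finset, Nat.card_Iic]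
    rwa [h3] at h2

lemma Maya.count_antitone (S : Maya) : Antitone S.count := fun i _ h =>
  Set.ncard_le_ncard (Set.inter_subset_inter_right _ (Set.Ici_subset_Ici.2 h))
    (S.finite_inter_Ici i)

/-- Far to the left an index set contains every place, so its counting function has slope `-1`. -/
lemma Maya.exists_count_eq (S : Maya) : ∃ L : ℤ,
    ∀ j, j ≤ L → (S.count j : ℤ) = S.count L + (L - j) := by
  obtain ⟨L, hL⟩ : ∃ L : ℤ, ∀ j, j ≤ L → j ∈ S.carrier := by
    obtain ⟨L, hL⟩ := S.finite_neg.bddBelow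
    refine ⟨min (L - 1) (-1), fun j hj => ?_⟩
    by_contra h
    have := hL ⟨show j < 0 by omega, h⟩
    omega
  refine ⟨L, fun j hj => ?_⟩
  obtain ⟨n, hn⟩ := Int.eq_ofNat_of_zero_le (sub_nonneg.2 hj)
  obtain rfl : j = L - n := by omega
  clear hj hn
  induction n with
  | zero => simp
  | succ n ih =>
    have h := S.count_step (L - (n + 1 : ℕ))
    rw [if_pos (hL _ (by omega)), show L - ((n + 1 : ℕ) : ℤ) + 1 = L - n by push_cast; ring] at h
    rw [h]
    push_cast
    omega

lemma Maya.exists_count_le (S : Maya) : ∃ U : ℤ, ∀ j, U ≤ j → S.count j = 0 := by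
  obtain ⟨U, hU⟩ := S.finite_pos.bddAbove
  refine ⟨max (U + 1) 0, fun j hj => ?_⟩
  rw [Maya.count, Set.ncard_eq_zero (S.finite_inter_Ici j), Set.eq_empty_iff_forall_notMem]
  rintro x ⟨hx, hxj⟩
  simp only [Set.mem_Ici] at hxj
  have := hU ⟨hx, show ¬ x < 0 by omega⟩
  omega

/-- Every index set comes from a partition and a charge. -/
lemma Maya.exists_eq_maya (S : Maya) : ∃ (c : ℤ) (lam : Ptn), S = lam.maya c := by
  obtain ⟨L, hL⟩ := S.exists_count_eq
  obtain ⟨U, hU⟩ := S.exists_count_le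
  -- `s k` is the `k`-th largest element, counted from zero
  have hex : ∀ k : ℕ, ∃ s : ℤ, k + 1 ≤ S.count s ∧ ∀ j, k + 1 ≤ S.count j → j ≤ s := by
    intro k
    refine Int.exists_greatest_of_bdd (P := fun j => k + 1 ≤ S.count j) ⟨U, ?_⟩
      ⟨L - k - 1, ?_⟩
    · intro j hj
      by_contra h
      rw [hU j (by omega)] at hj
      omega
    · have := hL (L - k - 1) (by omega)
      omega
  choose s hs1 hs2 using hex
  have hcount : ∀ k, S.count (s k + 1) ≤ k := by
    intro k
    by_contra h
    have := hs2 k (s k + 1) (by omega)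
    omega
  have hmem : ∀ k, s k ∈ S.carrier := by
    intro k
    have h1 := S.count_step (s k)
    have h2 := hs1 k
    have h3 := hcount k
    by_contra h
    rw [if_neg h] at h1
    omega
  have hanti : ∀ k, s (k + 1) < s k := by
    intro k
    by_contra h
    have h1 := hs1 (k + 1)
    have h2 := S.count_step (s k)
    rw [if_pos (hmem k)] at h2
    have h3 := hcount k
    have h4 := S.count_antitone (not_lt.1 h)
    omega
  have htail : ∀ k, S.count L ≤ k → s k = L + S.count L - k - 1 := by
    intro k hk
    have h1 := hL (L + S.count L - k - 1) (by omega)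
    have h2 := hs2 k (L + S.count L - k - 1) (by omega)
    have h3 := hs1 k
    have h4 : s k ≤ L := by
      by_contra h
      have h5 := S.count_step L
      have h6 := S.count_antitone (show L + 1 ≤ s k by omega)
      have h7 := hL (L - 1) (by omega)
      split_ifs at h5 <;> omega
    have h5 := hL (s k) h4
    omega
  have hmono : Antitone fun k : ℕ => s k + k := antitone_nat_of_succ_le fun k => by
    have := hanti k
    push_cast
    omega
  set c := L + (S.count L : ℤ) with hc
  have hge : ∀ k : ℕ, 0 ≤ s k + k + 1 - c := by
    intro k
    have h1 := hmono (le_max_left k (S.count L))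
    have h2 := htail _ (le_max_right k (S.count L))
    simp only at h1
    omega
  have hpart1 : Antitone fun k : ℕ => (s k + k + 1 - c).toNat := fun i j hij => by
    have := hmono hij
    simp only at this ⊢
    omega
  have hpart2 : ∀ k : ℕ, S.count L ≤ k → (s k + k + 1 - c).toNat = 0 := fun k hk => by
    have := htail k hk
    omega
  refine ⟨c, ⟨fun k => (s k + k + 1 - c).toNat, hpart1, S.count L, hpart2⟩, ?_⟩
  · have hpos : ∀ k, s k =
        Ptn.pos ⟨fun k => (s k + k + 1 - c).toNat, hpart1, S.count L, hpart2⟩ c k := by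
      intro k
      have := hge k
      simp only [Ptn.pos]
      omega
    ext x
    rw [Ptn.mem_maya]
    constructor
    · intro hx
      refine ⟨S.count (x + 1), ?_⟩
      rw [← hpos]
      have h1 := S.count_step x
      rw [if_pos hx] at h1
      have h2 := hs2 (S.count (x + 1)) x (by omega)
      by_contra h
      have h3 := S.count_antitone (show x + 1 ≤ s (S.count (x + 1)) by omega)
      have h4 := hs1 (S.count (x + 1))
      omega
    · rintro ⟨k, rfl⟩
      rw [← hpos]
      exact hmem k

/-- The interlacing relation between index sets, in terms of counting functions. -/
def Maya.Inter (S T : Maya) : Prop :=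
  ∀ j, S.count j ≤ T.count j ∧ T.count j ≤ S.count (j + 1) + 1

/-- Index sets interlace if and only if they have the same charge and their partitions interlace:
`rho 0 ≥ lam 0 ≥ rho 1 ≥ lam 1 ≥ ⋯`. -/
lemma Ptn.inter_maya {c d : ℤ} {lam rho : Ptn} :
    (lam.maya c).Inter (rho.maya d) ↔
      c = d ∧ ∀ k, lam.part k ≤ rho.part k ∧ rho.part (k + 1) ≤ lam.part k := by
  have key : (lam.maya c).Inter (rho.maya d) ↔
      ∀ k, lam.pos c k ≤ rho.pos d k ∧ rho.pos d (k + 1) + 1 ≤ lam.pos c k := by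
    constructor
    · intro h k
      constructor
      · rw [← Ptn.le_count_maya]
        exact (Ptn.le_count_maya.2 le_rfl).trans (h _).1
      · rw [← Ptn.le_count_maya]
        have h1 := (h (rho.pos d (k + 1))).2
        have h2 := (Ptn.le_count_maya (c := d) (lam := rho) (k := k + 1)).2 le_rfl
        omega
    · intro h j
      constructor
      · by_contra hj
        have h1 : (rho.maya d).count j + 1 ≤ (lam.maya c).count j := by omega
        have h2 := Ptn.le_count_maya.1 h1
        have h3 := Ptn.le_count_maya.2 (h2.trans (h _).1)
        omega
      · by_contra hj
        have h1 : ((lam.maya c).count (j + 1) + 1) + 1 ≤ (rho.maya d).count j := by omega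
        have h2 := Ptn.le_count_maya.1 h1
        have h3 : (lam.maya c).count (j + 1) + 1 ≤ (lam.maya c).count (j + 1) :=
          Ptn.le_count_maya.2 (by have := (h ((lam.maya c).count (j + 1))).2; omega)
        omega
  rw [key]
  constructor
  · intro h
    have hcd : c = d := by
      obtain ⟨K, hK⟩ := lam.eventually_zero
      obtain ⟨K', hK'⟩ := rho.eventually_zero
      have h1 := h (max K K')
      simp only [Ptn.pos] at h1
      rw [hK _ (le_max_left _ _), hK' _ (le_max_right _ _),
        hK' _ ((le_max_right _ _).trans (Nat.le_succ _))] at h1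
      push_cast at h1
      omega
    refine ⟨hcd, fun k => ?_⟩
    have h1 := h k
    simp only [Ptn.pos] at h1
    push_cast at h1
    omega
  · rintro ⟨rfl, h⟩ k
    have h1 := h k
    simp only [Ptn.pos]
    push_cast
    omega

/-- The empty partition. -/
def Ptn.zero : Ptn := ⟨0, fun _ _ _ => le_rfl, 0, fun _ _ => rfl⟩

lemma Ptn.maya_zero {lam : Ptn} (h : ∀ k, lam.part k = 0) (c : ℤ) : lam.maya c = vac c := by
  ext x
  rw [Ptn.mem_maya, mem_vac]
  constructor
  · rintro ⟨k, rfl⟩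
    rw [Ptn.pos, h]
    push_cast
    omega
  · intro hx
    refine ⟨(c - 1 - x).toNat, ?_⟩
    rw [Ptn.pos, h]
    omega

/-- Remove the first part of a partition. -/
def Ptn.tail (lam : Ptn) : Ptn where
  part k := lam.part (k + 1)
  anti _ _ h := lam.anti (Nat.succ_le_succ h)
  eventually_zero := lam.eventually_zero.imp fun _ h k hk => h _ (hk.trans (Nat.le_succ k))

lemma Ptn.pos_tail (lam : Ptn) (c : ℤ) (k : ℕ) : lam.tail.pos (c - 1) k = lam.pos c (k + 1) := by
  simp only [Ptn.pos, Ptn.tail]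
  push_cast
  ring

lemma Ptn.maya_eq_adjoin (lam : Ptn) (c : ℤ) :
    lam.maya c = (lam.tail.maya (c - 1)).adjoin (lam.pos c 0) := by
  ext x
  rw [Maya.mem_adjoin, Ptn.mem_maya, Ptn.mem_maya]
  simp only [Ptn.pos_tail]
  constructor
  · rintro ⟨_ | k, rfl⟩
    · exact Or.inl rfl
    · exact Or.inr ⟨k, rfl⟩
  · rintro (rfl | ⟨k, rfl⟩)
    · exact ⟨0, rfl⟩
    · exact ⟨k + 1, rfl⟩

lemma Ptn.energy_maya (K : ℕ) (lam : Ptn) (h : ∀ k, K ≤ k → lam.part k = 0) (c : ℤ) :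
    (lam.maya c).energy = (vac c).energy + ∑ k ∈ Finset.range K, (lam.part k : ℤ) := by
  induction K generalizing lam c with
  | zero => rw [Ptn.maya_zero (fun k => h k (Nat.zero_le k))]; simp
  | succ K ih =>
    have h1 : lam.pos c 0 ∉ (lam.tail.maya (c - 1)).carrier := by
      rintro ⟨k, hk⟩
      rw [Ptn.pos_tail] at hk
      exact absurd ((lam.pos_strictAnti c).injective hk) (Nat.succ_ne_zero k)
    have h2 : (vac c).energy = (vac (c - 1)).energy + (c - 1) := by
      have e : vac c = (vac (c - 1)).adjoin (c - 1) := by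
        ext x
        rw [Maya.mem_adjoin, mem_vac, mem_vac]
        omega
      rw [e, Maya.energy_adjoin (by rw [mem_vac]; omega)]
    rw [Ptn.maya_eq_adjoin, Maya.energy_adjoin h1,
      ih lam.tail (fun k hk => h (k + 1) (by omega)), h2, Finset.sum_range_succ']
    simp only [Ptn.pos, Ptn.tail]
    push_cast
    ring

lemma Ptn.exists_bound (lam rho : Ptn) :
    ∃ K, (∀ k, K ≤ k → lam.part k = 0) ∧ (∀ k, K ≤ k → rho.part k = 0) := by
  obtain ⟨K, hK⟩ := lam.eventually_zero
  obtain ⟨K', hK'⟩ := rho.eventually_zero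
  exact ⟨max K K', fun k hk => hK k (le_of_max_le_left hk), fun k hk =>
    hK' k (le_of_max_le_right hk)⟩

lemma Maya.Inter.energy_le {S T : Maya} (h : S.Inter T) : S.energy ≤ T.energy := by
  obtain ⟨c, lam, rfl⟩ := S.exists_eq_maya
  obtain ⟨d, rho, rfl⟩ := T.exists_eq_maya
  obtain ⟨rfl, h'⟩ := Ptn.inter_maya.1 h
  obtain ⟨K, h1, h2⟩ := lam.exists_bound rho
  rw [Ptn.energy_maya K _ h1, Ptn.energy_maya K _ h2]
  have : ∑ k ∈ Finset.range K, (lam.part k : ℤ) ≤ ∑ k ∈ Finset.range K, (rho.part k : ℤ) :=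
    Finset.sum_le_sum fun k _ => by exact_mod_cast (h' k).1
  omega

lemma Maya.inter_self (S : Maya) : S.Inter S := by
  intro j
  refine ⟨le_rfl, ?_⟩
  rw [S.count_step j]
  split_ifs <;> omega

/-! ### The Pieri rule -/

/-- The expected matrix element of the coefficient of `x^n` in `Γ₊(x)`. -/
def pieri (n : ℤ) (S T : Maya) : ℂ := if S.Inter T ∧ T.energy = S.energy + n then 1 else 0

lemma pieri_neg {n : ℤ} (hn : n < 0) (S T : Maya) : pieri n S T = 0 := by
  rw [pieri, if_neg]
  rintro ⟨h1, h2⟩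
  have := h1.energy_le
  omega

/-- The relations between consecutive coefficients of `Γ₊` that express its commutation with the
fermions. -/
structure PieriRel (F G : Maya → Maya → ℂ) : Prop where
  psi : ∀ j S T, (if j ∈ S.carrier then 0 else wedgeSign j S * F (S.adjoin j) T) =
    (if j ∈ T.carrier then wedgeSign j T * F S (T.remove j) else 0) +
      (if j + 1 ∈ S.carrier then 0 else wedgeSign (j + 1) S * G (S.adjoin (j + 1)) T)
  psiStar : ∀ j S T, (if j ∈ S.carrier then wedgeSign j S * F (S.remove j) T else 0) =
    (if j ∈ T.carrier then 0 else wedgeSign j T * F S (T.adjoin j)) -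
      (if j - 1 ∈ T.carrier then 0 else wedgeSign (j - 1) T * G S (T.adjoin (j - 1)))

/-- A coefficient is determined by the previous one and by its vacuum entry. -/
lemma PieriRel.unique {F F' G : Maya → Maya → ℂ} (h : PieriRel F G) (h' : PieriRel F' G)
    (h0 : F (vac 0) (vac 0) = F' (vac 0) (vac 0)) : F = F' := by
  have key := matrix_eq_zero_of_commute (X := fun S T => F S T - F' S T) ?_ ?_ ?_
    (by rw [h0, sub_self])
  · funext S T
    exact sub_eq_zero.1 (key S T)
  · intro j S T hS hT
    have e1 := h.psi j S (T.adjoin j)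
    have e2 := h'.psi j S (T.adjoin j)
    rw [if_neg hS, if_pos (Maya.mem_adjoin_self _ _), Maya.remove_adjoin hT, wedgeSign_adjoin hT,
      if_neg (lt_irrefl _), mul_one] at e1 e2
    rw [mul_sub, mul_sub, e1, e2]
    ring
  · intro j S T hS hT
    have e1 := h.psi j S (T.adjoin j)
    have e2 := h'.psi j S (T.adjoin j)
    rw [if_pos hS, if_pos (Maya.mem_adjoin_self _ _), Maya.remove_adjoin hT] at e1 e2
    have : wedgeSign j (T.adjoin j) * (F S T - F' S T) = 0 := by
      rw [mul_sub]; linear_combination e2 - e1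
    exact (mul_eq_zero.1 this).resolve_left (wedgeSign_ne_zero _ _)
  · intro j S T hS hT
    have e1 := h.psiStar j S (T.remove j)
    have e2 := h'.psiStar j S (T.remove j)
    rw [if_neg hS, if_neg (Maya.notMem_remove_self _ _), Maya.adjoin_remove hT] at e1 e2
    have : wedgeSign j (T.remove j) * (F S T - F' S T) = 0 := by
      rw [mul_sub]; linear_combination e2 - e1
    exact (mul_eq_zero.1 this).resolve_left (wedgeSign_ne_zero _ _)

/-- Adding or removing `j` or `j + 1` affects the interlacing conditions essentially only at these two
places; the lemmas below bring out a part common to all the sets that occur in `PieriRel`. -/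
lemma forall_int_split {p : ℤ → Prop} (j : ℤ) :
    (∀ i, p i) ↔ (∀ i, i < j → p i) ∧ p j ∧ p (j + 1) ∧ ∀ i, j + 1 < i → p i := by
  constructor
  · intro h; exact ⟨fun i _ => h i, h _, h _, fun i _ => h i⟩
  · rintro ⟨h1, h2, h3, h4⟩ i
    rcases lt_trichotomy i j with h | rfl | h
    · exact h1 i h
    · exact h2
    · rcases eq_or_lt_of_le (show j + 1 ≤ i by omega) with rfl | h
      · exact h3
      · exact h4 i h

section

variable (j : ℤ) (S T : Maya)

lemma inter_adjoin_left (h : j ∉ S.carrier) : (S.adjoin j).Inter T ↔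
    ((∀ i, i < j → S.count i + 1 ≤ T.count i ∧ T.count i ≤ S.count (i + 1) + 2) ∧
      ∀ i, j + 1 < i → S.count i ≤ T.count i ∧ T.count i ≤ S.count (i + 1) + 1) ∧
    (S.count j + 1 ≤ T.count j ∧ T.count j ≤ S.count (j + 1) + 1) ∧
      S.count (j + 1) ≤ T.count (j + 1) ∧ T.count (j + 1) ≤ S.count (j + 1 + 1) + 1 := by
  rw [Maya.Inter, forall_int_split j]
  simp only [Maya.count_adjoin h]
  have e1 : (∀ i, i < j → S.count i + (if i ≤ j then 1 else 0) ≤ T.count i ∧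
      T.count i ≤ S.count (i + 1) + (if i + 1 ≤ j then 1 else 0) + 1) ↔
      (∀ i, i < j → S.count i + 1 ≤ T.count i ∧ T.count i ≤ S.count (i + 1) + 2) :=
    forall_congr' fun i => imp_congr_right fun hi => by
      rw [if_pos hi.le, if_pos (show i + 1 ≤ j by omega)]
  have e2 : (∀ i, j + 1 < i → S.count i + (if i ≤ j then 1 else 0) ≤ T.count i ∧
      T.count i ≤ S.count (i + 1) + (if i + 1 ≤ j then 1 else 0) + 1) ↔
      (∀ i, j + 1 < i → S.count i ≤ T.count i ∧ T.count i ≤ S.count (i + 1) + 1) :=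
    forall_congr' fun i => imp_congr_right fun hi => by
      rw [if_neg (show ¬ i ≤ j by omega), if_neg (show ¬ i + 1 ≤ j by omega)]
      simp
  rw [e1, e2, if_pos le_rfl, if_neg (show ¬ j + 1 ≤ j by omega),
    if_neg (show ¬ j + 1 + 1 ≤ j by omega)]
  simp only [add_zero]
  tauto

lemma inter_adjoin_left' (h : j + 1 ∉ S.carrier) : (S.adjoin (j + 1)).Inter T ↔
    ((∀ i, i < j → S.count i + 1 ≤ T.count i ∧ T.count i ≤ S.count (i + 1) + 2) ∧
      ∀ i, j + 1 < i → S.count i ≤ T.count i ∧ T.count i ≤ S.count (i + 1) + 1) ∧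
    (S.count j + 1 ≤ T.count j ∧ T.count j ≤ S.count (j + 1) + 2) ∧
      S.count (j + 1) + 1 ≤ T.count (j + 1) ∧ T.count (j + 1) ≤ S.count (j + 1 + 1) + 1 := by
  rw [Maya.Inter, forall_int_split j]
  simp only [Maya.count_adjoin h]
  have e1 : (∀ i, i < j → S.count i + (if i ≤ j + 1 then 1 else 0) ≤ T.count i ∧
      T.count i ≤ S.count (i + 1) + (if i + 1 ≤ j + 1 then 1 else 0) + 1) ↔
      (∀ i, i < j → S.count i + 1 ≤ T.count i ∧ T.count i ≤ S.count (i + 1) + 2) :=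
    forall_congr' fun i => imp_congr_right fun hi => by
      rw [if_pos (show i ≤ j + 1 by omega), if_pos (show i + 1 ≤ j + 1 by omega)]
  have e2 : (∀ i, j + 1 < i → S.count i + (if i ≤ j + 1 then 1 else 0) ≤ T.count i ∧
      T.count i ≤ S.count (i + 1) + (if i + 1 ≤ j + 1 then 1 else 0) + 1) ↔
      (∀ i, j + 1 < i → S.count i ≤ T.count i ∧ T.count i ≤ S.count (i + 1) + 1) :=
    forall_congr' fun i => imp_congr_right fun hi => by
      rw [if_neg (show ¬ i ≤ j + 1 by omega), if_neg (show ¬ i + 1 ≤ j + 1 by omega)]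
      simp
  rw [e1, e2, if_pos (show j ≤ j + 1 by omega), if_pos le_rfl,
    if_neg (show ¬ j + 1 + 1 ≤ j + 1 by omega)]
  simp only [add_zero]
  tauto

lemma inter_remove_right (h : j ∈ T.carrier) : S.Inter (T.remove j) ↔
    ((∀ i, i < j → S.count i + 1 ≤ T.count i ∧ T.count i ≤ S.count (i + 1) + 2) ∧
      ∀ i, j + 1 < i → S.count i ≤ T.count i ∧ T.count i ≤ S.count (i + 1) + 1) ∧
    (S.count j + 1 ≤ T.count j ∧ T.count j ≤ S.count (j + 1) + 2) ∧
      S.count (j + 1) ≤ T.count (j + 1) ∧ T.count (j + 1) ≤ S.count (j + 1 + 1) + 1 := by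
  rw [Maya.Inter, forall_int_split j]
  simp only [Maya.count_remove h]
  have e1 : (∀ i, i < j → S.count i + 1 ≤ (T.remove j).count i + (if i ≤ j then 1 else 0) ∧
      (T.remove j).count i + (if i ≤ j then 1 else 0) ≤ S.count (i + 1) + 2) ↔
      (∀ i, i < j → S.count i ≤ (T.remove j).count i ∧
        (T.remove j).count i ≤ S.count (i + 1) + 1) :=
    forall_congr' fun i => imp_congr_right fun hi => by
      rw [if_pos hi.le]
      omega
  have e2 : (∀ i, j + 1 < i → S.count i ≤ (T.remove j).count i + (if i ≤ j then 1 else 0) ∧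
      (T.remove j).count i + (if i ≤ j then 1 else 0) ≤ S.count (i + 1) + 1) ↔
      (∀ i, j + 1 < i → S.count i ≤ (T.remove j).count i ∧
        (T.remove j).count i ≤ S.count (i + 1) + 1) :=
    forall_congr' fun i => imp_congr_right fun hi => by
      rw [if_neg (show ¬ i ≤ j by omega)]
      simp
  rw [e1, e2, if_pos le_rfl, if_neg (show ¬ j + 1 ≤ j by omega)]
  simp only [add_zero]
  have e3 : (S.count j + 1 ≤ (T.remove j).count j + 1 ∧
      (T.remove j).count j + 1 ≤ S.count (j + 1) + 2) ↔
      (S.count j ≤ (T.remove j).count j ∧ (T.remove j).count j ≤ S.count (j + 1) + 1) := by omega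
  rw [e3]
  tauto

lemma inter_remove_left (h : j + 1 ∈ S.carrier) : (S.remove (j + 1)).Inter T ↔
    ((∀ i, i < j → S.count i ≤ T.count i + 1 ∧ T.count i ≤ S.count (i + 1)) ∧
      ∀ i, j + 1 < i → S.count i ≤ T.count i ∧ T.count i ≤ S.count (i + 1) + 1) ∧
    (S.count j ≤ T.count j + 1 ∧ T.count j ≤ S.count (j + 1)) ∧
      S.count (j + 1) ≤ T.count (j + 1) + 1 ∧ T.count (j + 1) ≤ S.count (j + 1 + 1) + 1 := by
  rw [Maya.Inter, forall_int_split j]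
  simp only [Maya.count_remove h]
  have e1 : (∀ i, i < j → (S.remove (j + 1)).count i + (if i ≤ j + 1 then 1 else 0) ≤
      T.count i + 1 ∧ T.count i ≤
        (S.remove (j + 1)).count (i + 1) + (if i + 1 ≤ j + 1 then 1 else 0)) ↔
      (∀ i, i < j → (S.remove (j + 1)).count i ≤ T.count i ∧
        T.count i ≤ (S.remove (j + 1)).count (i + 1) + 1) :=
    forall_congr' fun i => imp_congr_right fun hi => by
      rw [if_pos (show i ≤ j + 1 by omega), if_pos (show i + 1 ≤ j + 1 by omega)]
      omega
  have e2 : (∀ i, j + 1 < i → (S.remove (j + 1)).count i + (if i ≤ j + 1 then 1 else 0) ≤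
      T.count i ∧ T.count i ≤
        (S.remove (j + 1)).count (i + 1) + (if i + 1 ≤ j + 1 then 1 else 0) + 1) ↔
      (∀ i, j + 1 < i → (S.remove (j + 1)).count i ≤ T.count i ∧
        T.count i ≤ (S.remove (j + 1)).count (i + 1) + 1) :=
    forall_congr' fun i => imp_congr_right fun hi => by
      rw [if_neg (show ¬ i ≤ j + 1 by omega), if_neg (show ¬ i + 1 ≤ j + 1 by omega)]
      simp
  rw [e1, e2, if_pos (show j ≤ j + 1 by omega), if_pos le_rfl,
    if_neg (show ¬ j + 1 + 1 ≤ j + 1 by omega)]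
  simp only [add_zero, add_le_add_iff_right]
  tauto

lemma inter_adjoin_right (h : j + 1 ∉ T.carrier) : S.Inter (T.adjoin (j + 1)) ↔
    ((∀ i, i < j → S.count i ≤ T.count i + 1 ∧ T.count i ≤ S.count (i + 1)) ∧
      ∀ i, j + 1 < i → S.count i ≤ T.count i ∧ T.count i ≤ S.count (i + 1) + 1) ∧
    (S.count j ≤ T.count j + 1 ∧ T.count j ≤ S.count (j + 1)) ∧
      S.count (j + 1) ≤ T.count (j + 1) + 1 ∧ T.count (j + 1) ≤ S.count (j + 1 + 1) := by
  rw [Maya.Inter, forall_int_split j]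
  simp only [Maya.count_adjoin h]
  have e1 : (∀ i, i < j → S.count i ≤ T.count i + (if i ≤ j + 1 then 1 else 0) ∧
      T.count i + (if i ≤ j + 1 then 1 else 0) ≤ S.count (i + 1) + 1) ↔
      (∀ i, i < j → S.count i ≤ T.count i + 1 ∧ T.count i ≤ S.count (i + 1)) :=
    forall_congr' fun i => imp_congr_right fun hi => by
      rw [if_pos (show i ≤ j + 1 by omega)]
      omega
  have e2 : (∀ i, j + 1 < i → S.count i ≤ T.count i + (if i ≤ j + 1 then 1 else 0) ∧
      T.count i + (if i ≤ j + 1 then 1 else 0) ≤ S.count (i + 1) + 1) ↔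
      (∀ i, j + 1 < i → S.count i ≤ T.count i ∧ T.count i ≤ S.count (i + 1) + 1) :=
    forall_congr' fun i => imp_congr_right fun hi => by
      rw [if_neg (show ¬ i ≤ j + 1 by omega)]
      simp
  rw [e1, e2, if_pos (show j ≤ j + 1 by omega), if_pos le_rfl]
  simp only [add_le_add_iff_right]
  tauto

lemma inter_adjoin_right' (h : j ∉ T.carrier) : S.Inter (T.adjoin j) ↔
    ((∀ i, i < j → S.count i ≤ T.count i + 1 ∧ T.count i ≤ S.count (i + 1)) ∧
      ∀ i, j + 1 < i → S.count i ≤ T.count i ∧ T.count i ≤ S.count (i + 1) + 1) ∧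
    (S.count j ≤ T.count j + 1 ∧ T.count j ≤ S.count (j + 1)) ∧
      S.count (j + 1) ≤ T.count (j + 1) ∧ T.count (j + 1) ≤ S.count (j + 1 + 1) + 1 := by
  rw [Maya.Inter, forall_int_split j]
  simp only [Maya.count_adjoin h]
  have e1 : (∀ i, i < j → S.count i ≤ T.count i + (if i ≤ j then 1 else 0) ∧
      T.count i + (if i ≤ j then 1 else 0) ≤ S.count (i + 1) + 1) ↔
      (∀ i, i < j → S.count i ≤ T.count i + 1 ∧ T.count i ≤ S.count (i + 1)) :=
    forall_congr' fun i => imp_congr_right fun hi => by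
      rw [if_pos (show i ≤ j by omega)]
      omega
  have e2 : (∀ i, j + 1 < i → S.count i ≤ T.count i + (if i ≤ j then 1 else 0) ∧
      T.count i + (if i ≤ j then 1 else 0) ≤ S.count (i + 1) + 1) ↔
      (∀ i, j + 1 < i → S.count i ≤ T.count i ∧ T.count i ≤ S.count (i + 1) + 1) :=
    forall_congr' fun i => imp_congr_right fun hi => by
      rw [if_neg (show ¬ i ≤ j by omega)]
      simp
  rw [e1, e2, if_pos le_rfl, if_neg (show ¬ j + 1 ≤ j by omega)]
  simp only [add_le_add_iff_right, add_zero]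
  tauto

end

/-- The interlacing matrices satisfy the commutation relations of `Γ₊`: away from the positions
`j` and `j + 1` the three interlacing conditions coincide. -/
lemma pieri_rel (n : ℤ) : PieriRel (pieri n) (pieri (n - 1)) := by
  constructor
  · intro j S T
    have s1 := S.count_step j
    have s2 := S.count_step (j + 1)
    have t1 := T.count_step j
    -- `A` holds the conditions common to all terms; what remains involves finitely many numbers
    obtain ⟨A, hA⟩ : ∃ A : Prop, A ↔ ((∀ i, i < j → S.count i + 1 ≤ T.count i ∧ T.count i ≤ S.count (i + 1) + 2) ∧
      ∀ i, j + 1 < i → S.count i ≤ T.count i ∧ T.count i ≤ S.count (i + 1) + 1) := ⟨_, Iff.rfl⟩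
    have e1 : (if j ∈ S.carrier then 0 else wedgeSign j S * pieri n (S.adjoin j) T) =
        if j ∉ S.carrier ∧ A ∧ T.energy = S.energy + j + n ∧
          (S.count j + 1 ≤ T.count j ∧ T.count j ≤ S.count (j + 1) + 1) ∧
          S.count (j + 1) ≤ T.count (j + 1) ∧ T.count (j + 1) ≤ S.count (j + 1 + 1) + 1
        then (-1) ^ S.count (j + 1) else 0 := by
      by_cases h : j ∈ S.carrier
      · simp [h]
      · rw [if_neg h, pieri, wedgeSign_eq, mul_ite, mul_one, mul_zero]
        have h0 := inter_adjoin_left j S T h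
        have h1 := Maya.energy_adjoin h
        exact if_congr (by rw [h1]; tauto) rfl rfl
    have e2 : (if j ∈ T.carrier then wedgeSign j T * pieri n S (T.remove j) else 0) =
        if j ∈ T.carrier ∧ A ∧ T.energy = S.energy + j + n ∧
          (S.count j + 1 ≤ T.count j ∧ T.count j ≤ S.count (j + 1) + 2) ∧
          S.count (j + 1) ≤ T.count (j + 1) ∧ T.count (j + 1) ≤ S.count (j + 1 + 1) + 1
        then (-1) ^ T.count (j + 1) else 0 := by
      by_cases h : j ∈ T.carrier
      · rw [if_pos h, pieri, wedgeSign_eq, mul_ite, mul_one, mul_zero]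
        have h0 := inter_remove_right j S T h
        have h1 := Maya.energy_remove h
        have : T.energy - j = S.energy + n ↔ T.energy = S.energy + j + n := by omega
        exact if_congr (by rw [h1]; tauto) rfl rfl
      · simp [h]
    have e3 : (if j + 1 ∈ S.carrier then 0 else
        wedgeSign (j + 1) S * pieri (n - 1) (S.adjoin (j + 1)) T) =
        if j + 1 ∉ S.carrier ∧ A ∧ T.energy = S.energy + j + n ∧
          (S.count j + 1 ≤ T.count j ∧ T.count j ≤ S.count (j + 1) + 2) ∧
          S.count (j + 1) + 1 ≤ T.count (j + 1) ∧ T.count (j + 1) ≤ S.count (j + 1 + 1) + 1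
        then (-1) ^ S.count (j + 1 + 1) else 0 := by
      by_cases h : j + 1 ∈ S.carrier
      · simp [h]
      · rw [if_neg h, pieri, wedgeSign_eq, mul_ite, mul_one, mul_zero]
        have h0 := inter_adjoin_left' j S T h
        have h1 := Maya.energy_adjoin h
        have : T.energy = S.energy + (j + 1) + (n - 1) ↔ T.energy = S.energy + j + n := by omega
        exact if_congr (by rw [h1]; tauto) rfl rfl
    rw [e1, e2, e3]
    clear e1 e2 e3
    clear hA
    by_cases hAE : A ∧ T.energy = S.energy + j + n
    swap
    · rw [if_neg (by tauto), if_neg (by tauto), if_neg (by tauto), add_zero]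
    simp only [hAE.1, hAE.2, true_and]
    generalize S.count j = a at *
    generalize S.count (j + 1) = b at *
    generalize S.count (j + 1 + 1) = c at *
    generalize T.count j = d at *
    generalize T.count (j + 1) = e at *
    by_cases h1 : j ∈ S.carrier <;> by_cases h2 : j + 1 ∈ S.carrier <;>
      by_cases h3 : j ∈ T.carrier <;>
      simp only [h1, h2, h3, if_true, if_false, not_true_eq_false, not_false_eq_true, true_and,
        false_and] at s1 s2 t1 ⊢ <;>
      (try split_ifs) <;> first | (exfalso; omega) | skip
    all_goals first
      | (simp; done)
      | (obtain h | h : e = c ∨ e = c + 1 := by omega) <;>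
          first | (exfalso; omega) | simp [h, s2, pow_succ]
  · intro j' S T
    obtain ⟨j, rfl⟩ : ∃ j, j' = j + 1 := ⟨j' - 1, by ring⟩
    rw [add_sub_cancel_right]
    have s2 := S.count_step (j + 1)
    have t1 := T.count_step j
    have t2 := T.count_step (j + 1)
    have s1 := S.count_step j
    obtain ⟨A, hA⟩ : ∃ A : Prop, A ↔ ((∀ i, i < j → S.count i ≤ T.count i + 1 ∧ T.count i ≤ S.count (i + 1)) ∧
      ∀ i, j + 1 < i → S.count i ≤ T.count i ∧ T.count i ≤ S.count (i + 1) + 1) := ⟨_, Iff.rfl⟩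
    have e1 : (if j + 1 ∈ S.carrier then wedgeSign (j + 1) S * pieri n (S.remove (j + 1)) T
          else 0) =
        if j + 1 ∈ S.carrier ∧ A ∧ T.energy = S.energy - (j + 1) + n ∧
          (S.count j ≤ T.count j + 1 ∧ T.count j ≤ S.count (j + 1)) ∧
          S.count (j + 1) ≤ T.count (j + 1) + 1 ∧ T.count (j + 1) ≤ S.count (j + 1 + 1) + 1
        then (-1) ^ S.count (j + 1 + 1) else 0 := by
      by_cases h : j + 1 ∈ S.carrier
      · rw [if_pos h, pieri, wedgeSign_eq, mul_ite, mul_one, mul_zero]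
        have h0 := inter_remove_left j S T h
        have h1 := Maya.energy_remove h
        exact if_congr (by rw [h1]; tauto) rfl rfl
      · simp [h]
    have e2 : (if j + 1 ∈ T.carrier then 0 else
          wedgeSign (j + 1) T * pieri n S (T.adjoin (j + 1))) =
        if j + 1 ∉ T.carrier ∧ A ∧ T.energy = S.energy - (j + 1) + n ∧
          (S.count j ≤ T.count j + 1 ∧ T.count j ≤ S.count (j + 1)) ∧
          S.count (j + 1) ≤ T.count (j + 1) + 1 ∧ T.count (j + 1) ≤ S.count (j + 1 + 1)
        then (-1) ^ T.count (j + 1 + 1) else 0 := by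
      by_cases h : j + 1 ∈ T.carrier
      · simp [h]
      · rw [if_neg h, pieri, wedgeSign_eq, mul_ite, mul_one, mul_zero]
        have h0 := inter_adjoin_right j S T h
        have h1 := Maya.energy_adjoin h
        have : T.energy + (j + 1) = S.energy + n ↔ T.energy = S.energy - (j + 1) + n := by omega
        exact if_congr (by rw [h1]; tauto) rfl rfl
    have e3 : (if j ∈ T.carrier then 0 else wedgeSign j T * pieri (n - 1) S (T.adjoin j)) =
        if j ∉ T.carrier ∧ A ∧ T.energy = S.energy - (j + 1) + n ∧
          (S.count j ≤ T.count j + 1 ∧ T.count j ≤ S.count (j + 1)) ∧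
          S.count (j + 1) ≤ T.count (j + 1) ∧ T.count (j + 1) ≤ S.count (j + 1 + 1) + 1
        then (-1) ^ T.count (j + 1) else 0 := by
      by_cases h : j ∈ T.carrier
      · simp [h]
      · rw [if_neg h, pieri, wedgeSign_eq, mul_ite, mul_one, mul_zero]
        have h0 := inter_adjoin_right' j S T h
        have h1 := Maya.energy_adjoin h
        have : T.energy + j = S.energy + (n - 1) ↔ T.energy = S.energy - (j + 1) + n := by omega
        exact if_congr (by rw [h1]; tauto) rfl rfl
    rw [e1, e2, e3]
    clear e1 e2 e3
    have hA2 : A → S.count (j + 1 + 1) ≤ T.count (j + 1 + 1) := fun h =>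
      ((hA.1 h).2 _ (by omega)).1
    clear hA
    by_cases hAE : A ∧ T.energy = S.energy - (j + 1) + n
    swap
    · rw [if_neg (by tauto), if_neg (by tauto), if_neg (by tauto), sub_zero]
    replace hA2 := hA2 hAE.1
    simp only [hAE.1, hAE.2, true_and]
    generalize S.count j = a at *
    generalize S.count (j + 1) = b at *
    generalize S.count (j + 1 + 1) = c at *
    generalize T.count j = d at *
    generalize T.count (j + 1) = e at *
    generalize T.count (j + 1 + 1) = f at *
    have s3 : a = b ∨ a = b + 1 := by split_ifs at s1 <;> omega
    clear s1
    by_cases h1 : j ∈ T.carrier <;> by_cases h2 : j + 1 ∈ T.carrier <;>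
      by_cases h3 : j + 1 ∈ S.carrier <;>
      simp only [h1, h2, h3, if_true, if_false, not_true_eq_false, not_false_eq_true, true_and,
        false_and] at s2 t2 t1 ⊢ <;>
      (try split_ifs) <;> first | (exfalso; omega) | skip
    all_goals first
      | (simp; done)
      | (obtain h | h | h : f = c ∨ f = c + 1 ∨ c = f + 1 := by omega) <;>
          first | (exfalso; omega) | simp [h, t2, pow_succ]

lemma pieri_vac (n : ℕ) : pieri n (vac 0) (vac 0) = if n = 0 then 1 else 0 := by
  rw [pieri]
  refine if_congr ?_ rfl rfl
  constructor
  · rintro ⟨_, h⟩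
    omega
  · rintro rfl
    exact ⟨Maya.inter_self _, by simp⟩

lemma one_pieriRel : PieriRel (fun S T => (1 : Module.End ℂ Fock) (basisVec S) T) fun _ _ => 0 := by
  constructor
  · intro j S T
    have h := psi_apply j (basisVec S) T
    by_cases hj : j ∈ S.carrier
    · rw [psi_basisVec_of_mem hj] at h
      simpa [hj] using h
    · rw [psi_basisVec_of_notMem hj, Finsupp.smul_apply] at h
      simpa [hj] using h
  · intro j S T
    have h := psiStar_apply j (basisVec S) T
    by_cases hj : j ∈ S.carrier
    · rw [psiStar_basisVec_of_mem hj, Finsupp.smul_apply] at h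
      simpa [hj] using h
    · rw [psiStar_basisVec_of_notMem hj] at h
      simpa [hj] using h

lemma apply_psi (A : Module.End ℂ Fock) (j : ℤ) (S T : Maya) : (A * psi j) (basisVec S) T =
    if j ∈ S.carrier then 0 else wedgeSign j S * A (basisVec (S.adjoin j)) T := by
  rw [Module.End.mul_apply]
  by_cases hj : j ∈ S.carrier
  · rw [psi_basisVec_of_mem hj, map_zero, if_pos hj]; rfl
  · rw [psi_basisVec_of_notMem hj, map_smul, if_neg hj]; rfl

lemma apply_psiStar (A : Module.End ℂ Fock) (j : ℤ) (S T : Maya) :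
    (A * psiStar j) (basisVec S) T =
    if j ∈ S.carrier then wedgeSign j S * A (basisVec (S.remove j)) T else 0 := by
  rw [Module.End.mul_apply]
  by_cases hj : j ∈ S.carrier
  · rw [psiStar_basisVec_of_mem hj, map_smul, if_pos hj]; rfl
  · rw [psiStar_basisVec_of_notMem hj, map_zero, if_neg hj]; rfl

/-- The coefficients of `Γ₊` satisfy the same commutation relations as the interlacing matrices. -/
lemma gp_pieriRel (n : ℕ) : PieriRel (fun S T => gp (n + 1) (basisVec S) T)
    (fun S T => gp n (basisVec S) T) := by
  constructor
  · intro j S T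
    have h := congrArg (fun A : Module.End ℂ Fock => A (basisVec S) T) (gp_succ_mul_psi n j)
    simp only [LinearMap.add_apply, Finsupp.add_apply, apply_psi] at h
    rw [h, Module.End.mul_apply, psi_apply]
  · intro j S T
    have h := congrArg (fun A : Module.End ℂ Fock => A (basisVec S) T) (gp_succ_mul_psiStar n j)
    simp only [LinearMap.sub_apply, Finsupp.sub_apply, apply_psiStar] at h
    rw [h, Module.End.mul_apply, psiStar_apply, Module.End.mul_apply, psiStar_apply]

/-- The transposed coefficients of `Γ₋` satisfy them as well. -/
lemma gm_pieriRel (n : ℕ) : PieriRel (fun S T => gm (n + 1) (basisVec T) S)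
    (fun S T => gm n (basisVec T) S) := by
  constructor
  · intro j S T
    have h := congrArg (fun A : Module.End ℂ Fock => A (basisVec T) S) (gm_succ_mul_psiStar n j)
    simp only [LinearMap.sub_apply, Finsupp.sub_apply, apply_psiStar] at h
    rw [h, Module.End.mul_apply, psiStar_apply, Module.End.mul_apply, psiStar_apply]
    ring
  · intro j S T
    have h := congrArg (fun A : Module.End ℂ Fock => A (basisVec T) S) (gm_succ_mul_psi n j)
    simp only [LinearMap.add_apply, Finsupp.add_apply, apply_psi] at h
    rw [h, Module.End.mul_apply, psi_apply]
    ring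

lemma one_eq_pieri : (fun S T => (1 : Module.End ℂ Fock) (basisVec S) T) = pieri 0 := by
  refine one_pieriRel.unique ?_ ?_
  · have h := pieri_rel 0
    have e : pieri (0 - 1) = fun _ _ => 0 := by
      funext S T
      exact pieri_neg (by norm_num) S T
    rwa [e] at h
  · have := pieri_vac 0
    rw [Nat.cast_zero, if_pos rfl] at this
    rw [this]
    simp [basisVec]

/-- The Pieri rule: `Γ₊(x) v_S` is the sum of `x^{|T| - |S|} v_T` over all `T` that interlace
with `S`. -/
lemma gp_apply (n : ℕ) : (fun S T => gp n (basisVec S) T) = pieri n := by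
  induction n with
  | zero => rw [gp_zero]; exact one_eq_pieri
  | succ n ih =>
    have h1 := gp_pieriRel n
    rw [ih] at h1
    refine h1.unique ?_ ?_
    · have h2 := pieri_rel (n + 1 : ℕ)
      rwa [show ((n + 1 : ℕ) : ℤ) - 1 = n by push_cast; ring] at h2
    · rw [gp_apply_vac _ (Nat.succ_ne_zero n), pieri_vac, if_neg (Nat.succ_ne_zero n)]

/-- The Pieri rule for `Γ₋(x)`, the transpose of `Γ₊(x)`. -/
lemma gm_apply (n : ℕ) : (fun S T => gm n (basisVec T) S) = pieri n := by
  induction n with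
  | zero =>
    rw [gm_zero, Nat.cast_zero, ← one_eq_pieri]
    funext S T
    simp only [Module.End.one_apply, basisVec, Finsupp.single_apply]
    exact if_congr eq_comm rfl rfl
  | succ n ih =>
    have h1 := gm_pieriRel n
    rw [ih] at h1
    refine h1.unique ?_ ?_
    · have h2 := pieri_rel (n + 1 : ℕ)
      rwa [show ((n + 1 : ℕ) : ℤ) - 1 = n by push_cast; ring] at h2
    · rw [gm_vacuum _ (Nat.succ_ne_zero n), pieri_vac, if_neg (Nat.succ_ne_zero n)]
      rfl

/-! ### Wick's theorem -/

/-- Schur complement of the upper left corner of a matrix, in a form without division. -/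
lemma det_eq_det_schur_sub {R : Type*} [CommRing R] {n : ℕ} (G : Matrix (Fin (n + 1)) (Fin (n + 1)) R) :
    G.det = (Matrix.of fun i k : Fin n => G i.succ k.succ - G i.succ 0 * G 0 k.succ).det -
      (1 - G 0 0) * (Matrix.of fun i k : Fin n => G i.succ k.succ).det := by
  set H : Matrix (Fin (n + 1)) (Fin (n + 1)) R :=
    Matrix.of fun i k => if i = 0 ∧ k = 0 then 1 else G i k with hH
  have h1 : H.det = (Matrix.of fun i k : Fin n => G i.succ k.succ - G i.succ 0 * G 0 k.succ).det := by
    set B : Matrix (Fin (n + 1)) (Fin (n + 1)) R :=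
      Matrix.of fun i k => if i = 0 then H i k else H i k - H i 0 * H 0 k with hB
    have e1 : H.det = B.det := by
      refine Matrix.det_eq_of_forall_row_eq_smul_add_const
        (fun i => if i = 0 then 0 else H i 0) 0 (by simp) ?_
      intro i j
      by_cases hi : i = 0
      · subst hi
        simp [hB]
      · simp [hB, hi]
    rw [e1, Matrix.det_succ_column_zero, Fin.sum_univ_succ, Finset.sum_eq_zero]
    · have : B 0 0 = 1 := by simp [hB, hH]
      rw [this, add_zero]
      simp only [Fin.val_zero, pow_zero, one_mul]
      congr 1
    · intro i _
      have : B i.succ 0 = 0 := by simp [hB, hH]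
      rw [this]
      ring
  rw [← h1, Matrix.det_succ_row_zero G, Matrix.det_succ_row_zero H, Fin.sum_univ_succ,
    Fin.sum_univ_succ (n := n)]
  have e2 : ∀ i : Fin (n + 1), (H.submatrix Fin.succ i.succAbove) =
      G.submatrix Fin.succ i.succAbove := by
    intro i
    ext a b
    simp [hH]
  have e3 : ∀ i : Fin n, H 0 i.succ = G 0 i.succ := fun i => by simp [hH]
  have e4 : H 0 0 = 1 := by simp [hH]
  have e5 : (Matrix.of fun i k : Fin n => G i.succ k.succ) =
      G.submatrix Fin.succ (Fin.succAbove 0) := by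
    ext a b
    simp
  simp only [e2, e3, e4, e5, Fin.val_zero, pow_zero, one_mul]
  ring

/-- Wick's theorem for a product of pairs `(a_i⁺ + a_i⁻) b_i`, where the `a_i^±` anticommute, their
anticommutators with the `b_k` are scalars, and the functional `φ` vanishes on `a_i⁺ X` and on
`X a_i⁻`.

For the induction step one passes from `φ` to `X ↦ φ ((1 - c + a_0 b_0) X)` with
`c = φ (a_0 b_0)`.  This functional satisfies the same hypotheses with respect to the modified
splitting `a_i = (a_i⁺ - d_i a_0⁻) + (a_i⁻ + d_i a_0⁻)`, where `d_i` is the anticommutator of `a_i⁺`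
and `b_0`; on the side of the determinants this is a Schur complement. -/
theorem wick {A R : Type*} [Ring A] [CommRing R] (ι : R →+* A) (hι : ∀ r a, ι r * a = a * ι r)
    (n : ℕ) : ∀ (φ : A →+ R) (_ : ∀ r a, φ (ι r * a) = r * φ a) (_ : φ 1 = 1)
    (ap am b : Fin n → A) (cp cm : Fin n → Fin n → R)
    (_ : ∀ i k, ap i * ap k = -(ap k * ap i)) (_ : ∀ i k, ap i * am k = -(am k * ap i))
    (_ : ∀ i k, am i * am k = -(am k * am i)) (_ : ∀ i, am i * am i = 0)
    (_ : ∀ i k, b k * ap i = ι (cp i k) - ap i * b k)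
    (_ : ∀ i k, b k * am i = ι (cm i k) - am i * b k)
    (_ : ∀ i X, φ (ap i * X) = 0) (_ : ∀ i X, φ (X * am i) = 0),
    φ (List.ofFn fun i => (ap i + am i) * b i).prod =
      (Matrix.of fun i k => if i ≤ k then cm i k else -cp i k).det := by
  induction n with
  | zero =>
    intro φ _ h1 _ _ _ _ _ _ _ _ _ _ _ _ _
    simp [h1]
  | succ n ih =>
    intro φ hφ h1 ap am b cp cm hpp hpm hmm hsq hp hm kl kr
    set z : R := 1 - cm 0 0 with hz
    set W := (List.ofFn fun i : Fin n => (ap i.succ + am i.succ) * b i.succ).prod with hW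
    have hφ' : ∀ r X, φ (X * ι r) = r * φ X := fun r X => by rw [← hι, hφ]
    -- the functional for which the first pair has been absorbed
    set φ' : A →+ R := φ.comp (AddMonoidHom.mulLeft (ι z + (ap 0 + am 0) * b 0)) with hφ'd
    have hφ'a : ∀ X, φ' X = z * φ X + φ ((ap 0 + am 0) * b 0 * X) := fun X => by
      simp [hφ'd, add_mul, hφ]
    have h00 : φ ((ap 0 + am 0) * b 0) = cm 0 0 := by
      have e : (ap 0 + am 0) * b 0 = ap 0 * b 0 + (ι (cm 0 0) * 1 - b 0 * am 0) := by
        rw [hm]; noncomm_ring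
      rw [e, map_add, map_sub, kl, kr, hφ, h1]
      ring
    have e1 : φ' W = (Matrix.of fun i k : Fin n => if i ≤ k then
        cm i.succ k.succ + cp i.succ 0 * cm 0 k.succ
        else -(cp i.succ k.succ - cp i.succ 0 * cm 0 k.succ)).det := by
      have hd : ∀ (r : R) (x y : A), x * (ι r * y) = ι r * (x * y) := fun r x y => by
        rw [← mul_assoc, ← hι, mul_assoc]
      have sb : ∀ (r : R) (x y : A), x - ι r * y = x + ι (-r) * y := fun r x y => by
        rw [map_neg, neg_mul, sub_eq_add_neg]
      have anti : ∀ (r r' : R) {x x' y y' : A}, x * x' = -(x' * x) → x * y' = -(y' * x) →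
          y * x' = -(x' * y) → y * y' = -(y' * y) →
          (x + ι r * y) * (x' + ι r' * y') = -((x' + ι r' * y') * (x + ι r * y)) := by
        intro r r' x x' y y' h1 h2 h3 h4
        have ex : ∀ (r r' : R) (x x' y y' : A), (x + ι r * y) * (x' + ι r' * y') =
            x * x' + ι r' * (x * y') + ι r * (y * x') + ι (r * r') * (y * y') := by
          intro r r' x x' y y'
          rw [add_mul, mul_add, mul_add, hd, mul_assoc (ι r) y, mul_assoc (ι r) y, hd, map_mul,
            mul_assoc (ι r)]
          abel
        rw [ex, ex, h1, h2, h3, h4, mul_comm r' r]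
        noncomm_ring
      have key := ih φ' ?_ ?_ (fun i => ap i.succ - ι (cp i.succ 0) * am 0)
        (fun i => am i.succ + ι (cp i.succ 0) * am 0) (fun i => b i.succ)
        (fun i k => cp i.succ k.succ - cp i.succ 0 * cm 0 k.succ)
        (fun i k => cm i.succ k.succ + cp i.succ 0 * cm 0 k.succ) ?_ ?_ ?_ ?_ ?_ ?_ ?_ ?_
      · rw [← key, hW]
        congr 3
        funext i
        congr 1
        abel
      · intro r a
        rw [hφ'a, hφ'a, hd, hφ, hφ]
        ring
      · rw [hφ'a, mul_one, h1, h00]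
        ring
      · intro i k
        simp only [sb]
        refine anti _ _ (hpp _ _) (hpm _ _) ?_ (hmm _ _)
        rw [hpm, neg_neg]
      · intro i k
        simp only [sb]
        exact anti _ _ (hpm _ _) (hpm _ _) (hmm _ _) (hmm _ _)
      · intro i k
        exact anti _ _ (hmm _ _) (hmm _ _) (hmm _ _) (hmm _ _)
      · intro i
        simp only [mul_add, add_mul, mul_assoc, hd]
        rw [hsq, hsq, hmm i.succ 0]
        noncomm_ring
      · intro i k
        simp only [mul_sub, sub_mul, mul_assoc, hd, map_sub, map_mul]
        rw [hp, hm]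
        noncomm_ring
      · intro i k
        simp only [mul_add, add_mul, mul_assoc, hd, map_add, map_mul]
        rw [hm, hm]
        noncomm_ring
      · intro i X
        set d := cp i.succ 0
        rw [hφ'a]
        have a1 : (ap i.succ - ι d * am 0) * X = ap i.succ * X - ι d * (am 0 * X) := by
          rw [sub_mul, mul_assoc]
        have a2 : (ap 0 + am 0) * b 0 * (ap i.succ * X - ι d * (am 0 * X)) =
            ι d * (ap 0 * X) + ι d * (am 0 * X) + ap i.succ * ((ap 0 + am 0) * b 0 * X) -
            ι d * (ι (cm 0 0) * (ap 0 * X) + ι (cm 0 0) * (am 0 * X) - ap 0 * (am 0 * b 0 * X)) := by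
          have b1 : (ap 0 + am 0) * b 0 * (ap i.succ * X) =
              ι d * (ap 0 * X) + ι d * (am 0 * X) + ap i.succ * ((ap 0 + am 0) * b 0 * X) := by
            rw [mul_assoc, ← mul_assoc (b 0), hp]
            have : ap i.succ * ((ap 0 + am 0) * b 0 * X) =
                -((ap 0 + am 0) * (ap i.succ * b 0 * X)) := by
              simp only [← mul_assoc, mul_add]
              rw [hpp i.succ 0, hpm i.succ 0]
              noncomm_ring
            rw [this]
            simp only [sub_mul, mul_sub, add_mul, mul_assoc, hd]
            noncomm_ring
          have b2 : (ap 0 + am 0) * b 0 * (am 0 * X) =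
              ι (cm 0 0) * (ap 0 * X) + ι (cm 0 0) * (am 0 * X) - ap 0 * (am 0 * b 0 * X) := by
            have b3 : am 0 * (am 0 * (b 0 * X)) = 0 := by
              rw [← mul_assoc, hsq, zero_mul]
            rw [mul_assoc, ← mul_assoc (b 0), hm]
            simp only [sub_mul, mul_sub, add_mul, mul_assoc, hd, b3]
            noncomm_ring
          rw [mul_sub, b1, hd, b2]
        rw [a1, a2]
        simp only [map_sub, map_add, hφ, kl]
        rw [hz]
        ring
      · intro i X
        rw [hφ'a]
        have a1 : X * (am i.succ + ι (cp i.succ 0) * am 0) =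
            X * am i.succ + (ι (cp i.succ 0) * X) * am 0 := by
          rw [mul_add, hd, mul_assoc]
        rw [a1, mul_add, ← mul_assoc, ← mul_assoc, map_add, map_add, kr, kr, kr, kr]
        ring
    have e2 : φ W = (Matrix.of fun i k : Fin n => if i ≤ k then
        cm i.succ k.succ else -cp i.succ k.succ).det :=
      ih φ hφ h1 (fun i => ap i.succ) (fun i => am i.succ) (fun i => b i.succ)
        (fun i k => cp i.succ k.succ) (fun i k => cm i.succ k.succ)
        (fun i k => hpp _ _) (fun i k => hpm _ _) (fun i k => hmm _ _) (fun i => hsq _)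
        (fun i k => hp _ _) (fun i k => hm _ _) (fun i X => kl _ _) (fun i X => kr _ _)
    have e3 : φ (List.ofFn fun i => (ap i + am i) * b i).prod = φ' W - z * φ W := by
      rw [List.ofFn_succ, List.prod_cons, hφ'a]
      ring
    rw [e3, e1, e2, det_eq_det_schur_sub]
    simp only [Matrix.of_apply, le_refl, if_true, Fin.succ_le_succ_iff, Fin.zero_le]
    congr 2
    ext i k
    have : ¬ (i.succ ≤ (0 : Fin (n + 1))) := not_le.2 (Fin.succ_pos i)
    simp only [Matrix.of_apply, this, if_false]
    split_ifs <;> ring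

/-! ### Fermions smeared with Laurent series -/

/-- Formal power series of operators on Fock space. -/
abbrev OpSeries : Type := PowerSeries (Module.End ℂ Fock)

/-- Formal power series of Laurent polynomials. -/
abbrev SymSeries : Type := PowerSeries (LaurentPolynomial ℂ)

/-- Coefficientwise extension of an additive map to power series. -/
def mapSeries {R S : Type*} [Ring R] [Ring S] (F : R →+ S) : PowerSeries R →+ PowerSeries S where
  toFun f := PowerSeries.mk fun n => F (PowerSeries.coeff n f)
  map_zero' := by ext; simp
  map_add' f g := by ext; simp

@[simp] lemma coeff_mapSeries {R S : Type*} [Ring R] [Ring S] (F : R →+ S) (f : PowerSeries R)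
    (n : ℕ) : PowerSeries.coeff n (mapSeries F f) = F (PowerSeries.coeff n f) := by
  simp [mapSeries]

section Laurent

open LaurentPolynomial

/-- The linear functional or operator on Laurent polynomials with given values on monomials. -/
def laurentLift {M : Type*} [AddCommGroup M] [Module ℂ M] (F : ℤ → M) :
    LaurentPolynomial ℂ →ₗ[ℂ] M :=
  Finsupp.linearCombination ℂ F ∘ₗ (AddMonoidAlgebra.coeffLinearEquiv ℂ).toLinearMap

lemma laurentLift_monomial {M : Type*} [AddCommGroup M] [Module ℂ M] (F : ℤ → M)
    (c : ℂ) (k : ℤ) : laurentLift F (C c * T k) = c • F k := by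
  rw [← single_eq_C_mul_T]
  exact Finsupp.linearCombination_single ℂ c k

lemma laurentLift_T {M : Type*} [AddCommGroup M] [Module ℂ M] (F : ℤ → M) (k : ℤ) :
    laurentLift F (T k) = F k := by
  rw [← one_mul (T k), ← map_one C, laurentLift_monomial, one_smul]

/-- The constant term of a Laurent polynomial. -/
def ctL : LaurentPolynomial ℂ →ₗ[ℂ] ℂ := laurentLift fun k => if k = 0 then 1 else 0

/-- The part of a Laurent polynomial with negative exponents. -/
def negL : LaurentPolynomial ℂ →ₗ[ℂ] LaurentPolynomial ℂ :=
  laurentLift fun k => if k < 0 then T k else 0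

/-- The part of a Laurent polynomial with nonnegative exponents. -/
def posL : LaurentPolynomial ℂ →ₗ[ℂ] LaurentPolynomial ℂ :=
  laurentLift fun k => if k < 0 then 0 else T k

lemma posL_add_negL (f : LaurentPolynomial ℂ) : posL f + negL f = f := by
  induction f using LaurentPolynomial.induction_on' with
  | add f g hf hg =>
    rw [map_add, map_add, add_add_add_comm, hf, hg]
  | C_mul_T k c =>
    simp only [posL, negL, laurentLift_monomial]
    split_ifs <;> simp [smul_eq_C_mul]

/-- The constant term, coefficientwise. -/
def ctH : SymSeries →+ PowerSeries ℂ := mapSeries ctL.toAddMonoidHom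

/-- The negative part, coefficientwise. -/
def negH : SymSeries →+ SymSeries := mapSeries negL.toAddMonoidHom

/-- The nonnegative part, coefficientwise. -/
def posH : SymSeries →+ SymSeries := mapSeries posL.toAddMonoidHom

lemma coeff_ctH (f : SymSeries) (n : ℕ) :
    PowerSeries.coeff n (ctH f) = ctL (PowerSeries.coeff n f) := coeff_mapSeries _ _ _

lemma coeff_negH (f : SymSeries) (n : ℕ) :
    PowerSeries.coeff n (negH f) = negL (PowerSeries.coeff n f) := coeff_mapSeries _ _ _

lemma coeff_posH (f : SymSeries) (n : ℕ) :
    PowerSeries.coeff n (posH f) = posL (PowerSeries.coeff n f) := coeff_mapSeries _ _ _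

lemma posH_add_negH (f : SymSeries) : posH f + negH f = f := by
  ext1 n
  rw [map_add, coeff_posH, coeff_negH, posL_add_negL]

variable {R : Type*} [Ring R] [Algebra ℂ R]

/-- `∑ f_k T^k ↦ ∑ f_k F_k`, coefficientwise. -/
def smear (F : ℤ → R) : SymSeries →+ PowerSeries R := mapSeries (laurentLift F).toAddMonoidHom

lemma coeff_smear (F : ℤ → R) (f : SymSeries) (n : ℕ) :
    PowerSeries.coeff n (smear F f) = laurentLift F (PowerSeries.coeff n f) := coeff_mapSeries _ _ _

lemma laurentLift_anticomm {F G : ℤ → R} (h : ∀ i j, F i * G j = -(G j * F i))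
    (f g : LaurentPolynomial ℂ) :
    laurentLift F f * laurentLift G g = -(laurentLift G g * laurentLift F f) := by
  induction f using LaurentPolynomial.induction_on' with
  | add f f' hf hf' => simp only [map_add, add_mul, mul_add, hf, hf', neg_add]
  | C_mul_T k c =>
    induction g using LaurentPolynomial.induction_on' with
    | add f f' hf hf' => simp only [map_add, add_mul, mul_add, hf, hf', neg_add]
    | C_mul_T l d =>
      simp only [laurentLift_monomial, smul_mul_assoc, mul_smul_comm, h, smul_neg]
      rw [smul_comm]

lemma laurentLift_anticomm_dual {F G : ℤ → R}
    (h : ∀ i j, G j * F i = -(F i * G j) + if i + j = 0 then 1 else 0)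
    (f g : LaurentPolynomial ℂ) :
    laurentLift G g * laurentLift F f =
      algebraMap ℂ R (ctL (f * g)) - laurentLift F f * laurentLift G g := by
  induction f using LaurentPolynomial.induction_on' with
  | add f f' hf hf' => simp only [map_add, add_mul, mul_add, hf, hf']; abel
  | C_mul_T k c =>
    induction g using LaurentPolynomial.induction_on' with
    | add f f' hf hf' => simp only [map_add, add_mul, mul_add, hf, hf']; abel
    | C_mul_T l d =>
      have e : C c * T k * (C d * T l) = C (c * d) * (T (k + l) : LaurentPolynomial ℂ) := by
        rw [map_mul, T_add]; ring
      rw [e, ctL]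
      simp only [laurentLift_monomial, smul_mul_assoc, mul_smul_comm, h, smul_add, smul_neg,
        Algebra.algebraMap_eq_smul_one]
      simp only [smul_smul, mul_comm d c]
      split_ifs with h0
      · simp only [smul_eq_mul, mul_one]; abel
      · simp

lemma smear_anticomm {F G : ℤ → R} (h : ∀ i j, F i * G j = -(G j * F i)) (f g : SymSeries) :
    smear F f * smear G g = -(smear G g * smear F f) := by
  ext1 n
  rw [map_neg, PowerSeries.coeff_mul,
    PowerSeries.coeff_mul, ← Finset.Nat.sum_antidiagonal_swap, ← Finset.sum_neg_distrib]
  refine Finset.sum_congr rfl fun x _ => ?_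
  simp only [coeff_smear]
  exact laurentLift_anticomm h _ _

lemma smear_anticomm_dual {F G : ℤ → R}
    (h : ∀ i j, G j * F i = -(F i * G j) + if i + j = 0 then 1 else 0) (f g : SymSeries) :
    smear G g * smear F f = PowerSeries.map (algebraMap ℂ R) (ctH (f * g)) -
      smear F f * smear G g := by
  ext1 n
  rw [map_sub, PowerSeries.coeff_mul,
    PowerSeries.coeff_mul, PowerSeries.coeff_map, coeff_ctH, PowerSeries.coeff_mul,
    ← Finset.Nat.sum_antidiagonal_swap, map_sum, map_sum, ← Finset.sum_sub_distrib]
  refine Finset.sum_congr rfl fun x _ => ?_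
  simp only [coeff_smear]
  exact laurentLift_anticomm_dual h _ _

lemma smear_sq {F : ℤ → R} (h : ∀ i j, F i * F j = -(F j * F i)) (f : SymSeries) :
    smear F f * smear F f = 0 := by
  have h1 := smear_anticomm h f f
  have h2 : (2 : ℂ) • (smear F f * smear F f) = 0 := by
    rw [two_smul]
    nth_rewrite 1 [h1]
    exact neg_add_cancel _
  exact (smul_eq_zero_iff_right two_ne_zero).1 h2

/-- The Laurent series `1 - x T^e s`. -/
def factorSym (x : ℂ) (e : ℤ) : SymSeries := 1 - PowerSeries.C (C x * T e) * PowerSeries.X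

/-- If `A ψ_j = ψ_j A + x s A ψ_{j+e}`, then `A ψ(f (1 - x T^e s)) = ψ(f) A`. -/
lemma mul_smear_factorSym {F : ℤ → R} {a : ℕ → R} {x : ℂ} {e : ℤ} (h0 : a 0 = 1)
    (h : ∀ n j, a (n + 1) * F j = F j * a (n + 1) + x • (a n * F (j + e))) (f : SymSeries) :
    PowerSeries.mk a * smear F (f * factorSym x e) = smear F f * PowerSeries.mk a := by
  have key : ∀ (n : ℕ) (p : LaurentPolynomial ℂ), a (n + 1) * laurentLift F p =
      laurentLift F p * a (n + 1) + a n * laurentLift F (p * (C x * T e)) := by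
    intro n p
    induction p using LaurentPolynomial.induction_on' with
    | add f f' hf hf' => simp only [map_add, add_mul, mul_add, hf, hf']; abel
    | C_mul_T k c =>
      have e : C c * T k * (C x * T e) = C (c * x) * (T (k + e) : LaurentPolynomial ℂ) := by
        rw [map_mul, T_add]; ring
      rw [e]
      simp only [laurentLift_monomial, mul_smul_comm, smul_mul_assoc, h, smul_add, smul_smul]
  have hX : ∀ g : SymSeries, PowerSeries.mk a * smear F (g * PowerSeries.X) =
      PowerSeries.X * PowerSeries.mk a * smear F g := by
    intro g
    have : smear F (g * PowerSeries.X) = PowerSeries.X * smear F g := by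
      ext1 n
      rw [coeff_smear]
      cases n with
      | zero => simp
      | succ n => rw [PowerSeries.coeff_succ_mul_X, PowerSeries.coeff_succ_X_mul, coeff_smear]
    rw [this, ← mul_assoc, ← PowerSeries.X_mul]
  rw [factorSym, mul_sub, mul_one, map_sub, mul_sub, ← mul_assoc, hX, sub_eq_iff_eq_add]
  ext1 n
  rw [map_add, PowerSeries.coeff_mul, PowerSeries.coeff_mul, PowerSeries.coeff_mul,
    ← Finset.Nat.sum_antidiagonal_swap (n := n) (f := fun p => PowerSeries.coeff p.1 (smear F f) *
      PowerSeries.coeff p.2 (PowerSeries.mk a)), ← Finset.sum_add_distrib]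
  refine Finset.sum_congr rfl fun y _ => ?_
  simp only [coeff_smear, Prod.fst_swap, Prod.snd_swap, PowerSeries.coeff_mk,
    PowerSeries.coeff_mul_C]
  cases y.1 with
  | zero => simp [h0]
  | succ i => rw [PowerSeries.coeff_succ_X_mul, PowerSeries.coeff_mk, key]

/-- If `A ψ*_j = ψ*_j A - x s ψ*_{j+e} A`, then `A ψ*(f) = ψ*(f (1 - x T^e s)) A`. -/
lemma mul_smear_star {F : ℤ → R} {a : ℕ → R} {x : ℂ} {e : ℤ} (h0 : a 0 = 1)
    (h : ∀ n j, a (n + 1) * F j = F j * a (n + 1) - x • (F (j + e) * a n)) (f : SymSeries) :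
    PowerSeries.mk a * smear F f = smear F (f * factorSym x e) * PowerSeries.mk a := by
  have key : ∀ (n : ℕ) (p : LaurentPolynomial ℂ), laurentLift F p * a (n + 1) =
      a (n + 1) * laurentLift F p + laurentLift F (p * (C x * T e)) * a n := by
    intro n p
    induction p using LaurentPolynomial.induction_on' with
    | add f f' hf hf' => simp only [map_add, add_mul, mul_add, hf, hf']; abel
    | C_mul_T k c =>
      have e : C c * T k * (C x * T e) = C (c * x) * (T (k + e) : LaurentPolynomial ℂ) := by
        rw [map_mul, T_add]; ring
      rw [e]
      simp only [laurentLift_monomial, mul_smul_comm, smul_mul_assoc, h, smul_sub, smul_smul,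
        sub_add_cancel]
  have hX : ∀ g : SymSeries, smear F (g * PowerSeries.X) * PowerSeries.mk a =
      smear F g * (PowerSeries.X * PowerSeries.mk a) := by
    intro g
    have : smear F (g * PowerSeries.X) = smear F g * PowerSeries.X := by
      ext1 n
      rw [coeff_smear]
      cases n with
      | zero => simp
      | succ n => rw [PowerSeries.coeff_succ_mul_X, PowerSeries.coeff_succ_mul_X, coeff_smear]
    rw [this, mul_assoc]
  rw [factorSym, mul_sub, mul_one, map_sub, sub_mul, ← mul_assoc, hX, eq_sub_iff_add_eq, eq_comm]
  ext1 n
  rw [map_add, PowerSeries.coeff_mul, PowerSeries.coeff_mul, PowerSeries.coeff_mul,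
    ← Finset.Nat.sum_antidiagonal_swap (n := n) (f := fun p => PowerSeries.coeff p.1
      (PowerSeries.mk a) * PowerSeries.coeff p.2 (smear F f)), ← Finset.sum_add_distrib]
  refine Finset.sum_congr rfl fun y _ => ?_
  simp only [coeff_smear, Prod.fst_swap, Prod.snd_swap, PowerSeries.coeff_mk,
    PowerSeries.coeff_mul_C]
  cases y.2 with
  | zero => simp [h0]
  | succ i => rw [PowerSeries.coeff_succ_X_mul, PowerSeries.coeff_mk, key]

end Laurent

/-! ### Normal ordering of vertex operators -/

section Intertwines

variable {R : Type*} [Ring R] [Algebra ℂ R] {F G : ℤ → R}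

/-- Conjugation by `A` multiplies the symbol of a fermion by `u⁻¹` and the symbol of a dual
fermion by `u`. -/
structure Intertwines (F G : ℤ → R) (A : PowerSeries R) (u : SymSeries) : Prop where
  mul_smear : ∀ f, A * smear F (f * u) = smear F f * A
  mul_star : ∀ f, A * smear G f = smear G (f * u) * A

lemma Intertwines.one : Intertwines F G 1 1 := ⟨fun f => by simp, fun f => by simp⟩

lemma Intertwines.mul {A B : PowerSeries R} {u v : SymSeries} (hA : Intertwines F G A u)
    (hB : Intertwines F G B v) : Intertwines F G (A * B) (u * v) := by
  refine ⟨fun f => ?_, fun f => ?_⟩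
  · rw [mul_assoc, ← mul_assoc f, hB.mul_smear, ← mul_assoc, hA.mul_smear, mul_assoc]
  · rw [mul_assoc, hB.mul_star, ← mul_assoc, hA.mul_star, mul_assoc, mul_assoc, mul_comm v u]

lemma Intertwines.sub {A B : PowerSeries R} {u : SymSeries} (hA : Intertwines F G A u)
    (hB : Intertwines F G B u) : Intertwines F G (A - B) u := by
  refine ⟨fun f => ?_, fun f => ?_⟩
  · rw [sub_mul, mul_sub, hA.mul_smear, hB.mul_smear]
  · rw [sub_mul, mul_sub, hA.mul_star, hB.mul_star]

lemma map_algebraMap_comm (r : PowerSeries ℂ) (a : PowerSeries R) :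
    PowerSeries.map (algebraMap ℂ R) r * a = a * PowerSeries.map (algebraMap ℂ R) r := by
  refine commute_of_coeff fun i j => ?_
  rw [PowerSeries.coeff_map]
  exact Algebra.commutes _ _

lemma Intertwines.scalar_mul {A : PowerSeries R} {u : SymSeries} (hA : Intertwines F G A u)
    (r : PowerSeries ℂ) : Intertwines F G (PowerSeries.map (algebraMap ℂ R) r * A) u := by
  refine ⟨fun f => ?_, fun f => ?_⟩
  · rw [mul_assoc, hA.mul_smear, ← mul_assoc, map_algebraMap_comm, mul_assoc]
  · rw [mul_assoc, hA.mul_star, ← mul_assoc, map_algebraMap_comm, mul_assoc]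

/-- The lemma of Schur for power series of operators: the lowest coefficient of `D` commutes with all
fermions, so it vanishes if `φ` detects scalars and vanishes on `D`. -/
lemma Intertwines.eq_zero {D : PowerSeries R} {u : SymSeries} (hD : Intertwines F G D u)
    (hu : PowerSeries.coeff 0 u = 1) (φ : R → ℂ)
    (hφ : ∀ X, (∀ j, X * F j = F j * X) → (∀ j, X * G j = G j * X) → φ X = 0 → X = 0)
    (h0 : ∀ n, φ (PowerSeries.coeff n D) = 0) : D = 0 := by
  ext1 n
  rw [map_zero]
  induction n using Nat.strong_induction_on with
  | _ n ih =>
  have hl : ∀ f : PowerSeries R, PowerSeries.coeff n (D * f) =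
      PowerSeries.coeff n D * PowerSeries.coeff 0 f := fun f => by
    rw [PowerSeries.coeff_mul, Finset.sum_eq_single (n, 0)]
    · intro y hy hne
      have h1 := Finset.HasAntidiagonal.mem_antidiagonal.1 hy
      have h2 : y.1 < n := by
        by_contra hcon
        exact hne (Prod.ext (by simp only; omega) (by simp only; omega))
      rw [ih _ h2, zero_mul]
    · intro h
      exact absurd (Finset.HasAntidiagonal.mem_antidiagonal.2 (add_zero n)) h
  have hr : ∀ f : PowerSeries R, PowerSeries.coeff n (f * D) =
      PowerSeries.coeff 0 f * PowerSeries.coeff n D := fun f => by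
    rw [PowerSeries.coeff_mul, Finset.sum_eq_single (0, n)]
    · intro y hy hne
      have h1 := Finset.HasAntidiagonal.mem_antidiagonal.1 hy
      have h2 : y.2 < n := by
        by_contra hcon
        exact hne (Prod.ext (by simp only; omega) (by simp only; omega))
      rw [ih _ h2, mul_zero]
    · intro h
      exact absurd (Finset.HasAntidiagonal.mem_antidiagonal.2 (zero_add n)) h
  refine hφ _ (fun j => ?_) (fun j => ?_) (h0 n)
  · have h := congrArg (PowerSeries.coeff n)
      (hD.mul_smear (PowerSeries.C (LaurentPolynomial.T j)))
    rw [hl, hr, coeff_smear, coeff_smear, PowerSeries.coeff_C_mul, hu, mul_one] at h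
    simpa [laurentLift_T] using h
  · have h := congrArg (PowerSeries.coeff n)
      (hD.mul_star (PowerSeries.C (LaurentPolynomial.T j)))
    rw [hl, hr, coeff_smear, coeff_smear, PowerSeries.coeff_C_mul, hu, mul_one] at h
    simpa [laurentLift_T] using h

end Intertwines

/-- `ψ(f)` for a series of Laurent polynomials `f`. -/
def psiH : SymSeries →+ OpSeries := smear (R := Module.End ℂ Fock) psi

/-- `ψ*(f) = ∑ f_k ψ*_{-k}` for a series of Laurent polynomials `f`. -/
def psiSH : SymSeries →+ OpSeries := smear (R := Module.End ℂ Fock) fun k => psiStar (-k)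

/-- `Γ₊(x s)` as a power series in `s`. -/
def GP (x : ℂ) : OpSeries := PowerSeries.mk fun n => x ^ n • gp n

/-- `Γ₋(x s)` as a power series in `s`. -/
def GM (x : ℂ) : OpSeries := PowerSeries.mk fun n => x ^ n • gm n

/-- Scalar power series as series of operators. -/
def scalarSeries : PowerSeries ℂ →+* OpSeries :=
  PowerSeries.map (algebraMap ℂ (Module.End ℂ Fock))

/-- Conjugation of the fermions by `A` multiplies symbols by `u^{∓1}`. -/
abbrev Conj (A : OpSeries) (u : SymSeries) : Prop :=
  Intertwines (R := Module.End ℂ Fock) psi (fun k => psiStar (-k)) A u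

lemma smul_rearrange {R : Type*} [Ring R] [Algebra ℂ R] {a a' p q : R} (h : a' * p = p * a' + a * q) (x : ℂ)
    (n : ℕ) : (x ^ (n + 1) • a') * p = p * (x ^ (n + 1) • a') + x • ((x ^ n • a) * q) := by
  rw [smul_mul_assoc, h, smul_add, mul_smul_comm, smul_mul_assoc, smul_smul, pow_succ']

lemma smul_rearrange_star {R : Type*} [Ring R] [Algebra ℂ R] {a a' p q : R}
    (h : a' * p = p * a' - q * a) (x : ℂ)
    (n : ℕ) : (x ^ (n + 1) • a') * p = p * (x ^ (n + 1) • a') - x • (q * (x ^ n • a)) := by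
  rw [smul_mul_assoc, h, smul_sub, mul_smul_comm, mul_smul_comm, smul_smul, pow_succ']

/-- `Γ₊(x s)` multiplies symbols by `(1 - x s T)^{∓1}`. -/
lemma conj_GP (x : ℂ) : Conj (GP x) (factorSym x 1) := by
  refine ⟨fun f => ?_, fun f => ?_⟩
  · refine mul_smear_factorSym (R := Module.End ℂ Fock) (by simp [gp_zero]) (fun n j => ?_) f
    exact smul_rearrange (R := Module.End ℂ Fock) (gp_succ_mul_psi n j) x n
  · refine mul_smear_star (R := Module.End ℂ Fock) (by simp [gp_zero]) (fun n j => ?_) f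
    refine smul_rearrange_star (R := Module.End ℂ Fock) ?_ x n
    rw [neg_add, ← sub_eq_add_neg]
    exact gp_succ_mul_psiStar n _

/-- `Γ₋(x s)` multiplies symbols by `(1 - x s T⁻¹)^{∓1}`. -/
lemma conj_GM (x : ℂ) : Conj (GM x) (factorSym x (-1)) := by
  refine ⟨fun f => ?_, fun f => ?_⟩
  · refine mul_smear_factorSym (R := Module.End ℂ Fock) (by simp [gm_zero]) (fun n j => ?_) f
    exact smul_rearrange (R := Module.End ℂ Fock) (gm_succ_mul_psi n j) x n
  · refine mul_smear_star (R := Module.End ℂ Fock) (by simp [gm_zero]) (fun n j => ?_) f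
    refine smul_rearrange_star (R := Module.End ℂ Fock) ?_ x n
    rw [neg_add, neg_neg]
    exact gm_succ_mul_psiStar n _

/-- The vacuum expectation value `(A v_0, v_0)`, coefficientwise. -/
def vev : OpSeries →+ PowerSeries ℂ where
  toFun A := PowerSeries.mk fun n => (PowerSeries.coeff n A) (basisVec (vac 0)) (vac 0)
  map_zero' := by ext; simp
  map_add' A B := by ext; simp

lemma coeff_vev (A : OpSeries) (n : ℕ) : PowerSeries.coeff n (vev A) =
    (PowerSeries.coeff n A) (basisVec (vac 0)) (vac 0) := by simp [vev]

lemma vev_scalar_mul (r : PowerSeries ℂ) (A : OpSeries) :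
    vev (scalarSeries r * A) = r * vev A := by
  ext n
  rw [coeff_vev, PowerSeries.coeff_mul, PowerSeries.coeff_mul, LinearMap.sum_apply,
    Finsupp.finsetSum_apply]
  refine Finset.sum_congr rfl fun y _ => ?_
  rw [coeff_vev, scalarSeries, PowerSeries.coeff_map, Module.End.mul_apply,
    Module.algebraMap_end_apply, Finsupp.smul_apply, smul_eq_mul]

lemma vev_one : vev 1 = 1 := by
  ext n
  rw [coeff_vev, PowerSeries.coeff_one, PowerSeries.coeff_one]
  split_ifs
  · simp [basisVec]
  · simp

/-- `Γ₊` on the left may be dropped from a vacuum expectation value. -/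
lemma vev_GP_mul (x : ℂ) (A : OpSeries) : vev (GP x * A) = vev A := by
  ext n
  rw [coeff_vev, coeff_vev, PowerSeries.coeff_mul, LinearMap.sum_apply,
    Finsupp.finsetSum_apply, Finset.sum_eq_single (0, n)]
  · simp [GP, gp_zero]
  · intro y hy hne
    have h1 := Finset.HasAntidiagonal.mem_antidiagonal.1 hy
    have h2 : y.1 ≠ 0 := fun h => hne (Prod.ext h (by simp only; omega))
    rw [GP, PowerSeries.coeff_mk, Module.End.mul_apply, LinearMap.smul_apply, Finsupp.smul_apply,
      gp_apply_vac _ h2, smul_zero]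
  · intro h
    exact absurd (Finset.HasAntidiagonal.mem_antidiagonal.2 (zero_add n)) h

/-- `Γ₋` on the right may be dropped from a vacuum expectation value. -/
lemma vev_mul_GM (x : ℂ) (A : OpSeries) : vev (A * GM x) = vev A := by
  ext n
  rw [coeff_vev, coeff_vev, PowerSeries.coeff_mul, LinearMap.sum_apply,
    Finsupp.finsetSum_apply, Finset.sum_eq_single (n, 0)]
  · simp [GM, gm_zero]
  · intro y hy hne
    have h1 := Finset.HasAntidiagonal.mem_antidiagonal.1 hy
    have h2 : y.2 ≠ 0 := fun h => hne (Prod.ext (by simp only; omega) h)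
    rw [GM, PowerSeries.coeff_mk, Module.End.mul_apply, LinearMap.smul_apply,
      gm_vacuum _ h2, smul_zero, map_zero, Finsupp.zero_apply]
  · intro h
    exact absurd (Finset.HasAntidiagonal.mem_antidiagonal.2 (add_zero n)) h

/-- There is exactly one diagram obtained from the vacuum by adding a horizontal strip of
size `n`. -/
lemma existsUnique_strip (n : ℕ) : ∃! T : Maya, (vac 0).Inter T ∧
    T.energy = (vac 0).energy + n := by
  have hz : Ptn.zero.maya 0 = vac 0 := Ptn.maya_zero (fun _ => rfl) 0
  have key : ∀ lam : Ptn, (vac 0).Inter (lam.maya 0) ↔ ∀ k, lam.part (k + 1) = 0 := fun lam => by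
    rw [← hz, Ptn.inter_maya]
    simp only [Ptn.zero, Pi.zero_apply, true_and]
    exact forall_congr' fun k => by constructor <;> intro h <;> omega
  have hen : ∀ lam : Ptn, (∀ k, lam.part (k + 1) = 0) →
      (lam.maya 0).energy = (vac 0).energy + lam.part 0 := fun lam h => by
    rw [Ptn.energy_maya 1 lam (fun k hk => ?_)]
    · simp
    · obtain ⟨j, rfl⟩ := Nat.exists_eq_add_of_le' hk
      exact h j
  refine ⟨Ptn.maya 0 ⟨fun k => if k = 0 then n else 0, ?_, 1, ?_⟩, ⟨?_, ?_⟩, ?_⟩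
  · intro i j hij
    by_cases hj : j = 0
    · have : i = 0 := by omega
      simp [hj, this]
    · simp [hj]
  · intro k hk
    have : k ≠ 0 := by omega
    simp [this]
  · rw [key]; simp
  · rw [hen _ (by simp)]; simp
  · rintro T ⟨h1, h2⟩
    obtain ⟨c, lam, rfl⟩ := T.exists_eq_maya
    have hc : c = 0 := by
      rw [← hz, Ptn.inter_maya] at h1
      exact h1.1.symm
    subst hc
    rw [key] at h1
    rw [hen _ h1] at h2
    congr 1
    ext k
    cases k with
    | zero => simp; omega
    | succ k => simp [h1 k]

/-- By the Pieri rule the vacuum matrix element of `gm i * gp k` counts the common horizontal strips of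
sizes `i` and `k`, so it is `1` for `i = k` and `0` otherwise. -/
lemma vev_GM_mul_GP (x y : ℂ) :
    vev (GM x * GP y) * (1 - PowerSeries.C (x * y) * PowerSeries.X ^ 2) = 1 := by
  have h1 : ∀ i k : ℕ, (gm i * gp k) (basisVec (vac 0)) (vac 0) = if i = k then 1 else 0 := by
    intro i k
    obtain ⟨T₀, ⟨hT, hE⟩, hu⟩ := existsUnique_strip k
    have hv : gp k (basisVec (vac 0)) = basisVec T₀ := by
      ext T
      have := congrFun (congrFun (gp_apply k) (vac 0)) T
      rw [this, pieri, basisVec, Finsupp.single_apply]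
      refine if_congr ⟨fun h => (hu T h).symm, ?_⟩ rfl rfl
      rintro rfl
      exact ⟨hT, hE⟩
    rw [Module.End.mul_apply, hv]
    have := congrFun (congrFun (gm_apply i) (vac 0)) T₀
    rw [this, pieri]
    refine if_congr ⟨fun h => ?_, ?_⟩ rfl rfl
    · have := h.2
      rw [hE] at this
      omega
    · rintro rfl
      exact ⟨hT, hE⟩
  have h2 : ∀ n, PowerSeries.coeff n (vev (GM x * GP y)) =
      ∑ p ∈ Finset.HasAntidiagonal.antidiagonal n, if p.1 = p.2 then x ^ p.1 * y ^ p.2 else 0 := by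
    intro n
    rw [coeff_vev, PowerSeries.coeff_mul, LinearMap.sum_apply, Finsupp.finsetSum_apply]
    refine Finset.sum_congr rfl fun p _ => ?_
    have h3 := h1 p.1 p.2
    rw [Module.End.mul_apply] at h3
    simp only [GM, GP, PowerSeries.coeff_mk, Module.End.mul_apply, LinearMap.smul_apply, map_smul,
      Finsupp.smul_apply, h3, smul_eq_mul]
    split_ifs <;> ring
  have h3 : ∀ n, PowerSeries.coeff (n + 2) (vev (GM x * GP y)) =
      x * y * PowerSeries.coeff n (vev (GM x * GP y)) := by
    intro n
    rw [h2, h2, Finset.Nat.sum_antidiagonal_succ, Finset.Nat.sum_antidiagonal_succ', Finset.mul_sum]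
    simp only [Nat.succ_ne_zero, add_left_inj, if_false, zero_add, (Nat.succ_ne_zero _).symm]
    refine Finset.sum_congr rfl fun p _ => ?_
    split_ifs <;> ring
  ext n
  rw [mul_sub, mul_one, map_sub, ← mul_assoc, mul_comm (vev _), mul_assoc, PowerSeries.coeff_C_mul]
  match n with
  | 0 => rw [PowerSeries.coeff_mul_X_pow', h2]; simp
  | 1 =>
    rw [PowerSeries.coeff_mul_X_pow', h2, Finset.Nat.sum_antidiagonal_succ]
    simp [PowerSeries.coeff_one]
  | n + 2 => rw [PowerSeries.coeff_mul_X_pow, h3, PowerSeries.coeff_one]; simp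

lemma coeff_zero_factorSym (x : ℂ) (e : ℤ) : PowerSeries.coeff 0 (factorSym x e) = 1 := by
  simp [factorSym]

/-- The commutation relation `Γ₋(x s) Γ₊(y s) = (1 - x y s²)⁻¹ Γ₊(y s) Γ₋(x s)`. -/
lemma GM_mul_GP (x y : ℂ) :
    GM x * GP y = scalarSeries (1 - PowerSeries.C (x * y) * PowerSeries.X ^ 2)⁻¹ *
      (GP y * GM x) := by
  have hc : (1 - PowerSeries.C (x * y) * PowerSeries.X ^ 2 : PowerSeries ℂ)⁻¹ =
      vev (GM x * GP y) := by
    rw [eq_comm, PowerSeries.eq_inv_iff_mul_eq_one (by simp)]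
    exact vev_GM_mul_GP x y
  rw [hc]
  have h1 : Conj (GM x * GP y) (factorSym x (-1) * factorSym y 1) := (conj_GM x).mul (conj_GP y)
  have h2 : Conj (GP y * GM x) (factorSym x (-1) * factorSym y 1) := by
    rw [mul_comm (factorSym x (-1))]
    exact (conj_GP y).mul (conj_GM x)
  have h3 := Intertwines.sub (R := Module.End ℂ Fock) h1
    (Intertwines.scalar_mul (R := Module.End ℂ Fock) h2 (vev (GM x * GP y)))
  have h4 : vev (GP y * GM x) = 1 := by
    rw [vev_GP_mul, ← one_mul (GM x), vev_mul_GM, vev_one]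
  refine sub_eq_zero.1 (Intertwines.eq_zero (R := Module.End ℂ Fock) h3 ?_
    (fun X => X (basisVec (vac 0)) (vac 0)) (fun X e1 e2 e3 => ?_) fun n => ?_)
  · rw [PowerSeries.coeff_mul]
    simp [coeff_zero_factorSym]
  · exact end_eq_zero_of_commute e1 (fun j => by simpa using e2 (-j)) e3
  · rw [← coeff_vev]
    have h5 := vev_scalar_mul (vev (GM x * GP y)) (GP y * GM x)
    rw [h4, mul_one] at h5
    erw [map_sub vev, h5, sub_self, map_zero]

/-! ### Vacuum expectation values of words and fermions -/

/-- A vertex operator: `(true, x)` stands for `Γ₋(x s)` and `(false, x)` for `Γ₊(x s)`. -/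
abbrev Letter : Type := Bool × ℂ

/-- The vertex operator of a letter. -/
def letterOp (l : Letter) : OpSeries := if l.1 then GM l.2 else GP l.2

/-- The Laurent series by which a letter acts on the symbols of fermions. -/
def letterSym (l : Letter) : SymSeries := factorSym l.2 (if l.1 then -1 else 1)

lemma conj_letterOp (l : Letter) : Conj (letterOp l) (letterSym l) := by
  rcases l with ⟨_ | _, x⟩
  · exact conj_GP x
  · exact conj_GM x

/-- The product of the vertex operators of a word. -/
def wordOp (w : List Letter) : OpSeries := (w.map letterOp).prod

lemma conj_wordOp (w : List Letter) : Conj (wordOp w) (w.map letterSym).prod := by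
  induction w with
  | nil => exact Intertwines.one
  | cons l w ih =>
    have e : wordOp (l :: w) = letterOp l * wordOp w := by simp [wordOp]
    rw [e, List.map_cons, List.prod_cons]
    exact (conj_letterOp l).mul ih

/-- The letters `Γ₊` of a word. -/
def plusPart (w : List Letter) : List Letter := w.filter fun l => !l.1

/-- The letters `Γ₋` of a word. -/
def minusPart (w : List Letter) : List Letter := w.filter fun l => l.1

/-- The scalar that appears when a word is brought into normal order. -/
def vacFactor : List Letter → PowerSeries ℂ
  | [] => 1
  | l :: w => (if l.1 then ((plusPart w).map fun l' =>
      (1 - PowerSeries.C (l.2 * l'.2) * PowerSeries.X ^ 2)⁻¹).prod else 1) * vacFactor w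

lemma GM_mul_wordOp (x : ℂ) (w : List Letter) (hw : ∀ l ∈ w, l.1 = false) :
    GM x * wordOp w = scalarSeries (w.map fun l' =>
      (1 - PowerSeries.C (x * l'.2) * PowerSeries.X ^ 2)⁻¹).prod * (wordOp w * GM x) := by
  induction w with
  | nil => simp [wordOp]
  | cons l w ih =>
    have e : wordOp (l :: w) = GP l.2 * wordOp w := by
      simp [wordOp, letterOp, hw l List.mem_cons_self]
    have hs := map_algebraMap_comm (R := Module.End ℂ Fock) (w.map fun l' =>
      (1 - PowerSeries.C (x * l'.2) * PowerSeries.X ^ 2)⁻¹).prod (GP l.2)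
    rw [e, ← mul_assoc, GM_mul_GP, mul_assoc, mul_assoc,
      ih fun l hl => hw l (List.mem_cons_of_mem _ hl), List.map_cons, List.prod_cons, map_mul scalarSeries,
      mul_assoc (scalarSeries _) (scalarSeries _), ← mul_assoc (GP l.2)]
    erw [← hs]
    simp only [mul_assoc]
    rfl

/-- Normal ordering of a product of vertex operators. -/
lemma wordOp_eq (w : List Letter) : wordOp w =
    scalarSeries (vacFactor w) * (wordOp (plusPart w) * wordOp (minusPart w)) := by
  induction w with
  | nil => simp [wordOp, vacFactor, plusPart, minusPart]
  | cons l w ih =>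
    have e : wordOp (l :: w) = letterOp l * wordOp w := by simp [wordOp]
    have hs : ∀ y : OpSeries, y * scalarSeries (vacFactor w) = scalarSeries (vacFactor w) * y :=
      fun y => (map_algebraMap_comm (R := Module.End ℂ Fock) (vacFactor w) y).symm
    rw [e, ih, ← mul_assoc, hs, vacFactor, map_mul, mul_assoc]
    rcases l with ⟨_ | _, x⟩
    · have e1 : wordOp (plusPart ((false, x) :: w)) = GP x * wordOp (plusPart w) := by
        simp [wordOp, plusPart, letterOp]
      have e2 : wordOp (minusPart ((false, x) :: w)) = wordOp (minusPart w) := by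
        simp [wordOp, minusPart]
      rw [e1, e2]
      simp [letterOp, mul_assoc]
    · have e1 : wordOp (plusPart ((true, x) :: w)) = wordOp (plusPart w) := by
        simp [wordOp, plusPart]
      have e2 : wordOp (minusPart ((true, x) :: w)) = GM x * wordOp (minusPart w) := by
        simp [wordOp, minusPart, letterOp]
      have e3 : letterOp (true, x) = GM x := by simp [letterOp]
      rw [e1, e2, e3, if_pos rfl, ← mul_assoc (GM x), GM_mul_wordOp x (plusPart w) (fun l hl => by
        simpa [plusPart] using (List.mem_filter.1 hl).2), ← mul_assoc, ← mul_assoc, ← mul_assoc,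
        ← mul_assoc, hs]
      simp only [mul_assoc]

lemma vev_plus_mul (w : List Letter) (hw : ∀ l ∈ w, l.1 = false) (A : OpSeries) :
    vev (wordOp w * A) = vev A := by
  induction w with
  | nil => simp [wordOp]
  | cons l w ih =>
    have e : wordOp (l :: w) = GP l.2 * wordOp w := by
      simp [wordOp, letterOp, hw l List.mem_cons_self]
    rw [e, mul_assoc, vev_GP_mul, ih fun l hl => hw l (List.mem_cons_of_mem _ hl)]

lemma vev_mul_minus (w : List Letter) (hw : ∀ l ∈ w, l.1 = true) : ∀ A : OpSeries,
    vev (A * wordOp w) = vev A := by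
  induction w with
  | nil => simp [wordOp]
  | cons l w ih =>
    intro A
    have e : wordOp (l :: w) = GM l.2 * wordOp w := by
      simp [wordOp, letterOp, hw l List.mem_cons_self]
    rw [e, ← mul_assoc, ih fun l hl => hw l (List.mem_cons_of_mem _ hl), vev_mul_GM]

/-- An operator that is moved through the letters `Γ₊` meets the vacuum on both sides. -/
lemma vev_mul_wordOp (w : List Letter) {A A' : OpSeries}
    (hA : A * wordOp (plusPart w) = wordOp (plusPart w) * A') :
    vev (A * wordOp w) = vacFactor w * vev A' := by
  have hs : A * scalarSeries (vacFactor w) = scalarSeries (vacFactor w) * A :=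
    (map_algebraMap_comm (R := Module.End ℂ Fock) (vacFactor w) A).symm
  rw [wordOp_eq, ← mul_assoc, hs, mul_assoc, vev_scalar_mul, ← mul_assoc, hA, mul_assoc,
    vev_plus_mul _ fun l hl => by simpa [plusPart] using (List.mem_filter.1 hl).2,
    vev_mul_minus _ fun l hl => by simpa [minusPart] using (List.mem_filter.1 hl).2]

lemma coeff_psiH (f : SymSeries) (n : ℕ) : PowerSeries.coeff n (psiH f) =
    laurentLift (M := Module.End ℂ Fock) psi (PowerSeries.coeff n f) :=
  coeff_smear (R := Module.End ℂ Fock) _ _ _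

lemma laurentLift_psi_posL (f : LaurentPolynomial ℂ) (v : Fock) :
    (laurentLift (M := Module.End ℂ Fock) psi (posL f)) v (vac 0) = 0 := by
  induction f using LaurentPolynomial.induction_on' with
  | add f g hf hg => rw [map_add, map_add, LinearMap.add_apply, Finsupp.add_apply, hf, hg, add_zero]
  | C_mul_T k c =>
    rw [posL, laurentLift_monomial, map_smul, LinearMap.smul_apply, Finsupp.smul_apply]
    split_ifs with hk
    · simp
    · rw [laurentLift_T, psi_apply, if_neg (by rw [mem_vac]; exact hk), smul_zero]

lemma laurentLift_psi_negL (f : LaurentPolynomial ℂ) :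
    (laurentLift (M := Module.End ℂ Fock) psi (negL f)) (basisVec (vac 0)) = 0 := by
  induction f using LaurentPolynomial.induction_on' with
  | add f g hf hg => rw [map_add, map_add, LinearMap.add_apply, hf, hg, add_zero]
  | C_mul_T k c =>
    rw [negL, laurentLift_monomial, map_smul, LinearMap.smul_apply]
    split_ifs with hk
    · rw [laurentLift_T, psi_basisVec_of_mem (mem_vac.2 hk), smul_zero]
    · simp

/-- Vectors in the image of `ψ_k` with `k ≥ 0` have no vacuum component. -/
lemma vev_posH_mul (f : SymSeries) (A : OpSeries) : vev (psiH (posH f) * A) = 0 := by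
  ext n
  rw [coeff_vev, PowerSeries.coeff_mul, LinearMap.sum_apply, Finsupp.finsetSum_apply]
  refine Finset.sum_eq_zero fun p _ => ?_
  have h := laurentLift_psi_posL (PowerSeries.coeff p.1 f)
    ((PowerSeries.coeff p.2 A) (basisVec (vac 0)))
  rw [Module.End.mul_apply, coeff_psiH, coeff_posH]
  exact h

/-- `ψ_k` with `k < 0` kills the vacuum. -/
lemma vev_mul_negH (f : SymSeries) (A : OpSeries) : vev (A * psiH (negH f)) = 0 := by
  ext n
  rw [coeff_vev, PowerSeries.coeff_mul, LinearMap.sum_apply, Finsupp.finsetSum_apply]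
  refine Finset.sum_eq_zero fun p _ => ?_
  have h := laurentLift_psi_negL (PowerSeries.coeff p.2 f)
  rw [Module.End.mul_apply, coeff_psiH, coeff_negH]
  erw [h]
  simp

lemma psi_anticomm (f g : SymSeries) : psiH f * psiH g = -(psiH g * psiH f) :=
  smear_anticomm (R := Module.End ℂ Fock) psi_mul_psi f g

lemma psiStar_psi_anticomm (f g : SymSeries) :
    psiSH g * psiH f = scalarSeries (ctH (f * g)) - psiH f * psiSH g := by
  refine smear_anticomm_dual (R := Module.End ℂ Fock) (fun i j => ?_) f g
  have h := psiStar_mul_psi (-j) i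
  simp only [eq_neg_iff_add_eq_zero] at h
  exact h

/-- Wick's theorem for products of fermions with arbitrary symbols. -/
lemma vev_fermions {n : ℕ} (f g : Fin n → SymSeries) :
    vev (List.ofFn fun i => psiH (f i) * psiSH (g i)).prod =
      (Matrix.of fun i k => if i ≤ k then ctH (negH (f i) * g k)
        else -ctH (posH (f i) * g k)).det := by
  have h1 : ∀ (r : PowerSeries ℂ) (a : OpSeries), scalarSeries r * a = a * scalarSeries r :=
    map_algebraMap_comm (R := Module.End ℂ Fock)
  have h2 : ∀ f : SymSeries, psiH f * psiH f = 0 :=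
    smear_sq (R := Module.End ℂ Fock) psi_mul_psi
  have h := wick (A := OpSeries) (R := PowerSeries ℂ) scalarSeries h1 n vev vev_scalar_mul
    vev_one (fun i => psiH (posH (f i))) (fun i => psiH (negH (f i))) (fun i => psiSH (g i))
    (fun i k => ctH (posH (f i) * g k)) (fun i k => ctH (negH (f i) * g k))
    (fun i k => psi_anticomm (posH (f i)) (posH (f k)))
    (fun i k => psi_anticomm (posH (f i)) (negH (f k)))
    (fun i k => psi_anticomm (negH (f i)) (negH (f k)))
    (fun i => h2 (negH (f i)))
    (fun i k => psiStar_psi_anticomm (posH (f i)) (g k))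
    (fun i k => psiStar_psi_anticomm (negH (f i)) (g k))
    (fun i X => vev_posH_mul (f i) X) (fun i X => vev_mul_negH (f i) X)
  rw [← h]
  congr 3
  funext i
  rw [← map_add, posH_add_negH]

/-- Fermion pairs with given symbols, moved through an operator. -/
lemma Conj.fermions_mul {A : OpSeries} {u : SymSeries} (hA : Conj A u) {α : Type*}
    {f g f' g' : α → SymSeries} : ∀ {L : List α} (_ : ∀ i ∈ L, f' i = f i * u)
    (_ : ∀ i ∈ L, g i = g' i * u), (L.map fun i => psiH (f i) * psiSH (g i)).prod * A =
      A * (L.map fun i => psiH (f' i) * psiSH (g' i)).prod := by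
  intro L
  induction L with
  | nil => intros; simp
  | cons i L ih =>
    intro hf hg
    rw [List.map_cons, List.map_cons, List.prod_cons, List.prod_cons, mul_assoc,
      ih (fun i hi => hf i (List.mem_cons_of_mem _ hi)) (fun i hi => hg i (List.mem_cons_of_mem _ hi)),
      ← mul_assoc, ← mul_assoc, hf i List.mem_cons_self, hg i List.mem_cons_self]
    congr 1
    have h1 := hA.mul_smear (f i)
    have h2 := hA.mul_star (g' i)
    rw [← mul_assoc A]
    erw [h1, mul_assoc, mul_assoc, h2]
    rfl

/-- The vacuum expectation of fermion pairs and vertex operators. -/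
lemma vev_fermions_mul_wordOp (w : List Letter) {n : ℕ} {f g f' g' : Fin n → SymSeries}
    (hf : ∀ i, f' i = f i * ((plusPart w).map letterSym).prod)
    (hg : ∀ i, g i = g' i * ((plusPart w).map letterSym).prod) :
    vev ((List.ofFn fun i => psiH (f i) * psiSH (g i)).prod * wordOp w) =
      vacFactor w * (Matrix.of fun i k => if i ≤ k then ctH (negH (f' i) * g' k)
        else -ctH (posH (f' i) * g' k)).det := by
  rw [← vev_fermions, vev_mul_wordOp]
  rw [List.ofFn_eq_map, List.ofFn_eq_map]
  exact Conj.fermions_mul (conj_wordOp _) (fun i _ => hf i) fun i _ => hg i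

/-! ### The operator products of the correlation functions -/

/-- A factor of an operator product, with its variable replaced by a multiple of the common
variable `s`. -/
def factorOp (F : Factor) : OpSeries := PowerSeries.mk fun n => F.1 ^ n • PowerSeries.coeff n F.2

/-- An operator product as a power series in the common variable `s`. -/
def wordE (W : List Factor) : OpSeries := (W.map factorOp).prod

lemma wordE_append (W W' : List Factor) : wordE (W ++ W') = wordE W * wordE W' := by
  simp [wordE]

lemma factorOp_constFactor (A : Module.End ℂ Fock) :
    factorOp (constFactor A) = PowerSeries.C A := by
  ext1 n
  simp [factorOp, constFactor]

/-- `f (lo + k - 1), …, f lo`. -/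
def downList {α : Type*} (f : ℤ → α) (lo : ℤ) (k : ℕ) : List α :=
  (List.range k).map fun i : ℕ => f (lo + k - 1 - i)

lemma downList_succ {α : Type*} (f : ℤ → α) (lo : ℤ) (k : ℕ) :
    downList f lo (k + 1) = f (lo + k) :: downList f lo k := by
  rw [downList, List.range_succ_eq_map, List.map_cons, List.map_map, downList]
  congr 1
  · congr 1; push_cast; ring
  · refine List.map_congr_left fun i _ => ?_
    simp only [Function.comp_apply]
    congr 1; push_cast; ring

lemma downList_append {α : Type*} (f : ℤ → α) (lo : ℤ) (k m : ℕ) :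
    downList f lo (k + m) = downList f (lo + k) m ++ downList f lo k := by
  induction m with
  | zero => simp [downList]
  | succ m ih =>
    rw [← add_assoc, downList_succ, ih, downList_succ, List.cons_append]
    push_cast
    rw [add_assoc]

lemma map_downList {α β : Type*} (g : α → β) (f : ℤ → α) (lo : ℤ) (k : ℕ) :
    (downList f lo k).map g = downList (fun n => g (f n)) lo k := by
  simp [downList]

lemma prod_downList {M : Type*} [CommMonoid M] (f : ℤ → M) (lo : ℤ) (k : ℕ) :
    (downList f lo k).prod = ∏ n ∈ Finset.Ico lo (lo + k), f n := by
  induction k with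
  | zero => simp [downList]
  | succ k ih =>
    rw [downList_succ, List.prod_cons, ih]
    have : Finset.Ico lo (lo + (k + 1 : ℕ)) = insert (lo + k) (Finset.Ico lo (lo + k)) := by
      ext x; simp only [Finset.mem_Ico, Finset.mem_insert]; omega
    rw [this, Finset.prod_insert (by simp)]

section Words

variable (P : SkewShape) (xp xm : ℤ → ℝ)

/-- The letter of the vertex operator `Γ_{-ε(m)}(x_m^{ε(m)})`. -/
def letter (n : ℤ) : Letter := if n ∈ P.Dplus then (true, (xp n : ℂ)) else (false, (xm n : ℂ))

lemma factorOp_vertexFactor (n : ℤ) :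
    factorOp (vertexFactor P xp xm n) = letterOp (letter P xp xm n) := by
  unfold vertexFactor letter factorOp letterOp
  split_ifs <;> simp_all [GM, GP, gm, gp]

lemma vertexWord_eq (s t : ℤ) : vertexWord P xp xm s t = downList (vertexFactor P xp xm)
    (max s (-(P.a : ℤ))) (min t P.b - max s (-(P.a : ℤ))).toNat := by
  refine List.map_congr_left fun k hk => ?_
  rw [List.mem_range] at hk
  congr 1
  omega

lemma wordE_vertexWord (s t : ℤ) : wordE (vertexWord P xp xm s t) =
    wordOp (downList (letter P xp xm) (max s (-(P.a : ℤ)))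
      (min t P.b - max s (-(P.a : ℤ))).toNat) := by
  rw [vertexWord_eq, wordE, wordOp, map_downList, map_downList]
  simp only [factorOp_vertexFactor]

lemma vertexWord_append {s t : ℤ} (h : s ≤ t) :
    vertexWord P xp xm (-(P.a : ℤ)) t =
      vertexWord P xp xm s t ++ vertexWord P xp xm (-(P.a : ℤ)) s := by
  rw [vertexWord_eq, vertexWord_eq, vertexWord_eq, max_self]
  by_cases h1 : s ≤ -(P.a : ℤ)
  · have e1 : (min s P.b - -(P.a : ℤ)).toNat = 0 := by omega
    rw [e1, max_eq_right h1]
    simp [downList]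
  · by_cases h2 : min t P.b ≤ s
    · have e1 : (min t P.b - max s (-(P.a : ℤ))).toNat = 0 := by omega
      have e2 : min s (P.b : ℤ) = min t P.b := by omega
      rw [e1, e2]
      simp [downList]
    · have e1 : (min t P.b - -(P.a : ℤ)).toNat = (min s P.b - -(P.a : ℤ)).toNat +
          (min t P.b - max s (-(P.a : ℤ))).toNat := by omega
      rw [e1, downList_append]
      congr 2
      omega

lemma filter_between (s t : ℤ) : (Finset.Ico (-(P.a : ℤ)) (P.b : ℤ)).filter
    (fun n => s ≤ n ∧ n < t) = Finset.Ico (max s (-(P.a : ℤ)))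
      (max s (-(P.a : ℤ)) + (min t P.b - max s (-(P.a : ℤ))).toNat) := by
  ext n
  simp only [Finset.mem_filter, Finset.mem_Ico]
  omega

/-- The inverse of `letterSym l`. -/
def letterSymInv (l : Letter) : SymSeries :=
  PowerSeries.mk fun n => LaurentPolynomial.C (l.2 ^ n) *
    LaurentPolynomial.T ((if l.1 then -1 else 1) * n)

lemma letterSym_mul_inv (l : Letter) : letterSym l * letterSymInv l = 1 := by
  rw [letterSym, factorSym, sub_mul, one_mul, sub_eq_iff_eq_add, mul_assoc]
  ext1 n
  rw [map_add, PowerSeries.coeff_C_mul, PowerSeries.coeff_one]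
  cases n with
  | zero => simp [letterSymInv]
  | succ n =>
    rw [PowerSeries.coeff_succ_X_mul, if_neg (Nat.succ_ne_zero n), zero_add, letterSymInv,
      PowerSeries.coeff_mk, PowerSeries.coeff_mk, pow_succ', map_mul, Nat.cast_succ, mul_add,
      mul_one, LaurentPolynomial.T_add]
    ring

/-- The product of the symbols of the vertex operators with `s ≤ n < t`. -/
def symBetween (s t : ℤ) : SymSeries :=
  ∏ n ∈ (Finset.Ico (-(P.a : ℤ)) (P.b : ℤ)).filter (fun n => s ≤ n ∧ n < t),
    letterSym (letter P xp xm n)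

/-- The inverse of `symBetween`. -/
def symInvBetween (s t : ℤ) : SymSeries :=
  ∏ n ∈ (Finset.Ico (-(P.a : ℤ)) (P.b : ℤ)).filter (fun n => s ≤ n ∧ n < t),
    letterSymInv (letter P xp xm n)

lemma sym_mul_inv (s t : ℤ) : symBetween P xp xm s t * symInvBetween P xp xm s t = 1 := by
  rw [symBetween, symInvBetween, ← Finset.prod_mul_distrib]
  exact Finset.prod_eq_one fun n _ => letterSym_mul_inv _

lemma prod_filter_split {M : Type*} [CommMonoid M] (f : ℤ → M) (D : Finset ℤ) {s t u : ℤ}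
    (h1 : s ≤ t) (h2 : t ≤ u) : ∏ n ∈ D.filter (fun n => s ≤ n ∧ n < u), f n =
      (∏ n ∈ D.filter (fun n => s ≤ n ∧ n < t), f n) *
        ∏ n ∈ D.filter (fun n => t ≤ n ∧ n < u), f n := by
  rw [← Finset.prod_union]
  · refine Finset.prod_congr ?_ fun _ _ => rfl
    ext n
    simp only [Finset.mem_filter, Finset.mem_union, ← and_or_left, and_congr_right_iff]
    intro _
    omega
  · refine Finset.disjoint_left.2 fun n h3 h4 => ?_
    rw [Finset.mem_filter] at h3 h4
    omega

lemma conj_vertexWord (s t : ℤ) :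
    Conj (wordE (vertexWord P xp xm s t)) (symBetween P xp xm s t) := by
  rw [wordE_vertexWord, symBetween, filter_between, ← prod_downList, ← map_downList letterSym]
  exact conj_wordOp _

/-- The symbol of `ψ_j` at time `t`, seen from time `T`. -/
def fSym (T : ℤ) (p : ℤ × ℤ) : SymSeries :=
  PowerSeries.C (LaurentPolynomial.T p.2) * symInvBetween P xp xm p.1 T

/-- The symbol of `ψ*_j` at time `t`, seen from time `T`. -/
def gSym (T : ℤ) (p : ℤ × ℤ) : SymSeries :=
  PowerSeries.C (LaurentPolynomial.T (-p.2)) * symBetween P xp xm p.1 T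

lemma psiH_C_T (j : ℤ) : psiH (PowerSeries.C (LaurentPolynomial.T j)) = PowerSeries.C (psi j) := by
  ext1 n
  rw [coeff_psiH, PowerSeries.coeff_C, PowerSeries.coeff_C]
  split_ifs
  · exact laurentLift_T _ _
  · exact map_zero _

lemma psiSH_C_T (j : ℤ) :
    psiSH (PowerSeries.C (LaurentPolynomial.T (-j))) = PowerSeries.C (psiStar j) := by
  ext1 n
  rw [psiSH]
  erw [coeff_smear (R := Module.End ℂ Fock)]
  rw [PowerSeries.coeff_C, PowerSeries.coeff_C]
  split_ifs
  · have := laurentLift_T (M := Module.End ℂ Fock) (fun k => psiStar (-k)) (-j)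
    rw [neg_neg] at this
    exact this
  · exact map_zero _

/-- All fermions moved to the left of all vertex operators. -/
lemma wordE_correlationWord : ∀ (L : List (ℤ × ℤ)) (T : ℤ), (∀ p ∈ L, p.1 ≤ T) →
    L.Pairwise (fun p p' => p'.1 ≤ p.1) → wordE (correlationWord P xp xm T L) =
      (L.map fun p => psiH (fSym P xp xm T p) * psiSH (gSym P xp xm T p)).prod *
        wordE (vertexWord P xp xm (-(P.a : ℤ)) T) := by
  intro L
  induction L with
  | nil => intro T _ _; simp [correlationWord]
  | cons p L ih =>
    intro T hT hL
    obtain ⟨t, j⟩ := p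
    rw [List.pairwise_cons] at hL
    have ht : t ≤ T := hT _ List.mem_cons_self
    have e1 : wordE [constFactor (psi j), constFactor (psiStar j)] =
        psiH (PowerSeries.C (LaurentPolynomial.T j)) *
          psiSH (PowerSeries.C (LaurentPolynomial.T (-j))) := by
      simp [wordE, factorOp_constFactor, psiH_C_T, psiSH_C_T]
    have e2 := Conj.fermions_mul (conj_vertexWord P xp xm t T) (L := (t, j) :: L)
      (f := fSym P xp xm T) (f' := fun p => fSym P xp xm t p) (g := gSym P xp xm T)
      (g' := gSym P xp xm t) (fun p hp => ?_) (fun p hp => ?_)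
    · rw [correlationWord, wordE_append, wordE_append, ih t (fun p hp => hL.1 p hp) hL.2, e1,
        vertexWord_append P xp xm ht, wordE_append, ← mul_assoc ((List.map _ _).prod), e2]
      have e3 : (Finset.Ico (-(P.a : ℤ)) (P.b : ℤ)).filter (fun n => t ≤ n ∧ n < t) = ∅ :=
        Finset.filter_false_of_mem fun n _ => by omega
      have e4 : fSym P xp xm t (t, j) = PowerSeries.C (LaurentPolynomial.T j) := by
        simp [fSym, symInvBetween, e3]
      have e5 : gSym P xp xm t (t, j) = PowerSeries.C (LaurentPolynomial.T (-j)) := by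
        simp [gSym, symBetween, e3]
      rw [List.map_cons, List.prod_cons, e4, e5]
      simp only [mul_assoc]
    · have hp1 : p.1 ≤ t := by
        rcases List.mem_cons.1 hp with rfl | h
        · exact le_rfl
        · exact hL.1 p h
      have h1 := sym_mul_inv P xp xm t T
      have h2 : symInvBetween P xp xm p.1 T =
          symInvBetween P xp xm p.1 t * symInvBetween P xp xm t T := prod_filter_split _ _ hp1 ht
      simp only [fSym]
      rw [h2]
      linear_combination (- (PowerSeries.C (LaurentPolynomial.T p.2) *
        symInvBetween P xp xm p.1 t)) * h1
    · have hp1 : p.1 ≤ t := by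
        rcases List.mem_cons.1 hp with rfl | h
        · exact le_rfl
        · exact hL.1 p h
      have h2 : symBetween P xp xm p.1 T =
          symBetween P xp xm p.1 t * symBetween P xp xm t T := prod_filter_split _ _ hp1 ht
      simp only [gSym]
      rw [h2, mul_assoc]

lemma vertexWord_congr {s t t' : ℤ} (h : min t (P.b : ℤ) = min t' P.b) :
    vertexWord P xp xm s t = vertexWord P xp xm s t' := by
  rw [vertexWord, vertexWord, h]

/-- Vertex operators exist inside the box only, so a starting time beyond `b` may be changed. -/
lemma correlationWord_congr {t t' : ℤ} (h : min t (P.b : ℤ) = min t' P.b) (L : List (ℤ × ℤ)) :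
    correlationWord P xp xm t L = correlationWord P xp xm t' L := by
  cases L with
  | nil => exact vertexWord_congr P xp xm h
  | cons p L => rw [correlationWord, correlationWord, vertexWord_congr P xp xm h]

/-- The letters of all vertex operators, in their order. -/
def fullWord : List Letter := downList (letter P xp xm) (-(P.a : ℤ)) (P.b + P.a)

lemma wordE_vertexWord_full {t : ℤ} (ht : (P.b : ℤ) ≤ t) :
    wordE (vertexWord P xp xm (-(P.a : ℤ)) t) = wordOp (fullWord P xp xm) := by
  rw [wordE_vertexWord, fullWord]
  congr 2
  · exact max_self _
  · omega

/-- The symbol of `ψ_j` at time `t`, after normal ordering of the vertex operators. -/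
def fNormal (p : ℤ × ℤ) : SymSeries :=
  PowerSeries.C (LaurentPolynomial.T p.2) *
    ((∏ n ∈ (Finset.Ico (-(P.a : ℤ)) (P.b : ℤ)).filter (fun n => n < p.1 ∧ n ∉ P.Dplus),
        letterSym (false, (xm n : ℂ))) *
      ∏ n ∈ (Finset.Ico (-(P.a : ℤ)) (P.b : ℤ)).filter (fun n => p.1 ≤ n ∧ n ∈ P.Dplus),
        letterSymInv (true, (xp n : ℂ)))

/-- The symbol of `ψ*_j` at time `t`, after normal ordering of the vertex operators. -/
def gNormal (p : ℤ × ℤ) : SymSeries :=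
  PowerSeries.C (LaurentPolynomial.T (-p.2)) *
    ((∏ n ∈ (Finset.Ico (-(P.a : ℤ)) (P.b : ℤ)).filter (fun n => n < p.1 ∧ n ∉ P.Dplus),
        letterSymInv (false, (xm n : ℂ))) *
      ∏ n ∈ (Finset.Ico (-(P.a : ℤ)) (P.b : ℤ)).filter (fun n => p.1 ≤ n ∧ n ∈ P.Dplus),
        letterSym (true, (xp n : ℂ)))

lemma prod_plusPart_downList {M : Type*} [CommMonoid M] (f : Letter → M) (lo : ℤ) (k : ℕ) :
    ((plusPart (downList (letter P xp xm) lo k)).map f).prod =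
      ∏ n ∈ (Finset.Ico lo (lo + k)).filter (fun n => n ∉ P.Dplus), f (false, (xm n : ℂ)) := by
  rw [Finset.prod_filter, ← prod_downList]
  induction k with
  | zero => simp [downList, plusPart]
  | succ k ih =>
    rw [downList_succ, downList_succ, List.prod_cons, ← ih, plusPart, plusPart, List.filter_cons]
    by_cases h : lo + k ∈ P.Dplus <;> simp [letter, h]

/-- Splitting of a product according to the position and the type of the vertex operators. -/
lemma prod_letter (f : Letter → SymSeries) {T t : ℤ} (hT : (P.b : ℤ) ≤ T) :
    ∏ n ∈ (Finset.Ico (-(P.a : ℤ)) (P.b : ℤ)).filter (fun n => t ≤ n ∧ n < T),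
      f (letter P xp xm n) =
    (∏ n ∈ (Finset.Ico (-(P.a : ℤ)) (P.b : ℤ)).filter (fun n => t ≤ n ∧ n ∈ P.Dplus),
      f (true, (xp n : ℂ))) *
    ∏ n ∈ (Finset.Ico (-(P.a : ℤ)) (P.b : ℤ)).filter (fun n => t ≤ n ∧ n ∉ P.Dplus),
      f (false, (xm n : ℂ)) := by
  simp only [Finset.prod_filter]
  rw [← Finset.prod_mul_distrib]
  refine Finset.prod_congr rfl fun n hn => ?_
  have h1 : n < T := (Finset.mem_Ico.1 hn).2.trans_le hT
  by_cases h2 : t ≤ n <;> by_cases h3 : n ∈ P.Dplus <;> simp [h1, h2, h3, letter]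

lemma prod_plus_split (f : ℤ → SymSeries) (t : ℤ) :
    ∏ n ∈ (Finset.Ico (-(P.a : ℤ)) (P.b : ℤ)).filter (fun n => n ∉ P.Dplus), f n =
    (∏ n ∈ (Finset.Ico (-(P.a : ℤ)) (P.b : ℤ)).filter (fun n => n < t ∧ n ∉ P.Dplus), f n) *
    ∏ n ∈ (Finset.Ico (-(P.a : ℤ)) (P.b : ℤ)).filter (fun n => t ≤ n ∧ n ∉ P.Dplus), f n := by
  simp only [Finset.prod_filter]
  rw [← Finset.prod_mul_distrib]
  refine Finset.prod_congr rfl fun n _ => ?_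
  by_cases h2 : t ≤ n <;> by_cases h3 : n ∈ P.Dplus <;> simp [h2, h3, not_lt.2, not_le.1]

lemma prod_plus_full (f : Letter → SymSeries) :
    ((plusPart (fullWord P xp xm)).map f).prod =
      ∏ n ∈ (Finset.Ico (-(P.a : ℤ)) (P.b : ℤ)).filter (fun n => n ∉ P.Dplus),
        f (false, (xm n : ℂ)) := by
  have : -(P.a : ℤ) + ((P.b + P.a : ℕ) : ℤ) = P.b := by push_cast; ring
  rw [fullWord, prod_plusPart_downList, this]

/-- The vacuum expectation of a correlation word as a determinant of power series. -/
lemma vev_correlationWord {n : ℕ} (p : Fin n → ℤ × ℤ) (hp : ∀ i k, i < k → (p k).1 ≤ (p i).1) :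
    vev (wordE (correlationWord P xp xm P.b (List.ofFn p))) =
      vacFactor (fullWord P xp xm) * (Matrix.of fun i k => if i ≤ k then
          ctH (negH (fNormal P xp xm (p i)) * gNormal P xp xm (p k))
        else -ctH (posH (fNormal P xp xm (p i)) * gNormal P xp xm (p k))).det := by
  -- vertex operators beyond `b` are absent, so the word may start at a time `T` beyond all points
  obtain ⟨T, hT, hpT⟩ : ∃ T : ℤ, (P.b : ℤ) ≤ T ∧ ∀ i, (p i).1 ≤ T := by
    refine ⟨P.b + ∑ i, |(p i).1|, ?_, fun i => ?_⟩
    · have : 0 ≤ ∑ i, |(p i).1| := Finset.sum_nonneg fun i _ => abs_nonneg _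
      omega
    · have h1 := Finset.single_le_sum (f := fun i => |(p i).1|) (fun i _ => abs_nonneg _)
        (Finset.mem_univ i)
      have h2 := le_abs_self (p i).1
      omega
  rw [correlationWord_congr P xp xm (t' := T) (by omega), wordE_correlationWord P xp xm _ T,
    wordE_vertexWord_full P xp xm hT, List.map_ofFn]
  · refine vev_fermions_mul_wordOp (fullWord P xp xm) (f := fun i => fSym P xp xm T (p i))
      (g := fun i => gSym P xp xm T (p i)) (fun i => ?_) fun i => ?_
    · rw [prod_plus_full, prod_plus_split P _ (p i).1, fSym, symInvBetween,
        prod_letter P xp xm letterSymInv hT, fNormal]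
      have h : (∏ n ∈ (Finset.Ico (-(P.a : ℤ)) (P.b : ℤ)).filter
            (fun n => (p i).1 ≤ n ∧ n ∉ P.Dplus), letterSym (false, (xm n : ℂ))) *
          ∏ n ∈ (Finset.Ico (-(P.a : ℤ)) (P.b : ℤ)).filter
            (fun n => (p i).1 ≤ n ∧ n ∉ P.Dplus), letterSymInv (false, (xm n : ℂ)) = 1 := by
        rw [← Finset.prod_mul_distrib]
        exact Finset.prod_eq_one fun n _ => letterSym_mul_inv _
      linear_combination (-(PowerSeries.C (LaurentPolynomial.T (p i).2) *
        ((∏ n ∈ (Finset.Ico (-(P.a : ℤ)) (P.b : ℤ)).filter (fun n => n < (p i).1 ∧ n ∉ P.Dplus),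
          letterSym (false, (xm n : ℂ))) *
        ∏ n ∈ (Finset.Ico (-(P.a : ℤ)) (P.b : ℤ)).filter (fun n => (p i).1 ≤ n ∧ n ∈ P.Dplus),
          letterSymInv (true, (xp n : ℂ))))) * h
    · rw [prod_plus_full, prod_plus_split P _ (p i).1, gSym, symBetween,
        prod_letter P xp xm letterSym hT, gNormal]
      have h : (∏ n ∈ (Finset.Ico (-(P.a : ℤ)) (P.b : ℤ)).filter
            (fun n => n < (p i).1 ∧ n ∉ P.Dplus), letterSym (false, (xm n : ℂ))) *
          ∏ n ∈ (Finset.Ico (-(P.a : ℤ)) (P.b : ℤ)).filter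
            (fun n => n < (p i).1 ∧ n ∉ P.Dplus), letterSymInv (false, (xm n : ℂ)) = 1 := by
        rw [← Finset.prod_mul_distrib]
        exact Finset.prod_eq_one fun n _ => letterSym_mul_inv _
      linear_combination (-(PowerSeries.C (LaurentPolynomial.T (-(p i).2)) *
        ((∏ n ∈ (Finset.Ico (-(P.a : ℤ)) (P.b : ℤ)).filter (fun n => (p i).1 ≤ n ∧ n ∈ P.Dplus),
          letterSym (true, (xp n : ℂ))) *
        ∏ n ∈ (Finset.Ico (-(P.a : ℤ)) (P.b : ℤ)).filter (fun n => (p i).1 ≤ n ∧ n ∉ P.Dplus),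
          letterSym (false, (xm n : ℂ))))) * h
  · intro q hq
    obtain ⟨i, rfl⟩ := (List.mem_ofFn' _ _).1 hq
    exact hpT i
  · rw [List.pairwise_ofFn]
    exact fun i k hik => hp i k hik

/-- The scalar of normal ordering, as a product over pairs of vertex operators. -/
lemma vacFactor_fullWord : vacFactor (fullWord P xp xm) =
    ∏ m ∈ (Finset.Ico (-(P.a : ℤ)) (P.b : ℤ) ×ˢ Finset.Ico (-(P.a : ℤ)) (P.b : ℤ)).filter
      (fun m => m.1 < m.2 ∧ m.1 ∉ P.Dplus ∧ m.2 ∈ P.Dplus),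
      (1 - PowerSeries.C ((xp m.2 : ℂ) * xm m.1) * PowerSeries.X ^ 2)⁻¹ := by
  have key : ∀ k : ℕ, vacFactor (downList (letter P xp xm) (-(P.a : ℤ)) k) =
      ∏ m ∈ (Finset.Ico (-(P.a : ℤ)) (-(P.a : ℤ) + k) ×ˢ
        Finset.Ico (-(P.a : ℤ)) (-(P.a : ℤ) + k)).filter
      (fun m => m.1 < m.2 ∧ m.1 ∉ P.Dplus ∧ m.2 ∈ P.Dplus),
      (1 - PowerSeries.C ((xp m.2 : ℂ) * xm m.1) * PowerSeries.X ^ 2)⁻¹ := by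
    intro k
    induction k with
    | zero => simp [downList, vacFactor]
    | succ k ih =>
      set N : ℤ := -(P.a : ℤ) + k with hN
      have hk : -(P.a : ℤ) + (k + 1 : ℕ) = N + 1 := by push_cast; ring
      rw [downList_succ, vacFactor, ih, hk, ← hN]
      by_cases h : N ∈ P.Dplus
      · have e : (Finset.Ico (-(P.a : ℤ)) (N + 1) ×ˢ Finset.Ico (-(P.a : ℤ)) (N + 1)).filter
            (fun m => m.1 < m.2 ∧ m.1 ∉ P.Dplus ∧ m.2 ∈ P.Dplus) =
            ((Finset.Ico (-(P.a : ℤ)) N).filter (fun n => n ∉ P.Dplus) ×ˢ {N}) ∪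
            (Finset.Ico (-(P.a : ℤ)) N ×ˢ Finset.Ico (-(P.a : ℤ)) N).filter
            (fun m => m.1 < m.2 ∧ m.1 ∉ P.Dplus ∧ m.2 ∈ P.Dplus) := by
          ext ⟨m1, m2⟩
          simp only [Finset.mem_filter, Finset.mem_product, Finset.mem_union, Finset.mem_Ico,
            Finset.mem_singleton]
          constructor
          · rintro ⟨⟨⟨h1, h2⟩, h3, h4⟩, h5, h6, h7⟩
            rcases eq_or_ne m2 N with rfl | h8
            · exact Or.inl ⟨⟨⟨h1, h5⟩, h6⟩, rfl⟩
            · exact Or.inr ⟨⟨⟨h1, by omega⟩, h3, by omega⟩, h5, h6, h7⟩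
          · rintro (⟨⟨⟨h1, h2⟩, h3⟩, rfl⟩ | ⟨⟨⟨h1, h2⟩, h3, h4⟩, h5, h6, h7⟩)
            · exact ⟨⟨⟨h1, by omega⟩, by omega, by omega⟩, h2, h3, h⟩
            · exact ⟨⟨⟨h1, by omega⟩, by omega, by omega⟩, h5, h6, h7⟩
        rw [e, Finset.prod_union, Finset.prod_product]
        · congr 1
          have hl : letter P xp xm N = (true, (xp N : ℂ)) := by simp [letter, h]
          rw [hl, if_pos rfl, hN]
          simp only [Finset.prod_singleton]
          exact prod_plusPart_downList P xp xm (fun l' : Letter =>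
            (1 - PowerSeries.C ((xp N : ℂ) * l'.2) * PowerSeries.X ^ 2 : PowerSeries ℂ)⁻¹)
            (-(P.a : ℤ)) k
        · refine Finset.disjoint_left.2 fun m h1 h2 => ?_
          rw [Finset.mem_product, Finset.mem_singleton] at h1
          rw [Finset.mem_filter, Finset.mem_product, Finset.mem_Ico, Finset.mem_Ico] at h2
          omega
      · have hl : letter P xp xm N = (false, (xm N : ℂ)) := by simp [letter, h]
        rw [hl]
        simp only [Bool.false_eq_true, if_false, one_mul]
        refine Finset.prod_congr ?_ fun _ _ => rfl
        ext ⟨m1, m2⟩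
        simp only [Finset.mem_filter, Finset.mem_product, Finset.mem_Ico]
        constructor
        · rintro ⟨⟨⟨h1, h2⟩, h3, h4⟩, h5, h6, h7⟩
          exact ⟨⟨⟨h1, by omega⟩, h3, by omega⟩, h5, h6, h7⟩
        · rintro ⟨⟨⟨h1, h2⟩, h3, h4⟩, h5, h6, h7⟩
          have : m2 ≠ N := fun h8 => h (h8 ▸ h7)
          exact ⟨⟨⟨h1, by omega⟩, h3, by omega⟩, h5, h6, h7⟩
  rw [fullWord, key]
  have : -(P.a : ℤ) + ((P.b + P.a : ℕ) : ℤ) = P.b := by push_cast; ring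
  rw [this]

end Words

/-! ### The boundary path of the inner shape -/

section Boundary

variable (μ : YoungDiagram)

lemma exists_diag_notMem (t : ℤ) : ∃ k : ℕ, ((-t).toNat + k, t.toNat + k) ∉ μ := by
  by_contra! h
  have hinj : Function.Injective fun k : ℕ => ((-t).toNat + k, t.toNat + k) := fun k l hkl => by
    simpa using (Prod.ext_iff.1 hkl).1
  exact Set.infinite_of_injective_forall_mem hinj (fun k => h k) μ.cells.finite_toSet

/-- The row of the first cell outside `μ` on the diagonal `t`. -/
def diagRow (t : ℤ) : ℕ := (-t).toNat + Nat.find (exists_diag_notMem μ t)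

/-- The column of the first cell outside `μ` on the diagonal `t`. -/
def diagCol (t : ℤ) : ℕ := t.toNat + Nat.find (exists_diag_notMem μ t)

lemma diagCol_eq (t : ℤ) : (diagCol μ t : ℤ) = diagRow μ t + t := by
  simp only [diagCol, diagRow]
  omega

lemma mem_iff_lt_diagRow {i j : ℕ} {t : ℤ} (h : (j : ℤ) - i = t) :
    (i, j) ∈ μ ↔ i < diagRow μ t := by
  have hspec := Nat.find_spec (exists_diag_notMem μ t)
  constructor
  · intro hm
    by_contra! hle
    exact hspec (μ.up_left_mem (i1 := (-t).toNat + Nat.find (exists_diag_notMem μ t))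
      (j1 := t.toNat + Nat.find (exists_diag_notMem μ t)) hle
      (by simp only [diagRow] at hle; omega) hm)
  · intro hlt
    simp only [diagRow] at hlt
    have h1 := Nat.find_min (exists_diag_notMem μ t) (m := i - (-t).toNat) (by omega)
    rw [not_not] at h1
    rwa [show (-t).toNat + (i - (-t).toNat) = i by omega,
      show t.toNat + (i - (-t).toNat) = j by omega] at h1

lemma neg_le_diagRow (t : ℤ) : -t ≤ diagRow μ t := by
  simp only [diagRow]
  omega

/-- The boundary path of `μ` moves by one step to the right from position `t` to `t + 1`, instead
of one step upwards. -/
def StepRight (t : ℤ) : Prop := diagRow μ (t + 1) = diagRow μ t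

lemma diagRow_eq_of_stepRight {t : ℤ} (h : StepRight μ t) : diagRow μ (t + 1) = diagRow μ t := h

lemma diagRow_step (t : ℤ) : diagRow μ (t + 1) = diagRow μ t ∨
    diagRow μ (t + 1) + 1 = diagRow μ t := by
  have hc := diagCol_eq μ t
  have h1 : diagRow μ (t + 1) ≤ diagRow μ t := by
    by_contra! h
    have h2 := (mem_iff_lt_diagRow μ (i := diagRow μ t) (j := diagCol μ t + 1) (t := t + 1)
      (by push_cast; omega)).2 h
    have h3 := μ.up_left_mem (i1 := diagRow μ t) (j1 := diagCol μ t) le_rfl (Nat.le_succ _) h2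
    have h4 := (mem_iff_lt_diagRow μ (t := t) (by omega)).1 h3
    omega
  have h2 : diagRow μ t ≤ diagRow μ (t + 1) + 1 := by
    by_contra! h
    have h5 := neg_le_diagRow μ (t + 1)
    have h6 : (diagRow μ t - 1, diagCol μ t - 1) ∈ μ :=
      (mem_iff_lt_diagRow μ (t := t) (by omega)).2 (by omega)
    have h7 := μ.up_left_mem (i1 := diagRow μ t - 2) (j1 := diagCol μ t - 1) (by omega) le_rfl h6
    have h8 := (mem_iff_lt_diagRow μ (t := t + 1) (by omega)).1 h7
    omega
  omega

lemma not_stepRight {t : ℤ} : ¬ StepRight μ t ↔ diagRow μ (t + 1) + 1 = diagRow μ t := by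
  have := diagRow_step μ t
  unfold StepRight
  omega

lemma mem_innerCorners {t : ℤ} : t ∈ innerCorners μ ↔ StepRight μ t ∧ ¬ StepRight μ (t - 1) := by
  have hs := diagRow_step μ t
  have hp := diagRow_step μ (t - 1)
  rw [sub_add_cancel] at hp
  have hc := diagCol_eq μ t
  have e : StepRight μ (t - 1) ↔ diagRow μ t = diagRow μ (t - 1) := by
    rw [StepRight, sub_add_cancel]
  rw [e]
  constructor
  · rintro ⟨i, j, rfl, h1, h2, h3⟩
    have hi : i = diagRow μ ((j : ℤ) - i) := by
      have h4 := mt (mem_iff_lt_diagRow μ (i := i) (j := j) rfl).2 h1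
      by_contra hne
      have h5 : diagRow μ ((j : ℤ) - i) < i := by omega
      have h6 := h2 (i - 1) (by omega)
      have h7 : 0 < j := by omega
      have h8 := μ.up_left_mem (i1 := i - 1) (j1 := j - 1) le_rfl (by omega) h6
      have h9 := (mem_iff_lt_diagRow μ (t := (j : ℤ) - i) (by omega)).1 h8
      omega
    constructor
    · by_contra hcon
      have h4 := (not_stepRight μ).1 hcon
      have h5 := h2 (i - 1) (by omega)
      have h6 := (mem_iff_lt_diagRow μ (t := (j : ℤ) - i + 1) (by omega)).1 h5
      omega
    · intro hcon
      have h6 := neg_le_diagRow μ ((j : ℤ) - i - 1)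
      have h5 := h3 (j - 1) (by omega)
      have h7 := (mem_iff_lt_diagRow μ (t := (j : ℤ) - i - 1) (by omega)).1 h5
      omega
  · rintro ⟨h1, h2⟩
    unfold StepRight at h1
    refine ⟨diagRow μ t, diagCol μ t, by omega, ?_, fun i' hi' => ?_, fun j' hj' => ?_⟩
    · rw [mem_iff_lt_diagRow μ (t := t) (by omega)]
      omega
    · rw [mem_iff_lt_diagRow μ (t := t + 1) (by omega)]
      omega
    · rw [mem_iff_lt_diagRow μ (t := t - 1) (by omega)]
      omega

lemma mem_outerCorners {t : ℤ} : t ∈ outerCorners μ ↔ StepRight μ (t - 1) ∧ ¬ StepRight μ t := by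
  have hs := diagRow_step μ t
  have hp := diagRow_step μ (t - 1)
  rw [sub_add_cancel] at hp
  have hc := diagCol_eq μ t
  have e : StepRight μ (t - 1) ↔ diagRow μ t = diagRow μ (t - 1) := by
    rw [StepRight, sub_add_cancel]
  rw [e]
  constructor
  · rintro ⟨i, j, rfl, h1, h2, h3⟩
    rw [mem_iff_lt_diagRow μ rfl] at h1
    have h4 : ¬ (i + 1, j + 1) ∈ μ := fun h => h2 (μ.up_left_mem le_rfl (Nat.le_succ j) h)
    rw [mem_iff_lt_diagRow μ (t := (j : ℤ) - i) (by push_cast; ring)] at h4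
    rw [mem_iff_lt_diagRow μ (t := (j : ℤ) - i - 1) (by push_cast; ring)] at h2
    rw [mem_iff_lt_diagRow μ (t := (j : ℤ) - i + 1) (by push_cast; ring)] at h3
    unfold StepRight
    omega
  · rintro ⟨h1, h2⟩
    rw [not_stepRight] at h2
    have h3 := neg_le_diagRow μ (t - 1)
    refine ⟨diagRow μ t - 1, diagCol μ t - 1, by omega, ?_, ?_, ?_⟩
    · rw [mem_iff_lt_diagRow μ (t := t) (by omega)]
      omega
    · rw [mem_iff_lt_diagRow μ (t := t - 1) (by omega)]
      omega
    · rw [mem_iff_lt_diagRow μ (t := t + 1) (by omega)]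
      omega

end Boundary

namespace SkewShape

variable (P : SkewShape)

lemma diagRow_of_ge {t : ℤ} (h : (P.b : ℤ) ≤ t) : diagRow P.μ t = 0 := by
  by_contra hne
  have h1 := (mem_iff_lt_diagRow P.μ (i := 0) (j := t.toNat) (t := t) (by omega)).2 (by omega)
  have h2 := (P.fits _ _ h1).2
  omega

lemma diagRow_of_le {t : ℤ} (h : t ≤ -(P.a : ℤ)) : (diagRow P.μ t : ℤ) = -t := by
  have h0 := neg_le_diagRow P.μ t
  by_contra hne
  have h1 := (mem_iff_lt_diagRow P.μ (i := (-t).toNat) (j := 0) (t := t) (by omega)).2 (by omega)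
  have h2 := (P.fits _ _ h1).1
  omega

lemma stepRight_of_ge {t : ℤ} (h : (P.b : ℤ) ≤ t) : StepRight P.μ t := by
  rw [StepRight, P.diagRow_of_ge h, P.diagRow_of_ge (by omega)]

lemma not_stepRight_of_lt {t : ℤ} (h : t < -(P.a : ℤ)) : ¬ StepRight P.μ t := by
  have h1 := P.diagRow_of_le h.le
  have h2 := P.diagRow_of_le (t := t + 1) (by omega)
  rw [SkewPP.not_stepRight]
  omega

lemma mem_v {t : ℤ} : (∃ i, 1 ≤ i ∧ i ≤ P.N ∧ P.v i = t) ↔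
    StepRight P.μ t ∧ ¬ StepRight P.μ (t - 1) := by
  rw [← mem_innerCorners, ← P.inner_eq]
  simp [and_assoc]

lemma mem_u {t : ℤ} : (∃ i, 1 ≤ i ∧ i < P.N ∧ P.u i = t) ↔
    StepRight P.μ (t - 1) ∧ ¬ StepRight P.μ t := by
  rw [← mem_outerCorners, ← P.outer_eq]
  simp [and_assoc]

lemma v_lt {i j : ℕ} (hi : 1 ≤ i) (hij : i < j) (hj : j ≤ P.N) : P.v i < P.v j := by
  induction j, hij using Nat.le_induction with
  | base => exact (P.interlace i hi hj).1.trans (P.interlace i hi hj).2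
  | succ j hij ih =>
    have := P.interlace j (by omega) (by omega)
    have := ih (by omega)
    omega

lemma v_le {i j : ℕ} (hi : 1 ≤ i) (hij : i ≤ j) (hj : j ≤ P.N) : P.v i ≤ P.v j := by
  rcases hij.eq_or_lt with rfl | h
  · exact le_rfl
  · exact (P.v_lt hi h hj).le

lemma u_lt {i j : ℕ} (hi : 1 ≤ i) (hij : i < j) (hj : j < P.N) : P.u i < P.u j := by
  have h1 := P.interlace i hi (by omega)
  have h2 := P.interlace j (by omega) hj
  have h3 := P.v_le (i := i + 1) (j := j) (by omega) hij (by omega)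
  omega

lemma stepRight_v {i : ℕ} (h1 : 1 ≤ i) (h2 : i ≤ P.N) :
    StepRight P.μ (P.v i) ∧ ¬ StepRight P.μ (P.v i - 1) := P.mem_v.1 ⟨i, h1, h2, rfl⟩

lemma stepRight_u {i : ℕ} (h1 : 1 ≤ i) (h2 : i < P.N) :
    StepRight P.μ (P.u i - 1) ∧ ¬ StepRight P.μ (P.u i) := P.mem_u.1 ⟨i, h1, h2, rfl⟩

lemma v_bounds {i : ℕ} (h1 : 1 ≤ i) (h2 : i ≤ P.N) : -(P.a : ℤ) ≤ P.v i ∧ P.v i ≤ P.b := by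
  obtain ⟨h3, h4⟩ := P.stepRight_v h1 h2
  constructor
  · by_contra! h
    exact P.not_stepRight_of_lt h h3
  · by_contra! h
    exact h4 (P.stepRight_of_ge (by omega))

lemma u_bounds {i : ℕ} (h2 : i ≤ P.N) : -(P.a : ℤ) ≤ P.u i ∧ P.u i ≤ P.b := by
  have ha := P.u_zero
  have hb := P.u_last
  rcases Nat.eq_zero_or_pos i with rfl | h1
  · constructor <;> omega
  rcases h2.eq_or_lt with rfl | h2
  · constructor <;> omega
  obtain ⟨h3, h4⟩ := P.stepRight_u h1 h2
  constructor
  · by_contra! h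
    exact P.not_stepRight_of_lt (by omega) h3
  · by_contra! h
    exact h4 (P.stepRight_of_ge h.le)

lemma N_pos : 0 < P.N := by
  -- the path starts with steps upwards and ends with steps to the right
  by_contra! hN
  have h : ∀ k : ℕ, ¬ StepRight P.μ (-(P.a : ℤ) - 1 + k) := by
    intro k
    induction k with
    | zero => exact P.not_stepRight_of_lt (by omega)
    | succ k ih =>
      intro hk
      obtain ⟨i, h1, h2, -⟩ := P.mem_v.2 ⟨hk, by
        rwa [show -(P.a : ℤ) - 1 + (k + 1 : ℕ) - 1 = -(P.a : ℤ) - 1 + k by push_cast; ring]⟩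
      omega
  refine h (P.a + P.b + 1) (P.stepRight_of_ge ?_)
  push_cast
  omega

lemma stepRight_of_mem_Dplus {n : ℤ} (h : n ∈ P.Dplus) : StepRight P.μ n := by
  obtain ⟨i, h1, h2, h3, h4⟩ := h
  have key : ∀ m : ℤ, P.v i ≤ m → m ≤ n → StepRight P.μ m := by
    intro m hm
    induction m, hm using Int.leInduction with
    | base => exact fun _ => (P.stepRight_v h1 h2).1
    | succ m hm ih =>
      intro hmn
      by_contra hcon
      obtain ⟨k, k1, k2, k3⟩ := P.mem_u.2 ⟨by rw [add_sub_cancel_right]; exact ih (by omega), hcon⟩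
      have k4 := P.interlace k k1 k2
      rcases lt_or_ge k i with hki | hki
      · have := P.v_le (i := k + 1) (j := i) (by omega) (by omega) h2
        omega
      · rcases hki.eq_or_lt with rfl | hki
        · omega
        · have := P.u_lt h1 hki k2
          omega
  exact key n h3 le_rfl

lemma not_stepRight_of_mem_Dminus {n : ℤ} (h : n ∈ P.Dminus) : ¬ StepRight P.μ n := by
  obtain ⟨i, h2, h3, h4⟩ := h
  have key : ∀ m : ℤ, P.u i ≤ m → m ≤ n → ¬ StepRight P.μ m := by
    have step : ∀ m : ℤ, P.u i ≤ m → m ≤ n → ¬ StepRight P.μ (m - 1) → (i ≠ 0 → m ≠ P.u i) →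
        ¬ StepRight P.μ m := by
      intro m h5 h6 h7 h8 hcon
      obtain ⟨k, k1, k2, k3⟩ := P.mem_v.2 ⟨hcon, h7⟩
      rcases lt_or_ge i k with hki | hki
      · have := P.v_le (i := i + 1) (j := k) (by omega) hki k2
        omega
      · have := P.v_le (i := k) (j := i) k1 hki (by omega)
        have := P.interlace i (by omega) h2
        omega
    intro m hm
    induction m, hm using Int.leInduction with
    | base =>
      intro h5
      rcases Nat.eq_zero_or_pos i with rfl | hi
      · refine step _ le_rfl h5 (P.not_stepRight_of_lt ?_) (fun h => absurd rfl h)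
        have := P.u_zero
        omega
      · exact (P.stepRight_u hi h2).2
    | succ m hm ih =>
      intro hmn
      exact step _ (by omega) hmn (by rw [add_sub_cancel_right]; exact ih (by omega))
        (fun _ => by omega)
  exact key n h3 le_rfl

lemma mem_Dplus_or_mem_Dminus {n : ℤ} (h1 : -(P.a : ℤ) ≤ n) (h2 : n < P.b) :
    n ∈ P.Dplus ∨ n ∈ P.Dminus := by
  have hex : ∃ i, i < P.N ∧ P.u i ≤ n ∧ n < P.u (i + 1) := by
    by_contra! hcon
    have : ∀ i, i ≤ P.N → P.u i ≤ n := by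
      intro i
      induction i with
      | zero => intro _; rw [P.u_zero]; exact h1
      | succ i ih => exact fun hi => hcon i (by omega) (ih (by omega))
    have := this P.N le_rfl
    have := P.u_last
    omega
  obtain ⟨i, hi, h3, h4⟩ := hex
  rcases lt_or_ge n (P.v (i + 1)) with h | h
  · exact Or.inr ⟨i, hi, h3, h⟩
  · exact Or.inl ⟨i + 1, by omega, by omega, h, h4⟩

lemma mem_Dplus_iff {n : ℤ} :
    n ∈ P.Dplus ↔ -(P.a : ℤ) ≤ n ∧ n < P.b ∧ StepRight P.μ n := by
  constructor
  · intro h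
    have h0 := h
    obtain ⟨i, h1, h2, h3, h4⟩ := h0
    have h5 := P.v_bounds h1 h2
    have h6 := P.u_bounds h2
    exact ⟨by omega, by omega, P.stepRight_of_mem_Dplus h⟩
  · rintro ⟨h1, h2, h3⟩
    exact (P.mem_Dplus_or_mem_Dminus h1 h2).resolve_right
      fun h => P.not_stepRight_of_mem_Dminus h h3

lemma mem_Dminus_iff {n : ℤ} :
    n ∈ P.Dminus ↔ -(P.a : ℤ) ≤ n ∧ n < P.b ∧ ¬ StepRight P.μ n := by
  constructor
  · intro h
    have h0 := h
    obtain ⟨i, h2, h3, h4⟩ := h0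
    have h5 := P.v_bounds (i := i + 1) (by omega) h2
    have h6 := P.u_bounds h2.le
    exact ⟨by omega, by omega, P.not_stepRight_of_mem_Dminus h⟩
  · rintro ⟨h1, h2, h3⟩
    exact (P.mem_Dplus_or_mem_Dminus h1 h2).resolve_left
      fun h => h3 (P.stepRight_of_mem_Dplus h)

lemma abs_second_difference (t w : ℤ) : |t + 1 - w| + |t - 1 - w| - 2 * |t - w| =
    if w = t then 2 else 0 := by
  split_ifs with h
  · subst h; simp
  · rcases lt_or_gt_of_ne h with h | h
    · rw [abs_of_nonneg (by omega : 0 ≤ t + 1 - w), abs_of_nonneg (by omega : 0 ≤ t - 1 - w),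
        abs_of_nonneg (by omega : 0 ≤ t - w)]
      ring
    · rw [abs_of_nonpos (by omega : t + 1 - w ≤ 0), abs_of_nonpos (by omega : t - 1 - w ≤ 0),
        abs_of_nonpos (by omega : t - w ≤ 0)]
      ring

/-- A function on the integers with vanishing second difference is affine. -/
lemma affine_of_second_difference {h : ℤ → ℤ} (hh : ∀ t, h (t + 1) + h (t - 1) - 2 * h t = 0)
    (t : ℤ) : h t = h 0 + t * (h 1 - h 0) := by
  have h1 : ∀ t, h (t + 1) - h t = h 1 - h 0 := by
    intro t
    induction t using Int.induction_on with
    | zero => simp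
    | succ k ih => have := hh (k + 1); rw [add_sub_cancel_right] at this; omega
    | pred k ih => have := hh (-k); rw [sub_add_cancel]; omega
  induction t using Int.induction_on with
  | zero => simp
  | succ k ih => have := h1 k; linarith
  | pred k ih => have := h1 (-k - 1); rw [sub_add_cancel] at this; linarith

/-- The profile of `μ`: `2 B(t)` is the number of rows above plus the number of columns to the
left of the vertex of the boundary path at position `t`. -/
lemma two_mul_B (t : ℤ) : ∑ i ∈ Finset.Icc 1 P.N, |t - P.v i| - ∑ i ∈ Finset.Ico 1 P.N, |t - P.u i| =
    2 * diagRow P.μ t + t := by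
  set A : ℤ → ℤ := fun t =>
    ∑ i ∈ Finset.Icc 1 P.N, |t - P.v i| - ∑ i ∈ Finset.Ico 1 P.N, |t - P.u i| with hA
  set h : ℤ → ℤ := fun t => A t - (2 * diagRow P.μ t + t) with hh
  have hv : ∀ t, ∑ i ∈ Finset.Icc 1 P.N, (if P.v i = t then (2 : ℤ) else 0) =
      if StepRight P.μ t ∧ ¬ StepRight P.μ (t - 1) then 2 else 0 := by
    intro t
    split_ifs with ht
    · obtain ⟨i, h1, h2, h3⟩ := P.mem_v.2 ht
      rw [Finset.sum_eq_single i, if_pos h3]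
      · intro k hk hne
        rw [Finset.mem_Icc] at hk
        refine if_neg fun h4 => ?_
        rcases lt_or_gt_of_ne hne with h5 | h5
        · have := P.v_lt hk.1 h5 h2; omega
        · have := P.v_lt h1 h5 hk.2; omega
      · exact fun h4 => absurd (Finset.mem_Icc.2 ⟨h1, h2⟩) h4
    · refine Finset.sum_eq_zero fun i hi => if_neg fun h3 => ht (P.mem_v.1 ⟨i, ?_, ?_, h3⟩)
      · exact (Finset.mem_Icc.1 hi).1
      · exact (Finset.mem_Icc.1 hi).2
  have hu : ∀ t, ∑ i ∈ Finset.Ico 1 P.N, (if P.u i = t then (2 : ℤ) else 0) =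
      if StepRight P.μ (t - 1) ∧ ¬ StepRight P.μ t then 2 else 0 := by
    intro t
    split_ifs with ht
    · obtain ⟨i, h1, h2, h3⟩ := P.mem_u.2 ht
      rw [Finset.sum_eq_single i, if_pos h3]
      · intro k hk hne
        rw [Finset.mem_Ico] at hk
        refine if_neg fun h4 => ?_
        rcases lt_or_gt_of_ne hne with h5 | h5
        · have := P.u_lt hk.1 h5 h2; omega
        · have := P.u_lt h1 h5 hk.2; omega
      · exact fun h4 => absurd (Finset.mem_Ico.2 ⟨h1, h2⟩) h4
    · refine Finset.sum_eq_zero fun i hi => if_neg fun h3 => ht (P.mem_u.1 ⟨i, ?_, ?_, h3⟩)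
      · exact (Finset.mem_Ico.1 hi).1
      · exact (Finset.mem_Ico.1 hi).2
  -- both sides bend at the corners only, and by the same amount, so they differ by an affine
  -- function `h`
  have h2 : ∀ t, h (t + 1) + h (t - 1) - 2 * h t = 0 := by
    intro t
    have e1 : A (t + 1) + A (t - 1) - 2 * A t =
        ∑ i ∈ Finset.Icc 1 P.N, (if P.v i = t then (2 : ℤ) else 0) -
          ∑ i ∈ Finset.Ico 1 P.N, (if P.u i = t then (2 : ℤ) else 0) := by
      simp only [hA, ← abs_second_difference, Finset.sum_sub_distrib, Finset.sum_add_distrib,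
        ← Finset.mul_sum]
      ring
    have e2 := diagRow_step P.μ t
    have e3 := diagRow_step P.μ (t - 1)
    rw [hv, hu] at e1
    have e4 : StepRight P.μ t ↔ diagRow P.μ (t + 1) = diagRow P.μ t := Iff.rfl
    have e5 : StepRight P.μ (t - 1) ↔ diagRow P.μ t = diagRow P.μ (t - 1) := by
      rw [StepRight, sub_add_cancel]
    rw [e4, e5] at e1
    rw [sub_add_cancel] at e3
    simp only [hh]
    split_ifs at e1 <;> omega
  have haff := affine_of_second_difference h2
  have hcard : (∑ i ∈ Finset.Icc 1 P.N, (1 : ℤ)) - ∑ i ∈ Finset.Ico 1 P.N, (1 : ℤ) = 1 := by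
    have := P.N_pos
    simp
    omega
  set κ : ℤ := ∑ i ∈ Finset.Icc 1 P.N, P.v i - ∑ i ∈ Finset.Ico 1 P.N, P.u i with hκ
  -- `h` is constant with opposite values on the two ends, hence zero
  have hlarge : ∀ t : ℤ, (P.b : ℤ) ≤ t → h t = -κ := by
    intro t ht
    have e1 : A t = (∑ i ∈ Finset.Icc 1 P.N, (1 : ℤ) - ∑ i ∈ Finset.Ico 1 P.N, (1 : ℤ)) * t - κ := by
      simp only [hA, hκ, sub_mul, Finset.sum_mul, one_mul]
      have a1 : ∑ i ∈ Finset.Icc 1 P.N, |t - P.v i| = ∑ i ∈ Finset.Icc 1 P.N, (t - P.v i) :=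
        Finset.sum_congr rfl fun i hi => abs_of_nonneg (by
          have := P.v_bounds (Finset.mem_Icc.1 hi).1 (Finset.mem_Icc.1 hi).2; omega)
      have a2 : ∑ i ∈ Finset.Ico 1 P.N, |t - P.u i| = ∑ i ∈ Finset.Ico 1 P.N, (t - P.u i) :=
        Finset.sum_congr rfl fun i hi => abs_of_nonneg (by
          have := P.u_bounds (Finset.mem_Ico.1 hi).2.le; omega)
      rw [a1, a2, Finset.sum_sub_distrib, Finset.sum_sub_distrib]
      ring
    rw [hcard] at e1
    simp only [hh, e1, P.diagRow_of_ge ht]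
    push_cast
    ring
  have hsmall : ∀ t : ℤ, t ≤ -(P.a : ℤ) → h t = κ := by
    intro t ht
    have e1 : A t = (∑ i ∈ Finset.Icc 1 P.N, (1 : ℤ) - ∑ i ∈ Finset.Ico 1 P.N, (1 : ℤ)) * (-t) + κ := by
      simp only [hA, hκ, sub_mul, Finset.sum_mul, one_mul]
      have a1 : ∑ i ∈ Finset.Icc 1 P.N, |t - P.v i| = ∑ i ∈ Finset.Icc 1 P.N, (P.v i - t) :=
        Finset.sum_congr rfl fun i hi => by
          have := P.v_bounds (Finset.mem_Icc.1 hi).1 (Finset.mem_Icc.1 hi).2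
          rw [abs_of_nonpos (by omega)]; ring
      have a2 : ∑ i ∈ Finset.Ico 1 P.N, |t - P.u i| = ∑ i ∈ Finset.Ico 1 P.N, (P.u i - t) :=
        Finset.sum_congr rfl fun i hi => by
          have := P.u_bounds (Finset.mem_Ico.1 hi).2.le
          rw [abs_of_nonpos (by omega)]; ring
      rw [a1, a2, Finset.sum_sub_distrib, Finset.sum_sub_distrib]
      simp only [Finset.sum_neg_distrib]
      ring
    rw [hcard] at e1
    simp only [hh, e1, P.diagRow_of_le ht]
    ring
  have c1 := haff (P.b + 1)
  have c2 := haff P.b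
  have c3 := haff (-(P.a : ℤ))
  have c4 := haff t
  rw [hlarge _ (by omega)] at c1 c2
  rw [hsmall _ le_rfl] at c3
  have c5 : h 1 - h 0 = 0 := by linarith
  rw [c5, mul_zero] at c1 c2 c3 c4
  have : h t = 0 := by omega
  simp only [hh, hA] at this
  omega

lemma B_eq (t : ℤ) : P.B t = diagRow P.μ t + (t : ℚ) / 2 := by
  have h := congrArg (Int.cast : ℤ → ℚ) (P.two_mul_B t)
  push_cast at h
  rw [B]
  linarith

end SkewShape

/-- The modes of the horizontal tiles on the diagonal `t` are `π_{x+k,y+k} - k - 1`, where `(x, y)`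
is the first cell of the diagonal outside `μ`. -/
lemma mem_tiles_iff {P : SkewShape} (π : SkewPlanePartition P) {p : ℤ × ℚ} (hp : IsSite p) :
    p ∈ tiles π ↔ ∃ k : ℕ, mode P p =
      (π.entry (diagRow P.μ p.1 + k) (diagCol P.μ p.1 + k) : ℤ) - k - 1 := by
  obtain ⟨m, hm⟩ := hp
  have hmode : mode P p = diagRow P.μ p.1 + m - 1 := by
    rw [mode, P.B_eq, Int.floor_eq_iff]
    push_cast
    constructor <;> linarith
  have hc := diagCol_eq P.μ p.1
  rw [hmode]
  constructor
  · rintro ⟨i, j, h1, rfl⟩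
    simp only at hm hc ⊢
    rw [mem_iff_lt_diagRow P.μ rfl] at h1
    refine ⟨i - diagRow P.μ ((j : ℤ) - i), ?_⟩
    rw [show diagRow P.μ ((j : ℤ) - i) + (i - diagRow P.μ ((j : ℤ) - i)) = i by omega,
      show diagCol P.μ ((j : ℤ) - i) + (i - diagRow P.μ ((j : ℤ) - i)) = j by omega]
    have : (m : ℚ) = ((π.entry i j : ℤ) - i : ℤ) := by
      rw [← hm]; push_cast; ring
    have := Int.cast_injective this
    omega
  · rintro ⟨k, hk⟩
    refine ⟨diagRow P.μ p.1 + k, diagCol P.μ p.1 + k, ?_, Prod.ext ?_ ?_⟩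
    · rw [mem_iff_lt_diagRow P.μ (t := p.1) (by push_cast; omega)]
      omega
    · simp only
      push_cast
      omega
    · simp only
      have h1 : (m : ℚ) = (π.entry (diagRow P.μ p.1 + k) (diagCol P.μ p.1 + k) : ℤ) - k -
          diagRow P.μ p.1 := by
        have : m = (π.entry (diagRow P.μ p.1 + k) (diagCol P.μ p.1 + k) : ℤ) - k -
          diagRow P.μ p.1 := by omega
        rw [this]; push_cast; ring
      have h2 : ((diagCol P.μ p.1 : ℕ) : ℚ) = diagRow P.μ p.1 + p.1 := by exact_mod_cast hc
      have h3 : p.2 = m - (p.1 : ℚ) / 2 - 1 / 2 := by linarith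
      rw [h3, h1]
      push_cast
      rw [h2]
      ring

/-! ### Matrix elements with nonnegative terms -/

open scoped ENNReal ComplexOrder

lemma enorm_sum_of_nonneg {α : Type*} (s : Finset α) (z : α → ℂ) (h : ∀ i ∈ s, 0 ≤ z i) :
    ‖∑ i ∈ s, z i‖ₑ = ∑ i ∈ s, ‖z i‖ₑ := by
  have h1 : ∀ w : ℂ, 0 ≤ w → ‖w‖ₑ = ENNReal.ofReal w.re := fun w hw => by
    have h2 := congrArg Complex.re (Complex.norm_of_nonneg' hw)
    rw [Complex.ofReal_re] at h2
    rw [← ofReal_norm, h2]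
  rw [h1 _ (Finset.sum_nonneg h), Complex.re_sum, ENNReal.ofReal_sum_of_nonneg]
  · exact Finset.sum_congr rfl fun i hi => (h1 _ (h i hi)).symm
  · exact fun i hi => (Complex.nonneg_iff.1 (h i hi)).1

lemma tsum_eq_of_nonneg {α : Type*} {z : α → ℂ} (h : ∀ i, 0 ≤ z i) (hf : ∑' i, ‖z i‖ₑ ≠ ∞) :
    Summable z ∧ ∑' i, z i = ((∑' i, ‖z i‖ₑ).toReal : ℂ) := by
  have h1 : Summable fun i => ‖z i‖ := tsum_enorm_ne_top_iff_summable_norm.1 hf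
  refine ⟨h1.of_norm, ?_⟩
  have h2 : ∀ i, z i = ((‖z i‖ : ℝ) : ℂ) := fun i => (Complex.norm_of_nonneg' (h i)).symm
  rw [tsum_congr h2, ← Complex.ofReal_tsum, ENNReal.tsum_toReal_eq fun i => by simp]
  simp

lemma pairing_basisVec (v : Fock) (T : Maya) : pairing v (basisVec T) = v T := by
  rw [pairing, Finsupp.sum]
  simp only [basisVec, Finsupp.single_apply, mul_ite, mul_one, mul_zero]
  rw [Finset.sum_ite_eq v.support T (fun S => v S)]
  split_ifs with h
  · rfl
  · exact (Finsupp.notMem_support_iff.1 h).symm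

lemma end_apply_eq_sum (A : Module.End ℂ Fock) (v : Fock) (T : Maya) :
    A v T = v.sum fun R c => c * A (basisVec R) T := by
  conv_lhs => rw [← Finsupp.sum_single v]
  rw [map_finsuppSum, Finsupp.sum_apply]
  refine Finsupp.sum_congr fun R _ => ?_
  rw [show Finsupp.single R (v R) = v R • basisVec R by simp [basisVec], map_smul,
    Finsupp.smul_apply, smul_eq_mul]

/-- The vector obtained by applying the coefficients of the given degrees. -/
def wordVec (W : List Factor) (S : Maya) (n : Fin W.length → ℕ) : Fock :=
  (List.ofFn fun i => PowerSeries.coeff (n i) (W.get i).2).prod (basisVec S)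

lemma matrixTerm_eq (W : List Factor) (S T : Maya) (n : Fin W.length → ℕ) :
    matrixTerm W (basisVec S) (basisVec T) n =
      (∏ i, (W.get i).1 ^ n i) * wordVec W S n T := by
  rw [matrixTerm, pairing_basisVec, wordVec]

lemma matrixTerm_cons (F : Factor) (W : List Factor) (S T : Maya) (k : ℕ)
    (n : Fin W.length → ℕ) :
    matrixTerm (F :: W) (basisVec S) (basisVec T) (Fin.cons k n) =
      ∑ R ∈ (wordVec W S n).support, F.1 ^ k * PowerSeries.coeff k F.2 (basisVec R) T *
        matrixTerm W (basisVec S) (basisVec R) n := by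
  have e1 : wordVec (F :: W) S (Fin.cons k n) = PowerSeries.coeff k F.2 (wordVec W S n) := by
    rw [wordVec, List.ofFn_congr (List.length_cons (as := W) (a := F)), List.ofFn_succ,
      List.prod_cons, Module.End.mul_apply]
    rfl
  have e2 : (∏ i, ((F :: W).get i).1 ^ (Fin.cons k n : Fin (W.length + 1) → ℕ) i) =
      F.1 ^ k * ∏ i, (W.get i).1 ^ n i := Fin.prod_univ_succ (n := W.length) _
  rw [matrixTerm_eq, e1, e2, end_apply_eq_sum, Finsupp.sum, Finset.mul_sum]
  refine Finset.sum_congr rfl fun R _ => ?_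
  rw [matrixTerm_eq]
  ring

/-- The sum of the absolute values of the terms of a matrix element between basis vectors. -/
def mass (W : List Factor) (S T : Maya) : ℝ≥0∞ :=
  ∑' n, ‖matrixTerm W (basisVec S) (basisVec T) n‖ₑ

/-- All terms of all matrix elements between basis vectors are nonnegative. -/
def NonnegWord (W : List Factor) : Prop :=
  ∀ S T n, 0 ≤ matrixTerm W (basisVec S) (basisVec T) n

/-- The sum of the terms of a matrix element of a single factor. -/
def massFactor (F : Factor) (R T : Maya) : ℝ≥0∞ :=
  ∑' k, ‖F.1 ^ k * PowerSeries.coeff k F.2 (basisVec R) T‖ₑ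

lemma exists_fin_cons {l : ℕ} (n : Fin (l + 1) → ℕ) :
    ∃ (k : ℕ) (m : Fin l → ℕ), n = Fin.cons k m := ⟨n 0, Fin.tail n, (Fin.cons_self_tail n).symm⟩

lemma NonnegWord.cons {F : Factor} {W : List Factor} (hW : NonnegWord W)
    (hF : ∀ k R T, 0 ≤ F.1 ^ k * PowerSeries.coeff k F.2 (basisVec R) T) :
    NonnegWord (F :: W) := by
  intro S T n
  obtain ⟨k, m, rfl⟩ := exists_fin_cons (l := W.length) n
  rw [matrixTerm_cons]
  exact Finset.sum_nonneg fun R _ => mul_nonneg (hF _ _ _) (hW _ _ _)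

lemma tsum_fin_succ {l : ℕ} (f : (Fin (l + 1) → ℕ) → ℝ≥0∞) :
    ∑' n, f n = ∑' k : ℕ, ∑' m : Fin l → ℕ, f (Fin.cons k m) := by
  rw [← ENNReal.tsum_prod, ← (Fin.consEquiv fun _ => ℕ).tsum_eq f]
  rfl

/-- Without cancellations, the mass of a product is a sum over intermediate diagrams. -/
lemma mass_cons {F : Factor} {W : List Factor} (hW : NonnegWord W)
    (hF : ∀ k R T, 0 ≤ F.1 ^ k * PowerSeries.coeff k F.2 (basisVec R) T) (S T : Maya) :
    mass (F :: W) S T = ∑' R, massFactor F R T * mass W S R := by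
  have e : mass (F :: W) S T = ∑' k : ℕ, ∑' m : Fin W.length → ℕ, ∑' R : Maya,
      ‖F.1 ^ k * PowerSeries.coeff k F.2 (basisVec R) T‖ₑ *
        ‖matrixTerm W (basisVec S) (basisVec R) m‖ₑ := by
    refine (tsum_fin_succ (l := W.length) _).trans ?_
    refine tsum_congr fun k => tsum_congr fun m => ?_
    rw [matrixTerm_cons, enorm_sum_of_nonneg _ _ fun R _ => mul_nonneg (hF _ _ _) (hW _ _ _)]
    simp only [enorm_mul]
    refine (tsum_eq_sum fun R hR => ?_).symm
    rw [Finsupp.notMem_support_iff] at hR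
    rw [matrixTerm_eq W, hR, mul_zero, enorm_zero, mul_zero]
  rw [e]
  simp only [massFactor, mass, ← ENNReal.tsum_mul_right, ← ENNReal.tsum_mul_left]
  rw [ENNReal.tsum_comm]
  have : ∀ m : Fin W.length → ℕ, ∑' (k : ℕ) (R : Maya),
      ‖F.1 ^ k * PowerSeries.coeff k F.2 (basisVec R) T‖ₑ *
        ‖matrixTerm W (basisVec S) (basisVec R) m‖ₑ = ∑' (R : Maya) (k : ℕ),
      ‖F.1 ^ k * PowerSeries.coeff k F.2 (basisVec R) T‖ₑ *
        ‖matrixTerm W (basisVec S) (basisVec R) m‖ₑ := fun m => ENNReal.tsum_comm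
  rw [tsum_congr this, ENNReal.tsum_comm]

lemma psi_psiStar_apply (j : ℤ) (v : Fock) (T : Maya) :
    psi j (psiStar j v) T = if j ∈ T.carrier then v T else 0 := by
  rw [psi_apply]
  refine if_ctx_congr Iff.rfl (fun h => ?_) fun _ => rfl
  rw [psiStar_apply, if_neg (Maya.notMem_remove_self j T), Maya.adjoin_remove h,
    wedgeSign_remove h, if_neg (lt_irrefl j), mul_one, ← mul_assoc, wedgeSign_mul_self, one_mul]

lemma matrixTerm_pair (W : List Factor) (j : ℤ) (S T : Maya) (k l : ℕ) (n : Fin W.length → ℕ) :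
    matrixTerm (constFactor (psi j) :: constFactor (psiStar j) :: W) (basisVec S) (basisVec T)
      (Fin.cons k (Fin.cons l n : Fin (W.length + 1) → ℕ) : Fin (W.length + 2) → ℕ) =
      if k = 0 ∧ l = 0 ∧ j ∈ T.carrier then matrixTerm W (basisVec S) (basisVec T) n else 0 := by
  have e1 : wordVec (constFactor (psi j) :: constFactor (psiStar j) :: W) S
      (Fin.cons k (Fin.cons l n : Fin (W.length + 1) → ℕ) : Fin (W.length + 2) → ℕ) =
      PowerSeries.coeff k (constFactor (psi j)).2
        (PowerSeries.coeff l (constFactor (psiStar j)).2 (wordVec W S n)) := by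
    have h1 : (constFactor (psi j) :: constFactor (psiStar j) :: W).length = W.length + 1 + 1 := rfl
    rw [wordVec, List.ofFn_congr h1, List.ofFn_succ, List.ofFn_succ, List.prod_cons, List.prod_cons,
      Module.End.mul_apply, Module.End.mul_apply]
    rfl
  have e2 : (∏ i, ((constFactor (psi j) :: constFactor (psiStar j) :: W).get i).1 ^
      (Fin.cons k (Fin.cons l n : Fin (W.length + 1) → ℕ) : Fin (W.length + 2) → ℕ) i) =
      1 ^ k * (1 ^ l * ∏ i, (W.get i).1 ^ n i) := by
    refine (Fin.prod_univ_succ (n := W.length + 1) _).trans ?_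
    congr 1
    exact Fin.prod_univ_succ (n := W.length) _
  rw [matrixTerm_eq, e1, e2, one_pow, one_pow, one_mul, one_mul, constFactor, constFactor,
    PowerSeries.coeff_C, PowerSeries.coeff_C, matrixTerm_eq]
  by_cases hk : k = 0
  · by_cases hl : l = 0
    · simp only [hk, hl, if_true, true_and, psi_psiStar_apply]
      split_ifs <;> simp
    · simp [hl]
  · simp [hk]

lemma NonnegWord.pair {W : List Factor} (hW : NonnegWord W) (j : ℤ) :
    NonnegWord (constFactor (psi j) :: constFactor (psiStar j) :: W) := by
  intro S T n
  obtain ⟨k, m, rfl⟩ := exists_fin_cons (l := W.length + 1) n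
  obtain ⟨l, m, rfl⟩ := exists_fin_cons (l := W.length) m
  rw [matrixTerm_pair]
  split_ifs
  · exact hW _ _ _
  · exact le_rfl

/-- `ψ_j ψ*_j` is the indicator of the index sets that contain `j`. -/
lemma mass_pair (W : List Factor) (j : ℤ) (S T : Maya) :
    mass (constFactor (psi j) :: constFactor (psiStar j) :: W) S T =
      if j ∈ T.carrier then mass W S T else 0 := by
  have e : mass (constFactor (psi j) :: constFactor (psiStar j) :: W) S T =
      ∑' (k : ℕ) (l : ℕ) (m : Fin W.length → ℕ), ‖if k = 0 ∧ l = 0 ∧ j ∈ T.carrier then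
        matrixTerm W (basisVec S) (basisVec T) m else 0‖ₑ := by
    refine (tsum_fin_succ (l := W.length + 1) _).trans ?_
    refine tsum_congr fun k => ?_
    refine (tsum_fin_succ (l := W.length) _).trans ?_
    refine tsum_congr fun l => tsum_congr fun m => ?_
    rw [matrixTerm_pair]
  rw [e, tsum_eq_single 0, tsum_eq_single 0]
  · simp only [true_and]
    split_ifs with h
    · rfl
    · simp
  · intro l hl
    simp [hl]
  · intro k hk
    simp [hk]

lemma nonnegWord_nil : NonnegWord [] := by
  intro S T n
  rw [matrixTerm_eq]
  simp only [wordVec, List.ofFn_zero, List.prod_nil, Module.End.one_apply, basisVec,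
    Finsupp.single_apply, List.length_nil, Finset.univ_eq_empty, Finset.prod_empty, one_mul]
  split_ifs <;> simp

lemma mass_nil (S T : Maya) : mass [] S T = if S = T then 1 else 0 := by
  refine (tsum_eq_single (fun i : Fin 0 => i.elim0) fun n hn => ?_).trans ?_
  · exact absurd (Subsingleton.elim _ _) hn
  · rw [matrixTerm_eq]
    simp only [wordVec, List.ofFn_zero, List.prod_nil, Module.End.one_apply, basisVec,
      Finsupp.single_apply, List.length_nil, Finset.univ_eq_empty, Finset.prod_empty, one_mul]
    split_ifs <;> simp

/-! ### Sums over paths of diagrams -/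

section Paths

variable (P : SkewShape) (xp xm : ℤ → ℝ)

/-- The weight of a step from the diagram `R` at position `n` to the diagram `T` at position
`n + 1`. -/
def stepWeight (n : ℤ) (R T : Maya) : ℝ≥0∞ :=
  if n ∈ P.Dplus then
    if T.Inter R then ENNReal.ofReal (xp n ^ (R.energy - T.energy).toNat) else 0
  else if R.Inter T then ENNReal.ofReal (xm n ^ (T.energy - R.energy).toNat) else 0

/-- Nonnegativity of the parameters of all vertex operators. -/
def NonnegParam : Prop := ∀ n, -(P.a : ℤ) ≤ n → n < P.b → 0 ≤ if n ∈ P.Dplus then xp n else xm n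

lemma pieri_nonneg (n : ℤ) (S T : Maya) : 0 ≤ pieri n S T := by
  rw [pieri]
  split_ifs <;> simp

lemma vertexFactor_coeff (n : ℤ) (k : ℕ) (R T : Maya) :
    (vertexFactor P xp xm n).1 ^ k *
      PowerSeries.coeff k (vertexFactor P xp xm n).2 (basisVec R) T =
    if n ∈ P.Dplus then (xp n : ℂ) ^ k * pieri k T R else (xm n : ℂ) ^ k * pieri k R T := by
  rw [← congrFun (congrFun (gp_apply k) R) T, ← congrFun (congrFun (gm_apply k) T) R, vertexFactor]
  split_ifs <;> rfl

variable {P xp xm}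

lemma NonnegParam.vertexFactor (h : NonnegParam P xp xm) {n : ℤ} (h1 : -(P.a : ℤ) ≤ n)
    (h2 : n < P.b) (k : ℕ) (R T : Maya) : 0 ≤ (vertexFactor P xp xm n).1 ^ k *
      PowerSeries.coeff k (vertexFactor P xp xm n).2 (basisVec R) T := by
  have h3 := h n h1 h2
  rw [vertexFactor_coeff]
  split_ifs at h3 ⊢ <;>
  exact mul_nonneg (pow_nonneg (by exact_mod_cast h3) _) (pieri_nonneg _ _ _)

lemma tsum_pow_pieri {x : ℝ} (hx : 0 ≤ x) (S T : Maya) : ∑' k : ℕ, ‖(x : ℂ) ^ k * pieri k S T‖ₑ =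
    if S.Inter T then ENNReal.ofReal (x ^ (T.energy - S.energy).toNat) else 0 := by
  split_ifs with h
  · have h1 := h.energy_le
    rw [tsum_eq_single (T.energy - S.energy).toNat]
    · rw [pieri, if_pos ⟨h, by omega⟩, mul_one, enorm_pow, ENNReal.ofReal_pow hx,
        ← ofReal_norm, Complex.norm_real, Real.norm_of_nonneg hx]
    · intro k hk
      rw [pieri, if_neg (fun h2 => hk (by omega)), mul_zero, enorm_zero]
  · simp [pieri, h]

lemma NonnegParam.massFactor_eq (h : NonnegParam P xp xm) {n : ℤ} (h1 : -(P.a : ℤ) ≤ n)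
    (h2 : n < P.b) (R T : Maya) :
    massFactor (SkewPP.vertexFactor P xp xm n) R T = stepWeight P xp xm n R T := by
  have h3 := h n h1 h2
  rw [massFactor, stepWeight]
  simp only [vertexFactor_coeff]
  split_ifs at h3 ⊢ with h4 h5 h5
  · rw [tsum_pow_pieri h3, if_pos h5]
  · rw [tsum_pow_pieri h3, if_neg h5]
  · rw [tsum_pow_pieri h3, if_pos h5]
  · rw [tsum_pow_pieri h3, if_neg h5]

variable (P xp xm)

/-- The sum over all paths of diagrams that are equal to `S` up to position `-a` and to `R` from
position `hi` on, with a weight `φ` in addition to the weight of the steps. -/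
def pathSum (hi : ℤ) (φ : (ℤ → Maya) → ℝ≥0∞) (S R : Maya) : ℝ≥0∞ :=
  ∑' U : {U : ℤ → Maya // (∀ r ≤ -(P.a : ℤ), U r = S) ∧ ∀ r, hi ≤ r → U r = R},
    (∏ n ∈ Finset.Ico (-(P.a : ℤ)) hi, stepWeight P xp xm n (U.1 n) (U.1 (n + 1))) * φ U.1

lemma pathSum_zero (φ : (ℤ → Maya) → ℝ≥0∞) (S R : Maya) :
    pathSum P xp xm (-(P.a : ℤ)) φ S R = if S = R then φ (fun _ => S) else 0 := by
  rw [pathSum]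
  split_ifs with h
  · subst h
    rw [tsum_eq_single ⟨fun _ => S, fun _ _ => rfl, fun _ _ => rfl⟩]
    · simp
    · intro U hU
      refine absurd (Subtype.ext (funext fun r => ?_)) hU
      rcases le_total r (-(P.a : ℤ)) with h | h
      · exact U.2.1 r h
      · exact U.2.2 r h
  · rw [ENNReal.tsum_eq_zero]
    intro U
    exact absurd ((U.2.1 _ le_rfl).symm.trans (U.2.2 _ le_rfl)) h

/-- A path to position `hi + 1` is a path to position `hi` with one more step. -/
def pathEquiv {hi : ℤ} (h : -(P.a : ℤ) ≤ hi) (S R : Maya) :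
    (Σ R' : Maya, {U : ℤ → Maya // (∀ r ≤ -(P.a : ℤ), U r = S) ∧ ∀ r, hi ≤ r → U r = R'}) ≃
    {U : ℤ → Maya // (∀ r ≤ -(P.a : ℤ), U r = S) ∧ ∀ r, hi + 1 ≤ r → U r = R} where
  toFun p := ⟨fun r => if hi < r then R else p.2.1 r, fun r hr => by
      exact (if_neg (by omega)).trans (p.2.2.1 r hr), fun r hr => if_pos (by omega)⟩
  invFun U := ⟨U.1 hi, fun r => if hi ≤ r then U.1 hi else U.1 r, fun r hr => by
      refine Eq.trans ?_ (U.2.1 r hr)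
      rcases lt_or_ge r hi with h1 | h1
      · exact if_neg (by omega)
      · exact (if_pos h1).trans (congrArg U.1 (by omega)), fun r hr => if_pos hr⟩
  left_inv p := by
    obtain ⟨R', U, hU1, hU2⟩ := p
    refine Sigma.subtype_ext ?_ ?_
    · simp [hU2]
    · funext r
      simp only [lt_irrefl, if_false]
      split_ifs with h1 h2
      · rw [hU2 r h1, hU2 hi le_rfl]
      · omega
      · rfl
  right_inv U := by
    refine Subtype.ext (funext fun r => ?_)
    simp only
    split_ifs with h1 h2
    · exact (U.2.2 r (by omega)).symm
    · exact congrArg U.1 (by omega)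
    · rfl

lemma pathSum_succ {hi : ℤ} (h : -(P.a : ℤ) ≤ hi) {φ : (ℤ → Maya) → ℝ≥0∞}
    (hφ : ∀ U U' : ℤ → Maya, (∀ r ≤ hi, U r = U' r) → φ U = φ U') (S R : Maya) :
    pathSum P xp xm (hi + 1) φ S R =
      ∑' R', stepWeight P xp xm hi R' R * pathSum P xp xm hi φ S R' := by
  rw [pathSum, ← (pathEquiv P h S R).tsum_eq, ENNReal.tsum_sigma']
  refine tsum_congr fun R' => ?_
  rw [pathSum, ← ENNReal.tsum_mul_left]
  refine tsum_congr fun U => ?_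
  have e1 : ∀ r ≤ hi, ((pathEquiv P h S R) ⟨R', U⟩).1 r = U.1 r := fun r hr => if_neg (by omega)
  have e2 : ((pathEquiv P h S R) ⟨R', U⟩).1 (hi + 1) = R := if_pos (by omega)
  have e3 : Finset.Ico (-(P.a : ℤ)) (hi + 1) = insert hi (Finset.Ico (-(P.a : ℤ)) hi) := by
    ext x; simp only [Finset.mem_Ico, Finset.mem_insert]; omega
  rw [hφ _ _ e1, e3, Finset.prod_insert (by simp), e2, e1 hi le_rfl, U.2.2 hi le_rfl, mul_assoc]
  congr 2
  refine Finset.prod_congr rfl fun n hn => ?_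
  rw [Finset.mem_Ico] at hn
  rw [e1 n (by omega), e1 (n + 1) (by omega)]

variable {P xp xm}

/-- Vertex operators on the left prolong the paths. -/
lemma NonnegParam.downList (h : NonnegParam P xp xm) {W : List Factor} (hW : NonnegWord W)
    {lo : ℤ} (hlo : -(P.a : ℤ) ≤ lo) {φ : (ℤ → Maya) → ℝ≥0∞}
    (hφ : ∀ U U' : ℤ → Maya, (∀ r ≤ lo, U r = U' r) → φ U = φ U')
    (hm : ∀ S R, mass W S R = pathSum P xp xm lo φ S R) (k : ℕ) (hk : lo + k ≤ P.b) :
    NonnegWord (downList (SkewPP.vertexFactor P xp xm) lo k ++ W) ∧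
      ∀ S R, mass (downList (SkewPP.vertexFactor P xp xm) lo k ++ W) S R =
        pathSum P xp xm (lo + k) φ S R := by
  induction k with
  | zero => simpa [SkewPP.downList] using ⟨hW, hm⟩
  | succ k ih =>
    obtain ⟨h1, h2⟩ := ih (by push_cast at hk; omega)
    have h3 := h.vertexFactor (n := lo + k) (by omega) (by push_cast at hk; omega)
    rw [downList_succ, List.cons_append]
    refine ⟨h1.cons h3, fun S R => ?_⟩
    rw [mass_cons h1 h3, Nat.cast_succ, ← add_assoc, pathSum_succ P xp xm (by omega)
      (fun U U' hU => hφ U U' fun r hr => hU r (by omega))]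
    refine tsum_congr fun R' => ?_
    rw [h2, h.massFactor_eq (by omega) (by push_cast at hk; omega)]

variable (P)

/-- The nearest position in the box. -/
def clampPos (t : ℤ) : ℤ := max (-(P.a : ℤ)) (min t P.b)

/-- The indicator function of the paths that contain given modes at given positions. -/
def modeIndicator (L : List (ℤ × ℤ)) (U : ℤ → Maya) : ℝ≥0∞ :=
  (L.map fun p => if p.2 ∈ (U (clampPos P p.1)).carrier then (1 : ℝ≥0∞) else 0).prod

variable {P}

lemma vertexWord_eq_clamp {s t : ℤ} (h : s ≤ t) : vertexWord P xp xm s t =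
    downList (SkewPP.vertexFactor P xp xm) (clampPos P s) (clampPos P t - clampPos P s).toNat := by
  rw [vertexWord_eq]
  simp only [clampPos]
  rcases le_or_gt s P.b with h1 | h1
  · congr 1 <;> omega
  · rw [show (min t P.b - max s (-(P.a : ℤ))).toNat = 0 by omega,
      show (max (-(P.a : ℤ)) (min t P.b) - max (-(P.a : ℤ)) (min s P.b)).toNat = 0 by omega]
    simp [downList]

/-- The matrix elements of a correlation word are sums over paths of diagrams that contain the given
modes at the given times. -/
lemma NonnegParam.correlationWord (h : NonnegParam P xp xm) : ∀ (L : List (ℤ × ℤ)) (T : ℤ),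
    (∀ p ∈ L, p.1 ≤ T) → L.Pairwise (fun p p' => p'.1 ≤ p.1) →
    NonnegWord (SkewPP.correlationWord P xp xm T L) ∧
      ∀ S R, mass (SkewPP.correlationWord P xp xm T L) S R =
        pathSum P xp xm (clampPos P T) (modeIndicator P L) S R := by
  intro L
  induction L with
  | nil =>
    intro T _ _
    have h1 := h.downList nonnegWord_nil (lo := -(P.a : ℤ)) le_rfl (φ := modeIndicator P [])
      (fun _ _ _ => rfl) (fun S R => by rw [mass_nil, pathSum_zero]; rfl)
      (clampPos P T + P.a).toNat (by simp only [clampPos]; omega)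
    rw [List.append_nil] at h1
    have e1 : SkewPP.correlationWord P xp xm T [] = SkewPP.downList (SkewPP.vertexFactor P xp xm)
        (-(P.a : ℤ)) (clampPos P T + P.a).toNat := by
      rw [SkewPP.correlationWord, vertexWord_eq, max_self]
      congr 1
      simp only [clampPos]
      omega
    have e2 : -(P.a : ℤ) + (clampPos P T + P.a).toNat = clampPos P T := by
      simp only [clampPos]; omega
    rw [e1]
    rwa [e2] at h1
  | cons p L ih =>
    intro T hT hL
    obtain ⟨t, j⟩ := p
    rw [List.pairwise_cons] at hL
    have ht : t ≤ T := hT _ List.mem_cons_self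
    obtain ⟨h1, h2⟩ := ih t (fun p hp => hL.1 p hp) hL.2
    have h3 := h.downList (h1.pair j) (lo := clampPos P t) (by simp only [clampPos]; omega)
      (φ := modeIndicator P ((t, j) :: L)) (fun U U' hU => ?_) (fun S R => ?_)
      (clampPos P T - clampPos P t).toNat (by simp only [clampPos]; omega)
    · have e2 : clampPos P t + (clampPos P T - clampPos P t).toNat = clampPos P T := by
        simp only [clampPos]; omega
      have e1 : SkewPP.correlationWord P xp xm T ((t, j) :: L) =
          SkewPP.downList (SkewPP.vertexFactor P xp xm) (clampPos P t)
            (clampPos P T - clampPos P t).toNat ++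
          constFactor (psi j) :: constFactor (psiStar j) ::
            SkewPP.correlationWord P xp xm t L := by
        rw [SkewPP.correlationWord, vertexWord_eq_clamp ht]
        simp
      rw [e1]
      rwa [e2] at h3
    · have e : ∀ p ∈ (t, j) :: L, U (clampPos P p.1) = U' (clampPos P p.1) := fun p hp => by
        refine hU _ ?_
        have : p.1 ≤ t := by
          rcases List.mem_cons.1 hp with rfl | h
          · exact le_rfl
          · exact hL.1 p h
        simp only [clampPos]
        omega
      rw [modeIndicator, modeIndicator]
      congr 1
      refine List.map_congr_left fun p hp => ?_
      rw [e p hp]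
    · rw [mass_pair, h2]
      simp only [pathSum]
      split_ifs with h4
      · refine tsum_congr fun U => ?_
        rw [modeIndicator, modeIndicator, List.map_cons, List.prod_cons, U.2.2 _ le_rfl, if_pos h4,
          one_mul]
      · symm
        rw [ENNReal.tsum_eq_zero]
        intro U
        rw [modeIndicator, List.map_cons, List.prod_cons, U.2.2 _ le_rfl, if_neg h4, zero_mul,
          mul_zero]

end Paths

/-! ### Skew plane partitions as paths of diagrams -/

open scoped ENNReal

section Slices

variable {P : SkewShape}

lemma SkewPlanePartition.entry_anti (π : SkewPlanePartition P) {i j : ℕ} (h : (i, j) ∉ P.μ)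
    (r s : ℕ) : π.entry (i + r) (j + s) ≤ π.entry i j := by
  by_cases h1 : i + r < P.a ∧ j + s < P.b
  · exact π.mono i j r s h h1.1 h1.2
  · rw [π.entry_eq_zero (i + r) (j + s) fun h2 => h1 ⟨h2.1, h2.2.1⟩]
    exact Nat.zero_le _

lemma diag_notMem (t : ℤ) (k : ℕ) : (diagRow P.μ t + k, diagCol P.μ t + k) ∉ P.μ := by
  have hc := diagCol_eq P.μ t
  rw [mem_iff_lt_diagRow P.μ (t := t) (by push_cast; omega)]
  omega

/-- The partition formed by the entries on the diagonal `t`. -/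
def SkewPlanePartition.slice (π : SkewPlanePartition P) (t : ℤ) : Ptn where
  part k := π.entry (diagRow P.μ t + k) (diagCol P.μ t + k)
  anti i j hij := by
    obtain ⟨r, rfl⟩ := Nat.exists_eq_add_of_le hij
    simp only [← add_assoc]
    exact π.entry_anti (diag_notMem t i) r r
  eventually_zero := ⟨P.a, fun k hk => π.entry_eq_zero _ _ fun h => by omega⟩

lemma SkewPlanePartition.slice_part (π : SkewPlanePartition P) {i j : ℕ} {t : ℤ}
    (h : (j : ℤ) - i = t) (hm : (i, j) ∉ P.μ) :
    (π.slice t).part (i - diagRow P.μ t) = π.entry i j := by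
  have hc := diagCol_eq P.μ t
  rw [mem_iff_lt_diagRow P.μ h] at hm
  simp only [slice]
  congr 1 <;> omega

lemma SkewPlanePartition.slice_eq_zero (π : SkewPlanePartition P) {t : ℤ}
    (h : t ≤ -(P.a : ℤ) ∨ (P.b : ℤ) ≤ t) (k : ℕ) : (π.slice t).part k = 0 := by
  refine π.entry_eq_zero _ _ fun h1 => ?_
  have hc := diagCol_eq P.μ t
  have hr := neg_le_diagRow P.μ t
  omega

/-- The path of diagrams of charge `c` formed by the diagonal slices. -/
def SkewPlanePartition.path (c : ℤ) (π : SkewPlanePartition P) (t : ℤ) : Maya :=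
  (π.slice t).maya c

lemma SkewPlanePartition.path_eq_vac (c : ℤ) (π : SkewPlanePartition P) {t : ℤ}
    (h : t ≤ -(P.a : ℤ) ∨ (P.b : ℤ) ≤ t) : π.path c t = vac c :=
  Ptn.maya_zero (π.slice_eq_zero h) c

lemma SkewPlanePartition.path_clampPos (c : ℤ) (π : SkewPlanePartition P) (t : ℤ) :
    π.path c (clampPos P t) = π.path c t := by
  by_cases h : -(P.a : ℤ) ≤ t ∧ t ≤ P.b
  · congr 1
    simp only [clampPos]
    omega
  · rw [π.path_eq_vac c (t := t) (by omega), π.path_eq_vac c (by simp only [clampPos]; omega)]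

/-- Diagrams at neighbouring positions interlace; they shrink along a step of the boundary path to
the right and grow along a step upwards. -/
def StepOK (P : SkewShape) (U : ℤ → Maya) : Prop :=
  ∀ t, if StepRight P.μ t then (U (t + 1)).Inter (U t) else (U t).Inter (U (t + 1))

/-- The diagonal slices of a skew plane partition interlace, as its entries decrease along rows and
columns. -/
lemma SkewPlanePartition.stepOK_path (c : ℤ) (π : SkewPlanePartition P) :
    StepOK P (π.path c) := by
  intro t
  have hc := diagCol_eq P.μ t
  have hc' := diagCol_eq P.μ (t + 1)
  split_ifs with h
  · have hr := diagRow_eq_of_stepRight P.μ h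
    have e : diagCol P.μ (t + 1) = diagCol P.μ t + 1 := by omega
    refine Ptn.inter_maya.2 ⟨rfl, fun k => ⟨?_, ?_⟩⟩
    · simp only [slice, e, hr]
      rw [add_right_comm]
      exact π.entry_anti (diag_notMem t k) 0 1
    · simp only [slice, e, hr]
      have h1 := diag_notMem (P := P) (t + 1) k
      rw [e, hr] at h1
      have h2 := π.entry_anti h1 1 0
      convert h2 using 2 <;> omega
  · have hr := (not_stepRight P.μ).1 h
    have e : diagCol P.μ (t + 1) = diagCol P.μ t := by omega
    refine Ptn.inter_maya.2 ⟨rfl, fun k => ⟨?_, ?_⟩⟩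
    · simp only [slice, e, ← hr]
      have h1 := diag_notMem (P := P) (t + 1) k
      rw [e] at h1
      have h2 := π.entry_anti h1 1 0
      rwa [add_right_comm, add_zero] at h2
    · simp only [slice, e, ← hr]
      have h2 := π.entry_anti (diag_notMem t k) 0 1
      rw [← hr] at h2
      convert h2 using 2 <;> omega

lemma Ptn.maya_injective (c : ℤ) : Function.Injective (Ptn.maya c) := by
  intro lam rho h
  have h1 := Maya.inter_self (lam.maya c)
  have h2 := h1
  nth_rewrite 2 [h] at h1
  nth_rewrite 1 [h] at h2
  rw [Ptn.inter_maya] at h1 h2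
  ext k
  exact le_antisymm (h1.2 k).1 (h2.2 k).1

lemma SkewPlanePartition.path_injective (c : ℤ) :
    Function.Injective (SkewPlanePartition.path (P := P) c) := by
  intro π π' h
  have h1 : ∀ t, π.slice t = π'.slice t := fun t => Ptn.maya_injective c (congrFun h t)
  have h2 : π.entry = π'.entry := by
    funext i j
    by_cases hm : (i, j) ∈ P.μ
    · rw [π.entry_eq_zero _ _ fun h => h.2.2 hm, π'.entry_eq_zero _ _ fun h => h.2.2 hm]
    · rw [← π.slice_part rfl hm, ← π'.slice_part rfl hm, h1]
  cases π
  cases π'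
  congr

/-- Every path of interlacing diagrams with vacuum ends comes from a skew plane partition. -/
lemma exists_path_eq (c : ℤ) {U : ℤ → Maya} (hU : StepOK P U)
    (h0 : ∀ t, t ≤ -(P.a : ℤ) ∨ (P.b : ℤ) ≤ t → U t = vac c) :
    ∃ π : SkewPlanePartition P, π.path c = U := by
  have hz : vac c = Ptn.zero.maya c := (Ptn.maya_zero (fun _ => rfl) c).symm
  -- all diagrams have charge `c`
  have hex : ∀ t, ∃ lam : Ptn, U t = lam.maya c := by
    have key : ∀ k : ℕ, ∃ lam : Ptn, U (-(P.a : ℤ) + k) = lam.maya c := by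
      intro k
      induction k with
      | zero => exact ⟨Ptn.zero, by rw [← hz]; exact h0 _ (Or.inl (by simp))⟩
      | succ k ih =>
        obtain ⟨lam, hlam⟩ := ih
        have h1 := hU (-(P.a : ℤ) + k)
        obtain ⟨d, rho, hrho⟩ := (U (-(P.a : ℤ) + k + 1)).exists_eq_maya
        refine ⟨rho, ?_⟩
        rw [hlam, hrho] at h1
        rw [Nat.cast_succ, ← add_assoc, hrho]
        split_ifs at h1
        · rw [(Ptn.inter_maya.1 h1).1]
        · rw [(Ptn.inter_maya.1 h1).1]
    intro t
    rcases le_total t (-(P.a : ℤ)) with h | h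
    · exact ⟨Ptn.zero, by rw [← hz]; exact h0 _ (Or.inl h)⟩
    · obtain ⟨lam, hlam⟩ := key (t + P.a).toNat
      exact ⟨lam, by rw [← hlam]; congr 1; omega⟩
  choose lam hlam using hex
  have hlz : ∀ t, t ≤ -(P.a : ℤ) ∨ (P.b : ℤ) ≤ t → ∀ k, (lam t).part k = 0 := by
    intro t ht k
    have h1 : lam t = Ptn.zero := Ptn.maya_injective c (by rw [← hlam, h0 t ht, hz])
    rw [h1]
    rfl
  have hstep : ∀ t, if StepRight P.μ t then
      ∀ k, (lam (t + 1)).part k ≤ (lam t).part k ∧ (lam t).part (k + 1) ≤ (lam (t + 1)).part k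
      else ∀ k, (lam t).part k ≤ (lam (t + 1)).part k ∧
        (lam (t + 1)).part (k + 1) ≤ (lam t).part k := by
    intro t
    have h1 := hU t
    rw [hlam, hlam] at h1
    split_ifs at h1 ⊢
    · exact (Ptn.inter_maya.1 h1).2
    · exact (Ptn.inter_maya.1 h1).2
  -- the entries, read off diagonal by diagonal; interlacing gives monotonicity along rows (`hcol`)
  -- and columns (`hrow`)
  set e : ℕ → ℕ → ℕ := fun i j => if (i, j) ∈ P.μ then 0 else
    (lam ((j : ℤ) - i)).part (i - diagRow P.μ ((j : ℤ) - i)) with he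
  have hcol : ∀ i j, (i, j) ∉ P.μ → e i (j + 1) ≤ e i j := by
    intro i j hm
    have hm' : (i, j + 1) ∉ P.μ := fun h => hm (P.μ.up_left_mem le_rfl (Nat.le_succ j) h)
    simp only [he, if_neg hm, if_neg hm']
    rw [mem_iff_lt_diagRow P.μ rfl] at hm hm'
    have h1 := hstep ((j : ℤ) - i)
    rw [show ((j + 1 : ℕ) : ℤ) - i = (j : ℤ) - i + 1 by push_cast; ring] at hm' ⊢
    split_ifs at h1 with h2
    · rw [diagRow_eq_of_stepRight P.μ h2]
      exact (h1 _).1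
    · have h3 := (not_stepRight P.μ).1 h2
      have h4 := (h1 (i - diagRow P.μ ((j : ℤ) - i))).2
      rwa [show i - diagRow P.μ ((j : ℤ) - i) + 1 = i - diagRow P.μ ((j : ℤ) - i + 1) by omega] at h4
  have hrow : ∀ i j, (i, j) ∉ P.μ → e (i + 1) j ≤ e i j := by
    intro i j hm
    have hm' : (i + 1, j) ∉ P.μ := fun h => hm (P.μ.up_left_mem (Nat.le_succ i) le_rfl h)
    simp only [he, if_neg hm, if_neg hm']
    rw [mem_iff_lt_diagRow P.μ rfl] at hm hm'
    have h1 := hstep ((j : ℤ) - i - 1)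
    rw [show (j : ℤ) - (i + 1 : ℕ) = (j : ℤ) - i - 1 by push_cast; ring] at hm' ⊢
    have h5 := diagRow_step P.μ ((j : ℤ) - i - 1)
    rw [sub_add_cancel] at h1 h5
    split_ifs at h1 with h2
    · have h3 : diagRow P.μ ((j : ℤ) - i) = diagRow P.μ ((j : ℤ) - i - 1) := by
        have := diagRow_eq_of_stepRight P.μ h2
        rwa [sub_add_cancel] at this
      have h4 := (h1 (i - diagRow P.μ ((j : ℤ) - i))).2
      rwa [show i - diagRow P.μ ((j : ℤ) - i) + 1 = i + 1 - diagRow P.μ ((j : ℤ) - i - 1) by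
        omega] at h4
    · have h3 := (not_stepRight P.μ).1 h2
      rw [sub_add_cancel] at h3
      have h4 := (h1 (i - diagRow P.μ ((j : ℤ) - i))).1
      rwa [show i - diagRow P.μ ((j : ℤ) - i) = i + 1 - diagRow P.μ ((j : ℤ) - i - 1) by omega]
        at h4 ⊢
  have hrows : ∀ i j r, (i, j) ∉ P.μ → e (i + r) j ≤ e i j := by
    intro i j r hm
    induction r with
    | zero => exact le_rfl
    | succ r ih =>
      exact (hrow (i + r) j fun h => hm (P.μ.up_left_mem (by omega) le_rfl h)).trans ih
  have hcols : ∀ i j s, (i, j) ∉ P.μ → e i (j + s) ≤ e i j := by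
    intro i j s hm
    induction s with
    | zero => exact le_rfl
    | succ s ih =>
      exact (hcol i (j + s) fun h => hm (P.μ.up_left_mem le_rfl (by omega) h)).trans ih
  have hout : ∀ i j, ¬ (i < P.a ∧ j < P.b ∧ (i, j) ∉ P.μ) → e i j = 0 := by
    intro i j h
    by_cases hm : (i, j) ∈ P.μ
    · simp [he, hm]
    rcases not_and_or.1 h with h1 | h1
    · have h2 : (i, 0) ∉ P.μ := fun h3 => h1 (P.fits _ _ h3).1
      have h3 := hcols i 0 j h2
      have h4 : e i 0 = 0 := by
        simp only [he, if_neg h2]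
        exact hlz _ (Or.inl (by push_cast; omega)) _
      rw [zero_add] at h3
      omega
    · have h1' : ¬ j < P.b := fun h3 => h1 ⟨h3, hm⟩
      have h2 : (0, j) ∉ P.μ := fun h3 => h1' (P.fits _ _ h3).2
      have h3 := hrows 0 j i h2
      have h4 : e 0 j = 0 := by
        simp only [he, if_neg h2]
        exact hlz _ (Or.inr (by push_cast; omega)) _
      rw [zero_add] at h3
      omega
  refine ⟨⟨e, hout, fun i j r s hm _ _ => (hrows i (j + s) r fun h =>
    hm (P.μ.up_left_mem le_rfl (by omega) h)).trans (hcols i j s hm)⟩, ?_⟩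
  funext t
  rw [hlam, SkewPlanePartition.path]
  congr 1
  ext k
  have hc := diagCol_eq P.μ t
  simp only [SkewPlanePartition.slice, he, if_neg (diag_notMem (P := P) t k)]
  have h1 : ((diagCol P.μ t + k : ℕ) : ℤ) - (diagRow P.μ t + k : ℕ) = t := by push_cast; omega
  rw [h1, Nat.add_sub_cancel_left]

lemma SkewPlanePartition.sliceSize_eq (π : SkewPlanePartition P) (t : ℤ) :
    sliceSize π t = ∑ k ∈ Finset.range P.a, (π.slice t).part k := by
  rw [sliceSize]
  refine Finset.sum_bij_ne_zero (fun c _ _ => c.1 - diagRow P.μ t) ?_ ?_ ?_ ?_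
  · intro c hc _
    rw [Finset.mem_filter, Finset.mem_product, Finset.mem_range] at hc
    rw [Finset.mem_range]
    omega
  · have hx : ∀ c : ℕ × ℕ, (c.2 : ℤ) - c.1 = t → π.entry c.1 c.2 ≠ 0 → diagRow P.μ t ≤ c.1 := by
      intro c hc hne
      by_contra! h
      exact hne (π.entry_eq_zero _ _ fun h2 => h2.2.2 ((mem_iff_lt_diagRow P.μ hc).2 h))
    intro c hc h1 d hd h2 h3
    have h4 := (Finset.mem_filter.1 hc).2
    have h5 := (Finset.mem_filter.1 hd).2
    have h6 := hx c h4 h1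
    have h7 := hx d h5 h2
    exact Prod.ext (by omega) (by omega)
  · intro k _ hne
    have hcl := diagCol_eq P.μ t
    have hlt : diagRow P.μ t + k < P.a ∧ diagCol P.μ t + k < P.b := by
      by_contra h
      exact hne (π.entry_eq_zero _ _ fun h2 => h ⟨h2.1, h2.2.1⟩)
    refine ⟨(diagRow P.μ t + k, diagCol P.μ t + k), ?_, hne, by simp⟩
    simp only [Finset.mem_filter, Finset.mem_product, Finset.mem_range]
    exact ⟨hlt, by push_cast; omega⟩
  · intro c hc hne
    have h4 := (Finset.mem_filter.1 hc).2
    refine (π.slice_part h4 fun h => hne (π.entry_eq_zero _ _ fun h2 => h2.2.2 h)).symm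

lemma SkewPlanePartition.energy_path (c : ℤ) (π : SkewPlanePartition P) (t : ℤ) :
    (π.path c t).energy = (vac c).energy + sliceSize π t := by
  rw [path, Ptn.energy_maya P.a (π.slice t) (fun k hk => π.entry_eq_zero _ _ fun h => by omega) c,
    π.sliceSize_eq]
  push_cast
  rfl

lemma SkewPlanePartition.sliceSize_eq_zero (π : SkewPlanePartition P) {t : ℤ}
    (h : t ≤ -(P.a : ℤ) ∨ (P.b : ℤ) ≤ t) : sliceSize π t = 0 := by
  rw [π.sliceSize_eq]
  exact Finset.sum_eq_zero fun k _ => π.slice_eq_zero h k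

end Slices

/-! ### The weights in terms of the parameters of the vertex operators -/

/-- Summation by parts for a product of powers. -/
lemma prod_zpow_sub {y : ℤ → ℝ} {s : ℤ → ℤ} {lo hi : ℤ}
    (hy : ∀ n, lo ≤ n → n < hi → y n ≠ 0) (h1 : s lo = 0) (h2 : s hi = 0) :
    ∏ n ∈ Finset.Ico lo hi, y n ^ (s (n + 1) - s n) =
      ∏ n ∈ Finset.Ioo lo hi, (y (n - 1) / y n) ^ s n := by
  rcases le_or_gt hi lo with h | h
  · rw [Finset.Ico_eq_empty (by omega), Finset.Ioo_eq_empty (by omega), Finset.prod_empty,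
      Finset.prod_empty]
  have key : ∀ k : ℕ, lo + k < hi → ∏ n ∈ Finset.Ico lo (lo + k + 1), y n ^ (s (n + 1) - s n) =
      (∏ n ∈ Finset.Ioo lo (lo + k + 1), (y (n - 1) / y n) ^ s n) *
        y (lo + k) ^ s (lo + k + 1) := by
    intro k
    induction k with
    | zero =>
      intro _
      have e1 : Finset.Ico lo (lo + (0 : ℕ) + 1) = {lo} := by
        ext x; simp only [Finset.mem_Ico, Finset.mem_singleton]; omega
      have e2 : Finset.Ioo lo (lo + (0 : ℕ) + 1) = ∅ := by
        ext x; simp only [Finset.mem_Ioo, Finset.notMem_empty, iff_false]; omega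
      rw [e1, e2]
      simp [h1]
    | succ k ih =>
      intro hk
      push_cast at hk ⊢
      set N := lo + (k + 1) with hN
      have hN' : lo + k + 1 = N := by omega
      have hN'' : lo + (k : ℤ) = N - 1 := by omega
      have ih := ih (by omega)
      rw [hN', hN''] at ih
      have e1 : Finset.Ico lo (N + 1) = insert N (Finset.Ico lo N) := by
        ext x; simp only [Finset.mem_Ico, Finset.mem_insert]; omega
      have e2 : Finset.Ioo lo (N + 1) = insert N (Finset.Ioo lo N) := by
        ext x; simp only [Finset.mem_Ioo, Finset.mem_insert]; omega
      have hy1 := hy N (by omega) hk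
      rw [e1, e2, Finset.prod_insert (by simp), Finset.prod_insert (by simp), ih, zpow_sub₀ hy1,
        div_zpow]
      ring
  have h3 := key (hi - 1 - lo).toNat (by omega)
  rw [show lo + ((hi - 1 - lo).toNat : ℤ) + 1 = hi by omega, h2, zpow_zero, mul_one] at h3
  exact h3

section Params

variable (P : SkewShape) (xp xm : ℤ → ℝ)

/-- The parameters `1 / x⁺_m` and `x⁻_m`, as one sequence. -/
def param (n : ℤ) : ℝ := if n ∈ P.Dplus then (xp n)⁻¹ else xm n

variable {P xp xm} {q : ℤ → ℝ}

lemma IsVertexParam.param_pos (hx : IsVertexParam P q xp xm) {n : ℤ} (h1 : -(P.a : ℤ) ≤ n)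
    (h2 : n < P.b) : 0 < param P xp xm n := by
  rw [param]
  split_ifs with h
  · exact inv_pos.2 (hx.xp_pos n h)
  · exact hx.xm_pos n ((P.mem_Dplus_or_mem_Dminus h1 h2).resolve_left h)

lemma IsVertexParam.nonnegParam (hx : IsVertexParam P q xp xm) : NonnegParam P xp xm := by
  intro n h1 h2
  split_ifs with h
  · exact (hx.xp_pos n h).le
  · exact (hx.xm_pos n ((P.mem_Dplus_or_mem_Dminus h1 h2).resolve_left h)).le

lemma not_mem_Dplus_of_mem_Dminus {n : ℤ} (h : n ∈ P.Dminus) : n ∉ P.Dplus := fun h' =>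
  (P.mem_Dminus_iff.1 h).2.2 (P.mem_Dplus_iff.1 h').2.2

/-- The `q_t` are the quotients of consecutive parameters. -/
lemma IsVertexParam.q_eq (hx : IsVertexParam P q xp xm) {n : ℤ} (h1 : -(P.a : ℤ) < n)
    (h2 : n < P.b) : q n = param P xp xm (n - 1) / param P xp xm n := by
  rcases P.mem_Dplus_or_mem_Dminus (n := n - 1) (by omega) (by omega) with ha | ha <;>
  rcases P.mem_Dplus_or_mem_Dminus (n := n) (by omega) (by omega) with hb | hb
  · obtain ⟨i, i1, i2, i3, i4⟩ := ha
    have h3 : n < P.u i := by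
      by_contra! h
      have h4 : n = P.u i := by omega
      rcases i2.eq_or_lt with rfl | i2
      · have := P.u_last; omega
      · rw [h4] at hb
        exact (P.stepRight_u i1 i2).2 (P.mem_Dplus_iff.1 hb).2.2
    have h4 := hx.ratio_plus i i1 i2 (n - 1) i3 (by omega)
    rw [sub_add_cancel] at h4
    have h5 : n - 1 ∈ P.Dplus := ⟨i, i1, i2, i3, i4⟩
    rw [param, param, if_pos h5, if_pos hb, ← h4, inv_div_inv]
  · obtain ⟨i, i1, i2, i3⟩ := P.mem_u.2 ⟨(P.mem_Dplus_iff.1 ha).2.2, (P.mem_Dminus_iff.1 hb).2.2⟩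
    have h4 := hx.at_outer i i1 i2
    rw [i3] at h4
    rw [param, param, if_pos ha, if_neg (not_mem_Dplus_of_mem_Dminus hb), ← inv_inv (q n), ← h4,
      mul_inv, div_eq_mul_inv]
  · obtain ⟨i, i1, i2, i3⟩ := P.mem_v.2 ⟨(P.mem_Dplus_iff.1 hb).2.2, (P.mem_Dminus_iff.1 ha).2.2⟩
    have h4 := hx.at_inner i i1 i2 (by omega) (by omega)
    rw [i3] at h4
    rw [param, param, if_pos hb, if_neg (not_mem_Dplus_of_mem_Dminus ha), ← h4, div_inv_eq_mul]
  · obtain ⟨i, i2, i3, i4⟩ := ha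
    have h3 : n < P.v (i + 1) := by
      by_contra! h
      have h4 : n = P.v (i + 1) := by omega
      rw [h4] at hb
      exact (P.mem_Dminus_iff.1 hb).2.2 (P.stepRight_v (by omega) (by omega)).1
    have h4 := hx.ratio_minus i i2 (n - 1) i3 (by omega)
    rw [sub_add_cancel] at h4
    have h5 : n - 1 ∈ P.Dminus := ⟨i, i2, i3, i4⟩
    rw [param, param, if_neg (not_mem_Dplus_of_mem_Dminus h5),
      if_neg (not_mem_Dplus_of_mem_Dminus hb), ← h4]

/-- The parameters increase strictly, because `q_t < 1`. All convergence statements rest on this. -/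
lemma IsVertexParam.param_lt (hx : IsVertexParam P q xp xm)
    (hq : ∀ t : ℤ, -(P.a : ℤ) < t → t < (P.b : ℤ) → 0 ≤ q t ∧ q t < 1) {m n : ℤ}
    (h1 : -(P.a : ℤ) ≤ m) (h2 : n < P.b) (hmn : m < n) :
    param P xp xm m < param P xp xm n := by
  induction n, hmn using Int.leInduction with
  | base =>
    have h3 := hx.q_eq (n := m + 1) (by omega) h2
    rw [add_sub_cancel_right] at h3
    have h4 := (hq (m + 1) (by omega) h2).2
    rwa [h3, div_lt_one (hx.param_pos (by omega) h2)] at h4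
  | succ n hmn ih =>
    have hmn' : m + 1 ≤ n := hmn
    refine (ih (by omega)).trans ?_
    have h3 := hx.q_eq (n := n + 1) (by omega) h2
    rw [add_sub_cancel_right] at h3
    have h4 := (hq (n + 1) (by omega) h2).2
    rwa [h3, div_lt_one (hx.param_pos (by omega) h2)] at h4

/-- The weight of a skew plane partition is the weight of its path. -/
lemma IsVertexParam.prod_stepWeight (hx : IsVertexParam P q xp xm) (c : ℤ)
    (π : SkewPlanePartition P) :
    ∏ n ∈ Finset.Ico (-(P.a : ℤ)) (P.b : ℤ), stepWeight P xp xm n (π.path c n) (π.path c (n + 1)) =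
      ENNReal.ofReal (weight q π) := by
  have h1 : ∀ n ∈ Finset.Ico (-(P.a : ℤ)) (P.b : ℤ),
      stepWeight P xp xm n (π.path c n) (π.path c (n + 1)) =
      ENNReal.ofReal (param P xp xm n ^ ((sliceSize π (n + 1) : ℤ) - sliceSize π n)) := by
    intro n hn
    rw [Finset.mem_Ico] at hn
    have h2 := π.stepOK_path c n
    rw [stepWeight, param]
    have h4 := π.energy_path c n
    have h5 := π.energy_path c (n + 1)
    by_cases h : n ∈ P.Dplus
    · rw [if_pos (P.mem_Dplus_iff.1 h).2.2] at h2
      rw [if_pos h, if_pos h, if_pos h2, inv_zpow', ← zpow_natCast]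
      have h3 := h2.energy_le
      congr 2
      omega
    · have h' := (P.mem_Dplus_or_mem_Dminus hn.1 hn.2).resolve_left h
      rw [if_neg (P.mem_Dminus_iff.1 h').2.2] at h2
      rw [if_neg h, if_neg h, if_pos h2, ← zpow_natCast]
      have h3 := h2.energy_le
      congr 2
      omega
  rw [Finset.prod_congr rfl h1, ← ENNReal.ofReal_prod_of_nonneg, weight,
    prod_zpow_sub (s := fun n => (sliceSize π n : ℤ))]
  · congr 1
    refine Finset.prod_congr rfl fun n hn => ?_
    rw [Finset.mem_Ioo] at hn
    rw [hx.q_eq hn.1 hn.2, zpow_natCast]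
  · exact fun n h3 h4 => (hx.param_pos h3 h4).ne'
  · simp [π.sliceSize_eq_zero]
  · simp [π.sliceSize_eq_zero]
  · intro n hn
    rw [Finset.mem_Ico] at hn
    exact zpow_nonneg (hx.param_pos hn.1 hn.2).le _

/-- The sum over paths is a sum over skew plane partitions. -/
lemma IsVertexParam.pathSum_eq (hx : IsVertexParam P q xp xm) (c : ℤ) (φ : (ℤ → Maya) → ℝ≥0∞) :
    pathSum P xp xm P.b φ (vac c) (vac c) =
      ∑' π : SkewPlanePartition P, ENNReal.ofReal (weight q π) * φ (π.path c) := by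
  set g : SkewPlanePartition P →
      {U : ℤ → Maya // (∀ r ≤ -(P.a : ℤ), U r = vac c) ∧ ∀ r, (P.b : ℤ) ≤ r → U r = vac c} :=
    fun π => ⟨π.path c, fun r hr => π.path_eq_vac c (Or.inl hr),
      fun r hr => π.path_eq_vac c (Or.inr hr)⟩ with hg
  have hinj : Function.Injective g := fun π π' h =>
    SkewPlanePartition.path_injective c (congrArg Subtype.val h)
  rw [pathSum, ← hinj.tsum_eq]
  · refine tsum_congr fun π => ?_
    rw [← hx.prod_stepWeight c π]
  · intro U hU
    have h1 : ∀ n ∈ Finset.Ico (-(P.a : ℤ)) (P.b : ℤ),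
        stepWeight P xp xm n (U.1 n) (U.1 (n + 1)) ≠ 0 :=
      Finset.prod_ne_zero_iff.1 (left_ne_zero_of_mul (Function.mem_support.1 hU))
    have hstep : StepOK P U.1 := by
      intro t
      by_cases ht : -(P.a : ℤ) ≤ t ∧ t < P.b
      · have h2 := h1 t (Finset.mem_Ico.2 ht)
        rw [stepWeight] at h2
        by_cases h : t ∈ P.Dplus
        · rw [if_pos h] at h2
          rw [if_pos (P.mem_Dplus_iff.1 h).2.2]
          by_contra h3
          exact h2 (if_neg h3)
        · rw [if_neg h] at h2
          have h' := (P.mem_Dplus_or_mem_Dminus ht.1 ht.2).resolve_left h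
          rw [if_neg (P.mem_Dminus_iff.1 h').2.2]
          by_contra h3
          exact h2 (if_neg h3)
      · have e : U.1 t = U.1 (t + 1) := by
          rcases not_and_or.1 ht with h | h
          · rw [U.2.1 t (by omega), U.2.1 (t + 1) (by omega)]
          · rw [U.2.2 t (by omega), U.2.2 (t + 1) (by omega)]
        rw [e]
        split_ifs <;> exact Maya.inter_self _
    obtain ⟨π, hπ⟩ := exists_path_eq c hstep fun t ht => ht.elim (U.2.1 t) (U.2.2 t)
    exact ⟨π, Subtype.ext hπ⟩

/-- The tiles of a skew plane partition are the modes of its path. -/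
lemma modeIndicator_path {n : ℕ} {p : Fin n → ℤ × ℚ} (hp : ∀ i, IsSite (p i))
    (π : SkewPlanePartition P) :
    modeIndicator P (List.ofFn fun i => ((p i).1, mode P (p i))) (π.path 0) =
      ENNReal.ofReal (∏ i, localDensity (p i) π) := by
  rw [modeIndicator, List.map_ofFn, List.prod_ofFn, ENNReal.ofReal_prod_of_nonneg]
  · refine Finset.prod_congr rfl fun i _ => ?_
    simp only [Function.comp_apply]
    rw [π.path_clampPos, localDensity]
    have h : mode P (p i) ∈ (π.path 0 (p i).1).carrier ↔ p i ∈ tiles π := by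
      rw [mem_tiles_iff π (hp i), SkewPlanePartition.path, Ptn.mem_maya]
      refine exists_congr fun k => ?_
      simp only [Ptn.pos, SkewPlanePartition.slice]
      omega
    rw [h]
    split_ifs <;> simp
  · intro i _
    rw [localDensity]
    split_ifs <;> simp

end Params

/-! ### Matrix elements as values of power series in one variable -/

open scoped ENNReal ComplexOrder

lemma sum_antidiagonalTuple_succ {M : Type*} [AddCommMonoid M] (l N : ℕ)
    (f : (Fin (l + 1) → ℕ) → M) :
    ∑ n ∈ Finset.Nat.antidiagonalTuple (l + 1) N, f n =
      ∑ p ∈ Finset.HasAntidiagonal.antidiagonal N,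
        ∑ m ∈ Finset.Nat.antidiagonalTuple l p.2, f (Fin.cons p.1 m) := by
  rw [Finset.sum_sigma']
  refine Finset.sum_bij' (fun n _ => ⟨(n 0, ∑ i, Fin.tail n i), Fin.tail n⟩)
    (fun x _ => Fin.cons x.1.1 x.2) ?_ ?_ ?_ ?_ ?_
  · intro n hn
    rw [Finset.Nat.mem_antidiagonalTuple, Fin.sum_univ_succ] at hn
    rw [Finset.mem_sigma, Finset.HasAntidiagonal.mem_antidiagonal,
      Finset.Nat.mem_antidiagonalTuple]
    exact ⟨hn, rfl⟩
  · rintro ⟨p, m⟩ hx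
    rw [Finset.mem_sigma, Finset.HasAntidiagonal.mem_antidiagonal,
      Finset.Nat.mem_antidiagonalTuple] at hx
    rw [Finset.Nat.mem_antidiagonalTuple, Fin.sum_univ_succ]
    simp only [Fin.cons_zero, Fin.cons_succ]
    rw [← hx.1, ← hx.2]
  · intro n _
    exact Fin.cons_self_tail n
  · rintro ⟨p, m⟩ hx
    rw [Finset.mem_sigma, Finset.HasAntidiagonal.mem_antidiagonal,
      Finset.Nat.mem_antidiagonalTuple] at hx
    simp only [Fin.cons_zero, Fin.tail_cons]
    congr 1
    exact Prod.ext rfl hx.2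
  · intro n _
    rw [Fin.cons_self_tail]

lemma coeff_list_prod {R α : Type*} [Semiring R] (g : α → PowerSeries R) :
    ∀ (W : List α) (N : ℕ), PowerSeries.coeff N (W.map g).prod =
      ∑ n ∈ Finset.Nat.antidiagonalTuple W.length N,
        (List.ofFn fun i => PowerSeries.coeff (n i) (g (W.get i))).prod := by
  intro W
  induction W with
  | nil =>
    intro N
    rw [List.map_nil, List.prod_nil, PowerSeries.coeff_one]
    cases N with
    | zero => simp
    | succ N => simp
  | cons F W ih =>
    intro N
    rw [List.map_cons, List.prod_cons, PowerSeries.coeff_mul]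
    refine Eq.trans ?_ (sum_antidiagonalTuple_succ W.length N _).symm
    refine Finset.sum_congr rfl fun p _ => ?_
    rw [ih, Finset.mul_sum]
    refine Finset.sum_congr rfl fun m _ => ?_
    rw [List.ofFn_congr (List.length_cons (as := W) (a := F)), List.ofFn_succ, List.prod_cons]
    rfl

lemma prod_ofFn_smul {R : Type*} [Ring R] [Algebra ℂ R] :
    ∀ {l : ℕ} (c : Fin l → ℂ) (A : Fin l → R),
    (List.ofFn fun i => c i • A i).prod = (∏ i, c i) • (List.ofFn A).prod := by
  intro l
  induction l with
  | zero => intros; simp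
  | succ l ih =>
    intro c A
    rw [List.ofFn_succ, List.ofFn_succ, List.prod_cons, List.prod_cons, ih, Fin.prod_univ_succ,
      smul_mul_smul_comm]

/-- The series in one variable `s` collects the terms of a matrix element by total degree. -/
lemma coeff_vev_wordE (W : List Factor) (N : ℕ) : PowerSeries.coeff N (vev (wordE W)) =
    ∑ n ∈ Finset.Nat.antidiagonalTuple W.length N,
      matrixTerm W (basisVec (vac 0)) (basisVec (vac 0)) n := by
  rw [coeff_vev, wordE, coeff_list_prod, LinearMap.sum_apply, Finsupp.finsetSum_apply]
  refine Finset.sum_congr rfl fun n _ => ?_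
  have h : (List.ofFn fun i => PowerSeries.coeff (n i) (factorOp (W.get i))).prod =
      (∏ i, (W.get i).1 ^ n i) •
        (List.ofFn fun i => PowerSeries.coeff (n i) (W.get i).2).prod := by
    rw [← prod_ofFn_smul (R := Module.End ℂ Fock)]
    simp only [factorOp, PowerSeries.coeff_mk]
  rw [h, matrixTerm_eq, wordVec, LinearMap.smul_apply, Finsupp.smul_apply, smul_eq_mul]

lemma NonnegWord.coeff_vev_nonneg {W : List Factor} (hW : NonnegWord W) (N : ℕ) :
    0 ≤ PowerSeries.coeff N (vev (wordE W)) := by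
  rw [coeff_vev_wordE]
  exact Finset.sum_nonneg fun n _ => hW _ _ _

/-- Terms without cancellation may be collected by total degree; thus absolute convergence of the
series in `s` implies that of the series in all variables. -/
lemma NonnegWord.tsum_enorm_coeff_vev {W : List Factor} (hW : NonnegWord W) :
    ∑' N, ‖PowerSeries.coeff N (vev (wordE W))‖ₑ = mass W (vac 0) (vac 0) := by
  rw [mass, ← (Finset.Nat.sigmaAntidiagonalTupleEquivTuple W.length).tsum_eq,
    ENNReal.tsum_sigma']
  refine tsum_congr fun N => ?_
  rw [coeff_vev_wordE, enorm_sum_of_nonneg _ _ fun n _ => hW _ _ _, ← Finset.tsum_subtype]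
  rfl

/-- A power series converges absolutely at `1`, with the given sum. -/
def HasValue (f : PowerSeries ℂ) (v : ℂ) : Prop :=
  Summable (fun n => ‖PowerSeries.coeff n f‖) ∧ ∑' n, PowerSeries.coeff n f = v

lemma HasValue.unique {f : PowerSeries ℂ} {v w : ℂ} (h : HasValue f v) (h' : HasValue f w) :
    v = w := h.2.symm.trans h'.2

lemma HasValue.mass_ne_top {W : List Factor} (hW : NonnegWord W) {v : ℂ}
    (h : HasValue (vev (wordE W)) v) : mass W (vac 0) (vac 0) ≠ ∞ := by
  rw [← hW.tsum_enorm_coeff_vev]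
  exact tsum_enorm_ne_top_iff_summable_norm.2 h.1

lemma NonnegWord.hasValue {W : List Factor} (hW : NonnegWord W)
    (h : mass W (vac 0) (vac 0) ≠ ∞) :
    HasValue (vev (wordE W)) (mass W (vac 0) (vac 0)).toReal := by
  rw [← hW.tsum_enorm_coeff_vev] at h ⊢
  exact ⟨tsum_enorm_ne_top_iff_summable_norm.1 h, (tsum_eq_of_nonneg hW.coeff_vev_nonneg h).2⟩

lemma NonnegWord.matrixElement_eq {W : List Factor} (hW : NonnegWord W) (c : ℤ)
    (h : mass W (vac c) (vac c) ≠ ∞) :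
    Summable (matrixTerm W (vacuum c) (vacuum c)) ∧
      matrixElement W (vacuum c) (vacuum c) = (mass W (vac c) (vac c)).toReal :=
  tsum_eq_of_nonneg (hW (vac c) (vac c)) h

/-! ### Values of power series -/

lemma HasValue.one : HasValue 1 1 := by
  have h : ∀ n, n ≠ 0 → PowerSeries.coeff n (1 : PowerSeries ℂ) = 0 := fun n hn => by
    rw [PowerSeries.coeff_one, if_neg hn]
  refine ⟨summable_of_ne_finset_zero (s := {0}) fun n hn => ?_, ?_⟩
  · rw [h n (by simpa using hn), norm_zero]
  · rw [tsum_eq_single 0 h, PowerSeries.coeff_one, if_pos rfl]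

lemma HasValue.add {f g : PowerSeries ℂ} {v w : ℂ} (hf : HasValue f v) (hg : HasValue g w) :
    HasValue (f + g) (v + w) := by
  obtain ⟨hf1, hf2⟩ := hf
  obtain ⟨hg1, hg2⟩ := hg
  have h : ∀ n, PowerSeries.coeff n (f + g) = PowerSeries.coeff n f + PowerSeries.coeff n g :=
    fun n => map_add _ f g
  unfold HasValue
  simp only [h]
  constructor
  · exact (hf1.add hg1).of_nonneg_of_le (fun _ => norm_nonneg _) fun n => norm_add_le _ _
  · rw [hf1.of_norm.tsum_add hg1.of_norm, hf2, hg2]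

lemma HasValue.neg {f : PowerSeries ℂ} {v : ℂ} (hf : HasValue f v) : HasValue (-f) (-v) := by
  obtain ⟨hf1, hf2⟩ := hf
  have h : ∀ n, PowerSeries.coeff n (-f) = -PowerSeries.coeff n f := fun n => map_neg _ f
  unfold HasValue
  simp only [h, norm_neg, tsum_neg, hf2, and_true]
  exact hf1

lemma HasValue.mul {f g : PowerSeries ℂ} {v w : ℂ} (hf : HasValue f v) (hg : HasValue g w) :
    HasValue (f * g) (v * w) := by
  obtain ⟨hf1, hf2⟩ := hf
  obtain ⟨hg1, hg2⟩ := hg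
  have h : ∀ n, PowerSeries.coeff n (f * g) = ∑ x ∈ Finset.HasAntidiagonal.antidiagonal n,
      PowerSeries.coeff x.1 f * PowerSeries.coeff x.2 g := fun n => PowerSeries.coeff_mul n f g
  have h1 := summable_norm_sum_mul_antidiagonal_of_summable_norm
    (f := fun n => PowerSeries.coeff n f) (g := fun n => PowerSeries.coeff n g) hf1 hg1
  have h2 := tsum_mul_tsum_eq_tsum_sum_antidiagonal_of_summable_norm
    (f := fun n => PowerSeries.coeff n f) (g := fun n => PowerSeries.coeff n g) hf1 hg1
  rw [hf2, hg2] at h2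
  unfold HasValue
  simp only [h]
  exact ⟨h1, h2.symm⟩

lemma HasValue.sum {α : Type*} (s : Finset α) {f : α → PowerSeries ℂ} {v : α → ℂ}
    (h : ∀ i ∈ s, HasValue (f i) (v i)) : HasValue (∑ i ∈ s, f i) (∑ i ∈ s, v i) := by
  induction s using Finset.induction_on with
  | empty => exact ⟨by simp, by simp⟩
  | insert i s hi ih =>
    rw [Finset.sum_insert hi, Finset.sum_insert hi]
    exact (h i (Finset.mem_insert_self i s)).add
      (ih fun k hk => h k (Finset.mem_insert_of_mem hk))

lemma HasValue.prod {α : Type*} (s : Finset α) {f : α → PowerSeries ℂ} {v : α → ℂ}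
    (h : ∀ i ∈ s, HasValue (f i) (v i)) : HasValue (∏ i ∈ s, f i) (∏ i ∈ s, v i) := by
  induction s using Finset.induction_on with
  | empty => simpa using HasValue.one
  | insert i s hi ih =>
    rw [Finset.prod_insert hi, Finset.prod_insert hi]
    exact (h i (Finset.mem_insert_self i s)).mul
      (ih fun k hk => h k (Finset.mem_insert_of_mem hk))

lemma HasValue.det {n : ℕ} {M : Matrix (Fin n) (Fin n) (PowerSeries ℂ)}
    {V : Matrix (Fin n) (Fin n) ℂ} (h : ∀ i k, HasValue (M i k) (V i k)) :
    HasValue M.det V.det := by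
  rw [Matrix.det_apply, Matrix.det_apply]
  refine HasValue.sum _ fun σ _ => ?_
  have h1 := HasValue.prod Finset.univ fun i _ => h (σ i) i
  rcases Int.units_eq_one_or (Equiv.Perm.sign σ) with hs | hs
  · rw [hs, one_smul, one_smul]
    exact h1
  · rw [hs, Units.neg_smul, one_smul, Units.neg_smul, one_smul]
    exact h1.neg

/-- The value of `(1 - a s²)⁻¹`. -/
lemma hasValue_inv {a : ℂ} (ha : ‖a‖ < 1) :
    HasValue (1 - PowerSeries.C a * PowerSeries.X ^ 2)⁻¹ (1 - a)⁻¹ := by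
  set f : PowerSeries ℂ := PowerSeries.mk fun n => if Even n then a ^ (n / 2) else 0 with hf
  have h1 : (1 - PowerSeries.C a * PowerSeries.X ^ 2 : PowerSeries ℂ)⁻¹ = f := by
    rw [eq_comm, PowerSeries.eq_inv_iff_mul_eq_one (by simp)]
    rw [mul_sub, mul_one, ← mul_assoc, mul_comm f, mul_assoc, sub_eq_iff_eq_add]
    ext1 n
    rw [map_add, PowerSeries.coeff_C_mul, PowerSeries.coeff_mul_X_pow', hf, PowerSeries.coeff_mk,
      PowerSeries.coeff_one]
    match n with
    | 0 => simp
    | 1 => simp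
    | n + 2 =>
      have e1 : ¬ n + 2 = 0 := by omega
      have e2 : 2 ≤ n + 2 := by omega
      have e3 : Even (n + 2) ↔ Even n := by simp [Nat.even_add]
      have e4 : (n + 2) / 2 = n / 2 + 1 := by omega
      rw [if_neg e1, if_pos e2, PowerSeries.coeff_mk, zero_add, Nat.add_sub_cancel]
      simp only [e3, e4]
      split_ifs <;> ring
  have hinj : Function.Injective fun n : ℕ => 2 * n := fun m n h => by
    have h' : 2 * m = 2 * n := h
    omega
  have hsupp : ∀ {M : Type} [Zero M] (g : ℂ → M), g 0 = 0 →
      Function.support (fun n => g (PowerSeries.coeff n f)) ⊆ Set.range fun n : ℕ => 2 * n := by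
    intro M _ g hg n hn
    rw [Function.mem_support, hf, PowerSeries.coeff_mk] at hn
    by_cases he : Even n
    · obtain ⟨k, rfl⟩ := he
      exact ⟨k, two_mul k⟩
    · rw [if_neg he] at hn
      exact absurd hg hn
  have hc : ∀ n : ℕ, PowerSeries.coeff (2 * n) f = a ^ n := fun n => by
    rw [hf, PowerSeries.coeff_mk, if_pos (even_two_mul n)]
    congr 1
    omega
  rw [h1]
  constructor
  · refine (hinj.summable_iff fun n hn => ?_).1 ?_
    · by_contra h
      exact hn (hsupp norm norm_zero h)
    · simp only [Function.comp_def, hc, norm_pow]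
      exact summable_geometric_of_lt_one (norm_nonneg _) ha
  · rw [← hinj.tsum_eq (f := fun n => PowerSeries.coeff n f) (hsupp id rfl)]
    simp only [hc]
    exact tsum_geometric_of_norm_lt_one ha

/-! ### Laurent series on circles -/

section Contours

open LaurentPolynomial

/-- The value at the point `z` of a Laurent polynomial in the variable `T = z⁻¹`. -/
def evalL (z : ℂ) : LaurentPolynomial ℂ →ₗ[ℂ] ℂ := laurentLift fun k => z ^ (-k)

/-- The sum of the absolute values of the terms of a Laurent polynomial in `T = z⁻¹` on the circle
`|z| = r`. -/
def majL (r : ℝ) (p : LaurentPolynomial ℂ) : ℝ := p.coeff.sum fun k c => ‖c‖ * r ^ (-k)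

lemma majL_monomial (r : ℝ) (c : ℂ) (k : ℤ) : majL r (C c * T k) = ‖c‖ * r ^ (-k) := by
  rw [← single_eq_C_mul_T, majL]
  exact Finsupp.sum_single_index (by simp)

lemma eq_sum_monomials (p : LaurentPolynomial ℂ) :
    p = ∑ k ∈ p.coeff.support, C (p.coeff k) * T k := by
  conv_lhs => rw [← AddMonoidAlgebra.sum_coeff_single p]
  simp only [single_eq_C_mul_T, Finsupp.sum]

lemma majL_nonneg {r : ℝ} (hr : 0 < r) (p : LaurentPolynomial ℂ) : 0 ≤ majL r p :=
  Finset.sum_nonneg fun _ _ => mul_nonneg (norm_nonneg _) (zpow_pos hr _).le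

lemma majL_zero (r : ℝ) : majL r 0 = 0 := Finsupp.sum_zero_index

lemma majL_add_le {r : ℝ} (hr : 0 < r) (p q : LaurentPolynomial ℂ) :
    majL r (p + q) ≤ majL r p + majL r q := by
  have h : ∀ (f : LaurentPolynomial ℂ) (s : Finset ℤ), f.coeff.support ⊆ s →
      majL r f = ∑ k ∈ s, ‖f.coeff k‖ * r ^ (-k) := fun f s hs =>
    Finsupp.sum_of_support_subset _ hs _ (by simp)
  have hs : (p + q).coeff.support ⊆ p.coeff.support ∪ q.coeff.support := by
    rw [AddMonoidAlgebra.coeff_add]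
    exact Finsupp.support_add
  rw [h _ _ hs, h p _ Finset.subset_union_left, h q _ Finset.subset_union_right,
    ← Finset.sum_add_distrib]
  refine Finset.sum_le_sum fun k _ => ?_
  rw [← add_mul, AddMonoidAlgebra.coeff_add, Finsupp.add_apply]
  exact mul_le_mul_of_nonneg_right (norm_add_le _ _) (zpow_pos hr _).le

/-- A subadditive function of a linear image is bounded by `majL` as soon as this holds on
monomials. -/
lemma le_majL {r : ℝ} {M : Type*} [AddCommGroup M]
    (F : LaurentPolynomial ℂ →+ M) (N : M → ℝ) (h0 : N 0 = 0)
    (hadd : ∀ x y, N (x + y) ≤ N x + N y) (K : ℝ)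
    (hmon : ∀ c k, N (F (C c * T k)) ≤ K * (‖c‖ * r ^ (-k))) (p : LaurentPolynomial ℂ) :
    N (F p) ≤ K * majL r p := by
  conv_lhs => rw [eq_sum_monomials p, map_sum]
  rw [majL, Finsupp.sum, Finset.mul_sum]
  exact (Finset.le_sum_of_subadditive N h0.le hadd _ _).trans
    (Finset.sum_le_sum fun k _ => hmon _ _)

lemma norm_evalL_le {z : ℂ} {r : ℝ} (hz : ‖z‖ = r) (p : LaurentPolynomial ℂ) :
    ‖evalL z p‖ ≤ majL r p := by
  rw [← one_mul (majL r p)]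
  refine le_majL (evalL z).toAddMonoidHom norm norm_zero norm_add_le 1 (fun c k => ?_) p
  rw [LinearMap.toAddMonoidHom_coe, evalL, laurentLift_monomial, norm_smul, norm_zpow, hz, one_mul]

lemma norm_ctL_le {r : ℝ} (hr : 0 < r) (p : LaurentPolynomial ℂ) : ‖ctL p‖ ≤ majL r p := by
  rw [← one_mul (majL r p)]
  refine le_majL ctL.toAddMonoidHom norm norm_zero norm_add_le 1 (fun c k => ?_) p
  rw [LinearMap.toAddMonoidHom_coe, ctL, laurentLift_monomial, one_mul]
  split_ifs with h
  · simp [h]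
  · rw [smul_zero, norm_zero]
    positivity

lemma majL_mul_le {r : ℝ} (hr : 0 < r) (p q : LaurentPolynomial ℂ) :
    majL r (p * q) ≤ majL r p * majL r q := by
  have h1 : ∀ c k, majL r (C c * T k * q) ≤ ‖c‖ * r ^ (-k) * majL r q := fun c k => by
    refine le_majL (AddMonoidHom.mulLeft (C c * T k)) (majL r) (majL_zero r)
      (majL_add_le hr) (‖c‖ * r ^ (-k)) (fun d l => ?_) q
    have e : C c * T k * (C d * T l) = C (c * d) * (T (k + l) : LaurentPolynomial ℂ) := by
      rw [map_mul, T_add]; ring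
    rw [AddMonoidHom.coe_mulLeft, e, majL_monomial, norm_mul, neg_add, zpow_add₀ hr.ne']
    exact le_of_eq (by ring)
  have h2 := le_majL (AddMonoidHom.mulRight q) (majL r) (majL_zero r) (majL_add_le hr) (majL r q)
    (fun c k => (h1 c k).trans_eq (mul_comm _ _)) p
  exact h2.trans_eq (mul_comm _ _)

lemma evalL_mul {z : ℂ} (hz : z ≠ 0) (p q : LaurentPolynomial ℂ) :
    evalL z (p * q) = evalL z p * evalL z q := by
  induction p using LaurentPolynomial.induction_on' with
  | add f f' hf hf' => simp only [map_add, add_mul, hf, hf']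
  | C_mul_T k c =>
    induction q using LaurentPolynomial.induction_on' with
    | add f f' hf hf' => simp only [map_add, mul_add, hf, hf']
    | C_mul_T l d =>
      have e : C c * T k * (C d * T l) = C (c * d) * (T (k + l) : LaurentPolynomial ℂ) := by
        rw [map_mul, T_add]; ring
      rw [e]
      simp only [evalL, laurentLift_monomial, neg_add, zpow_add₀ hz, smul_eq_mul]
      ring

lemma continuousOn_evalL {r : ℝ} (hr : 0 < r) (p : LaurentPolynomial ℂ) :
    ContinuousOn (fun z => evalL z p) (Metric.sphere 0 r) := by
  induction p using LaurentPolynomial.induction_on' with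
  | add f f' hf hf' =>
    simp only [map_add]
    exact hf.add hf'
  | C_mul_T k c =>
    simp only [evalL, laurentLift_monomial]
    refine ContinuousOn.const_smul (ContinuousOn.zpow₀ (f := fun z : ℂ => z) continuousOn_id _
      fun z hz => Or.inl ?_) c
    exact Metric.ne_of_mem_sphere hz hr.ne'

/-- Termwise integration over a circle of a series that converges normally on it. -/
lemma hasSum_circleIntegral {F : ℕ → ℂ → ℂ} {f : ℂ → ℂ} {r : ℝ} (hr : 0 ≤ r) {b : ℕ → ℝ}
    (hF : ∀ n, ContinuousOn (F n) (Metric.sphere 0 r)) (hb : Summable b)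
    (hFb : ∀ n, ∀ z ∈ Metric.sphere (0 : ℂ) r, ‖F n z‖ ≤ b n)
    (hf : ∀ z ∈ Metric.sphere (0 : ℂ) r, ∑' n, F n z = f z) :
    HasSum (fun n => ∮ z in C(0, r), F n z) (∮ z in C(0, r), f z) := by
  have hmem : ∀ θ : ℝ, circleMap 0 r θ ∈ Metric.sphere (0 : ℂ) r := fun θ =>
    circleMap_mem_sphere 0 hr θ
  have hd : ∀ θ : ℝ, ‖deriv (circleMap 0 r) θ‖ = r := fun θ => by
    rw [deriv_circleMap, norm_mul, Complex.norm_I, mul_one, norm_circleMap_zero, abs_of_nonneg hr]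
  refine intervalIntegral.hasSum_integral_of_dominated_convergence (fun n _ => r * b n)
    (fun n => ?_) (fun n => ?_) ?_ ?_ ?_
  · refine Continuous.aestronglyMeasurable ?_
    refine Continuous.smul (M := ℂ) (X := ℂ) ?_ ?_
    · rw [show deriv (circleMap 0 r) = fun θ => circleMap 0 r θ * Complex.I from
        funext fun θ => deriv_circleMap 0 r θ]
      exact (continuous_circleMap 0 r).mul continuous_const
    · exact (hF n).comp_continuous (continuous_circleMap 0 r) hmem
  · refine Filter.Eventually.of_forall fun θ _ => ?_
    rw [norm_smul, hd]
    exact mul_le_mul_of_nonneg_left (hFb n _ (hmem θ)) hr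
  · exact Filter.Eventually.of_forall fun θ _ => hb.mul_left r
  · exact intervalIntegrable_const
  · refine Filter.Eventually.of_forall fun θ _ => HasSum.const_smul _ ?_
    change HasSum (fun n => F n (circleMap 0 r θ)) (f (circleMap 0 r θ))
    rw [← hf _ (hmem θ)]
    exact (hb.of_norm_bounded fun n => hFb n _ (hmem θ)).hasSum

lemma circleIntegral_zpow {r : ℝ} (hr : 0 < r) (l : ℤ) :
    ∮ w in C(0, r), w ^ (-l) = if l = 1 then 2 * Real.pi * Complex.I else 0 := by
  split_ifs with h
  · subst h
    have := circleIntegral.integral_sub_center_inv 0 hr.ne'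
    simpa using this
  · have := circleIntegral.integral_sub_zpow_of_ne (n := -l) (by omega) 0 0 r
    simpa using this

/-- The mean over a circle of a Laurent polynomial is its constant term. -/
lemma circleIntegral_evalL {r : ℝ} (hr : 0 < r) (p : LaurentPolynomial ℂ) :
    ∮ z in C(0, r), evalL z p * z⁻¹ = 2 * Real.pi * Complex.I * ctL p := by
  induction p using LaurentPolynomial.induction_on' with
  | add f f' hf hf' =>
    have hi : ∀ g : LaurentPolynomial ℂ,
        CircleIntegrable (fun z => evalL z g * z⁻¹) 0 r := fun g =>
      ((continuousOn_evalL hr g).mul (continuousOn_id.inv₀ fun z hz =>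
        Metric.ne_of_mem_sphere hz hr.ne')).circleIntegrable hr.le
    simp only [map_add, add_mul, mul_add]
    rw [circleIntegral.integral_add (hi f) (hi f'), hf, hf']
  | C_mul_T k c =>
    have h : ∀ z ∈ Metric.sphere (0 : ℂ) r,
        evalL z (C c * T k) * z⁻¹ = c * z ^ (-(k + 1)) := fun z hz => by
      have hz0 : z ≠ 0 := Metric.ne_of_mem_sphere hz hr.ne'
      rw [evalL, laurentLift_monomial, neg_add, zpow_add₀ hz0, zpow_neg_one, smul_eq_mul, mul_assoc]
    rw [circleIntegral.integral_congr hr.le h, circleIntegral.integral_const_mul,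
      circleIntegral_zpow hr, ctL, laurentLift_monomial]
    by_cases hk : k = 0
    · simp [hk, mul_comm]
    · simp [hk]

end Contours

/-! ### Cauchy integrals of Laurent series -/

section Contours

open LaurentPolynomial

lemma continuousOn_zpow_sphere {s : ℝ} (hs : 0 < s) (l : ℤ) :
    ContinuousOn (fun w : ℂ => w ^ l) (Metric.sphere 0 s) :=
  ContinuousOn.zpow₀ (f := fun w : ℂ => w) continuousOn_id _ fun _ hw =>
    Or.inl (Metric.ne_of_mem_sphere hw hs.ne')

lemma sub_ne_zero_of_mem_sphere {s : ℝ} {z : ℂ} (hz : ‖z‖ ≠ s) {w : ℂ}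
    (hw : w ∈ Metric.sphere (0 : ℂ) s) : z - w ≠ 0 := by
  intro h
  rw [mem_sphere_zero_iff_norm] at hw
  exact hz (by rw [sub_eq_zero.1 h, hw])

lemma continuousOn_cauchy {s : ℝ} {z : ℂ} (hz : ‖z‖ ≠ s) :
    ContinuousOn (fun w : ℂ => 1 / (z - w)) (Metric.sphere 0 s) :=
  continuousOn_const.div (continuousOn_const.sub continuousOn_id) fun _ hw =>
    sub_ne_zero_of_mem_sphere hz hw

/-- The Cauchy integral of a monomial: `χ` is the indicator of `l > 0` if `z` lies outside the
circle and minus the indicator of `l ≤ 0` if `z` lies inside. -/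
lemma circleIntegral_cauchy {s : ℝ} (hs : 0 < s) {z : ℂ} (hz0 : z ≠ 0) (hz : ‖z‖ ≠ s) {χ : ℤ → ℂ}
    (h0 : χ 0 = if ‖z‖ < s then -1 else 0)
    (hχ : ∀ l, χ (l + 1) = χ l + if l + 1 = 1 then 1 else 0) (l : ℤ) :
    ∮ w in C(0, s), w ^ (-l) * (1 / (z - w)) = 2 * Real.pi * Complex.I * (χ l * z ^ (-l)) := by
  have hstep : ∀ l : ℤ, z * ∮ w in C(0, s), w ^ (-(l + 1)) * (1 / (z - w)) =
      (if l + 1 = 1 then 2 * Real.pi * Complex.I else 0) +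
        ∮ w in C(0, s), w ^ (-l) * (1 / (z - w)) := by
    intro l
    rw [← circleIntegral_zpow hs, ← circleIntegral.integral_const_mul,
      ← circleIntegral.integral_add]
    · refine circleIntegral.integral_congr hs.le fun w hw => ?_
      have hw0 : w ≠ 0 := Metric.ne_of_mem_sphere hw hs.ne'
      have h1 := sub_ne_zero_of_mem_sphere hz hw
      have h2 : w ^ (-l) = w ^ (-(l + 1)) * w := by
        rw [← zpow_add_one₀ hw0]
        congr 1
        ring
      simp only [h2]
      field_simp
      ring
    · exact (continuousOn_zpow_sphere hs _).circleIntegrable hs.le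
    · exact ((continuousOn_zpow_sphere hs _).mul (continuousOn_cauchy hz)).circleIntegrable hs.le
  have hzl : ∀ l : ℤ, z ^ (-l) = z * z ^ (-(l + 1)) := fun l => by
    rw [mul_comm, ← zpow_add_one₀ hz0]
    congr 1
    ring
  induction l using Int.induction_on with
  | zero =>
    simp only [neg_zero, zpow_zero, one_mul, mul_one, h0]
    split_ifs with h
    · have h1 := circleIntegral.integral_sub_inv_of_mem_ball (c := 0) (w := z) (R := s)
        (by rwa [mem_ball_zero_iff])
      have h2 : (∮ w in C(0, s), 1 / (z - w)) = ∮ w in C(0, s), (-1 : ℂ) * (w - z)⁻¹ := by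
        refine circleIntegral.integral_congr hs.le fun w _ => ?_
        rw [← neg_sub w z, one_div, inv_neg, neg_one_mul]
      rw [h2, circleIntegral.integral_const_mul, h1]
      ring
    · rw [mul_zero]
      have hne : ∀ w ∈ Metric.closedBall (0 : ℂ) s, z - w ≠ 0 := fun w hw h' => by
        rw [mem_closedBall_zero_iff, ← sub_eq_zero.1 h'] at hw
        exact h (lt_of_le_of_ne hw hz)
      refine Complex.circleIntegral_eq_zero_of_differentiable_on_off_countable hs.le
        Set.countable_empty ?_ ?_
      · exact continuousOn_const.div (continuousOn_const.sub continuousOn_id) hne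
      · intro w hw
        exact (differentiableAt_const _).div ((differentiableAt_const _).sub differentiableAt_id)
          (hne w (Metric.ball_subset_closedBall hw.1))
  | succ l ih =>
    have h1 := hstep l
    rw [ih, hzl] at h1
    refine mul_left_cancel₀ hz0 (h1.trans ?_)
    rw [hχ]
    by_cases hl : (l : ℤ) + 1 = 1
    · rw [if_pos hl, if_pos hl, hl, zpow_neg_one]
      field_simp
      ring
    · rw [if_neg hl, if_neg hl]
      ring
  | pred l ih =>
    have h1 := hstep (-l - 1)
    have h2 := hχ (-l - 1)
    rw [sub_add_cancel, ih] at h1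
    rw [sub_add_cancel] at h2
    rw [← sub_eq_iff_eq_add'] at h1
    rw [← h1, h2, hzl (-l - 1), sub_add_cancel]
    by_cases hl : -(l : ℤ) = 1
    · rw [if_pos hl, if_pos hl, hl, zpow_neg_one]
      field_simp
      ring
    · rw [if_neg hl, if_neg hl]
      ring

/-- Multiplication of the coefficients of a Laurent polynomial by a function of the exponent. -/
def coeffMulL (χ : ℤ → ℂ) : LaurentPolynomial ℂ →ₗ[ℂ] LaurentPolynomial ℂ :=
  laurentLift fun k => χ k • T k

/-- Multiplication of the coefficients by a function of the exponent of `T`. -/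
def coeffMulH (χ : ℤ → ℂ) : SymSeries →+ SymSeries := mapSeries (coeffMulL χ).toAddMonoidHom

lemma coeff_coeffMulH (χ : ℤ → ℂ) (f : SymSeries) (n : ℕ) :
    PowerSeries.coeff n (coeffMulH χ f) = coeffMulL χ (PowerSeries.coeff n f) :=
  coeff_mapSeries _ _ _

lemma circleIntegral_cauchy_evalL {s : ℝ} (hs : 0 < s) {z : ℂ} (hz0 : z ≠ 0) (hz : ‖z‖ ≠ s)
    {χ : ℤ → ℂ} (h0 : χ 0 = if ‖z‖ < s then -1 else 0)
    (hχ : ∀ l, χ (l + 1) = χ l + if l + 1 = 1 then 1 else 0) (p : LaurentPolynomial ℂ) :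
    ∮ w in C(0, s), evalL w p * (1 / (z - w)) =
      2 * Real.pi * Complex.I * evalL z (coeffMulL χ p) := by
  induction p using LaurentPolynomial.induction_on' with
  | add f f' hf hf' =>
    have hi : ∀ g : LaurentPolynomial ℂ,
        CircleIntegrable (fun w => evalL w g * (1 / (z - w))) 0 s := fun g =>
      ((continuousOn_evalL hs g).mul (continuousOn_cauchy hz)).circleIntegrable hs.le
    simp only [map_add, add_mul, mul_add]
    rw [circleIntegral.integral_add (hi f) (hi f'), hf, hf']
  | C_mul_T k c =>
    have h : ∀ w, evalL w (C c * T k) * (1 / (z - w)) = c * (w ^ (-k) * (1 / (z - w))) :=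
      fun w => by rw [evalL, laurentLift_monomial, smul_eq_mul, mul_assoc]
    simp only [h]
    rw [circleIntegral.integral_const_mul, circleIntegral_cauchy hs hz0 hz h0 hχ, coeffMulL,
      laurentLift_monomial, map_smul, map_smul, evalL, laurentLift_T, smul_eq_mul, smul_eq_mul]
    ring

lemma majL_coeffMulL_le {r s : ℝ} {χ : ℤ → ℂ}
    (h : ∀ k, ‖χ k‖ * r ^ (-k) ≤ s ^ (-k)) (hr : 0 < r) (p : LaurentPolynomial ℂ) :
    majL r (coeffMulL χ p) ≤ majL s p := by
  rw [← one_mul (majL s p)]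
  refine le_majL (coeffMulL χ).toAddMonoidHom (majL r) (majL_zero r) (majL_add_le hr) 1
    (fun c k => ?_) p
  rw [LinearMap.toAddMonoidHom_coe, coeffMulL, laurentLift_monomial, smul_smul, smul_eq_C_mul,
    majL_monomial, one_mul, norm_mul, mul_assoc]
  exact mul_le_mul_of_nonneg_left (h k) (norm_nonneg _)

/-- The formal series `f` converges normally on the circle `|z| = r`, with sum `φ z`. -/
def Represents (r : ℝ) (f : SymSeries) (φ : ℂ → ℂ) : Prop :=
  Summable (fun n => majL r (PowerSeries.coeff n f)) ∧
    ∀ z, ‖z‖ = r → ∑' n, evalL z (PowerSeries.coeff n f) = φ z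

lemma summable_sum_antidiagonal_of_nonneg {a b : ℕ → ℝ} (ha : ∀ n, 0 ≤ a n) (hb : ∀ n, 0 ≤ b n)
    (hsa : Summable a) (hsb : Summable b) :
    Summable fun n => ∑ x ∈ Finset.HasAntidiagonal.antidiagonal n, a x.1 * b x.2 :=
  summable_sum_mul_antidiagonal_of_summable_mul (hsa.mul_of_nonneg hsb ha hb)

lemma Represents.mul {r : ℝ} (hr : 0 < r) {f g : SymSeries} {φ γ : ℂ → ℂ}
    (hf : Represents r f φ) (hg : Represents r g γ) :
    Represents r (f * g) fun z => φ z * γ z := by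
  obtain ⟨hf1, hf2⟩ := hf
  obtain ⟨hg1, hg2⟩ := hg
  have h : ∀ n, PowerSeries.coeff n (f * g) = ∑ x ∈ Finset.HasAntidiagonal.antidiagonal n,
      PowerSeries.coeff x.1 f * PowerSeries.coeff x.2 g := fun n => PowerSeries.coeff_mul n f g
  constructor
  · have h1 := summable_sum_antidiagonal_of_nonneg (fun n => majL_nonneg hr (PowerSeries.coeff n f))
      (fun n => majL_nonneg hr (PowerSeries.coeff n g)) hf1 hg1
    refine Summable.of_nonneg_of_le (fun n => majL_nonneg hr (PowerSeries.coeff n (f * g)))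
      (fun n => ?_) h1
    rw [h]
    exact (Finset.le_sum_of_subadditive (majL r) (majL_zero r).le (majL_add_le hr) _ _).trans
      (Finset.sum_le_sum fun x _ => majL_mul_le hr _ _)
  · intro z hz
    have hz0 : z ≠ 0 := fun h0 => hr.ne' (by rw [← hz, h0, norm_zero])
    have hs : ∀ {k : SymSeries}, Summable (fun n => majL r (PowerSeries.coeff n k)) →
        Summable fun n => ‖evalL z (PowerSeries.coeff n k)‖ := fun hk =>
      hk.of_nonneg_of_le (fun _ => norm_nonneg _) fun n => norm_evalL_le hz _
    simp only [← hf2 z hz, ← hg2 z hz]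
    rw [tsum_mul_tsum_eq_tsum_sum_antidiagonal_of_summable_norm (hs hf1) (hs hg1)]
    refine tsum_congr fun n => ?_
    rw [h, map_sum]
    exact Finset.sum_congr rfl fun x _ => evalL_mul hz0 _ _

/-- The mean over a circle of a normally convergent series is the value of its constant term. -/
lemma Represents.hasValue_ctH {r : ℝ} (hr : 0 < r) {f : SymSeries} {φ : ℂ → ℂ}
    (hf : Represents r f φ) :
    HasValue (ctH f) ((2 * Real.pi * Complex.I)⁻¹ * ∮ z in C(0, r), φ z * z⁻¹) := by
  constructor
  · refine hf.1.of_nonneg_of_le (fun _ => norm_nonneg _) fun n => ?_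
    rw [coeff_ctH]
    exact norm_ctL_le hr _
  · have h := hasSum_circleIntegral (F := fun n z => evalL z (PowerSeries.coeff n f) * z⁻¹)
      (f := fun z => φ z * z⁻¹) hr.le (b := fun n => majL r (PowerSeries.coeff n f) * r⁻¹)
      (fun n => (continuousOn_evalL hr _).mul (continuousOn_id.inv₀ fun z hz =>
        Metric.ne_of_mem_sphere hz hr.ne')) (hf.1.mul_right _)
      (fun n z hz => by
        rw [mem_sphere_zero_iff_norm] at hz
        rw [norm_mul, norm_inv, hz]
        exact mul_le_mul_of_nonneg_right (norm_evalL_le hz _) (inv_nonneg.2 hr.le))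
      (fun z hz => by
        rw [mem_sphere_zero_iff_norm] at hz
        rw [tsum_mul_right, hf.2 z hz])
    rw [← h.tsum_eq, ← tsum_mul_left]
    refine tsum_congr fun n => ?_
    rw [circleIntegral_evalL hr, coeff_ctH, inv_mul_cancel_left₀ Complex.two_pi_I_ne_zero]

/-- The Cauchy integral of a normally convergent series. -/
lemma Represents.cauchy {r s : ℝ} (hr : 0 < r) (hs : 0 < s) (hrs : r ≠ s) {g : SymSeries}
    {γ : ℂ → ℂ} (hg : Represents s g γ) {χ : ℤ → ℂ} (h0 : χ 0 = if r < s then -1 else 0)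
    (hχ : ∀ l, χ (l + 1) = χ l + if l + 1 = 1 then 1 else 0)
    (hb : ∀ k, ‖χ k‖ * r ^ (-k) ≤ s ^ (-k)) :
    Represents r (coeffMulH χ g) fun z =>
      (2 * Real.pi * Complex.I)⁻¹ * ∮ w in C(0, s), γ w * (1 / (z - w)) := by
  constructor
  · refine hg.1.of_nonneg_of_le (fun _ => majL_nonneg hr _) fun n => ?_
    rw [coeff_coeffMulH]
    exact majL_coeffMulL_le hb hr _
  · rintro z rfl
    have hz0 : z ≠ 0 := norm_pos_iff.1 hr
    have hd : 0 < |‖z‖ - s| := abs_pos.2 (sub_ne_zero.2 hrs)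
    have h := hasSum_circleIntegral
      (F := fun n w => evalL w (PowerSeries.coeff n g) * (1 / (z - w)))
      (f := fun w => γ w * (1 / (z - w))) hs.le
      (b := fun n => majL s (PowerSeries.coeff n g) * |‖z‖ - s|⁻¹)
      (fun n => (continuousOn_evalL hs _).mul (continuousOn_cauchy hrs)) (hg.1.mul_right _)
      (fun n w hw => by
        rw [mem_sphere_zero_iff_norm] at hw
        rw [norm_mul, one_div, norm_inv]
        refine mul_le_mul (norm_evalL_le hw _) (inv_anti₀ hd ?_) (inv_nonneg.2 (norm_nonneg _))
          (majL_nonneg hs _)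
        rw [← hw]
        exact abs_norm_sub_norm_le z w)
      (fun w hw => by
        rw [mem_sphere_zero_iff_norm] at hw
        rw [tsum_mul_right, hg.2 w hw])
    beta_reduce
    rw [← h.tsum_eq, ← tsum_mul_left]
    refine tsum_congr fun n => ?_
    rw [circleIntegral_cauchy_evalL hs hz0 hrs h0 hχ, coeff_coeffMulH,
      inv_mul_cancel_left₀ Complex.two_pi_I_ne_zero]

end Contours

/-! ### The kernel as a constant term -/

section Contours

open LaurentPolynomial

lemma Represents.congr {r : ℝ} {f : SymSeries} {φ φ' : ℂ → ℂ} (h : Represents r f φ)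
    (h' : ∀ z, ‖z‖ = r → φ z = φ' z) : Represents r f φ' :=
  ⟨h.1, fun z hz => (h.2 z hz).trans (h' z hz)⟩

lemma represents_C (r : ℝ) (p : LaurentPolynomial ℂ) :
    Represents r (PowerSeries.C p) fun z => evalL z p := by
  have h : ∀ n, n ≠ 0 → PowerSeries.coeff n (PowerSeries.C p) = 0 := fun n hn => by
    rw [PowerSeries.coeff_C, if_neg hn]
  refine ⟨summable_of_ne_finset_zero (s := {0}) fun n hn => ?_, fun z _ => ?_⟩
  · rw [h n (by simpa using hn), majL_zero]
  · rw [tsum_eq_single 0 fun n hn => by rw [h n hn, map_zero], PowerSeries.coeff_C, if_pos rfl]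

lemma Represents.prod {r : ℝ} (hr : 0 < r) {α : Type*} (s : Finset α) {f : α → SymSeries}
    {φ : α → ℂ → ℂ} (h : ∀ i ∈ s, Represents r (f i) (φ i)) :
    Represents r (∏ i ∈ s, f i) fun z => ∏ i ∈ s, φ i z := by
  induction s using Finset.induction_on with
  | empty =>
    simp only [Finset.prod_empty]
    refine (represents_C r 1).congr fun z _ => ?_
    rw [← T_zero, evalL, laurentLift_T, neg_zero, zpow_zero]
  | insert i s hi ih =>
    simp only [Finset.prod_insert hi]
    exact (h i (Finset.mem_insert_self i s)).mul hr
      (ih fun k hk => h k (Finset.mem_insert_of_mem hk))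

lemma represents_letterSym (r : ℝ) (l : Letter) :
    Represents r (letterSym l) fun z => 1 - l.2 * z ^ (-(if l.1 then -1 else 1) : ℤ) := by
  set e : ℤ := if l.1 then -1 else 1 with he
  have hc : ∀ n, PowerSeries.coeff n (letterSym l) =
      if n = 0 then 1 else if n = 1 then -(C l.2 * T e) else 0 := by
    intro n
    rw [letterSym, factorSym, map_sub, PowerSeries.coeff_one]
    match n with
    | 0 => simp
    | 1 => simp [he]
    | n + 2 =>
      rw [PowerSeries.coeff_C_mul, PowerSeries.coeff_X]
      simp
  refine ⟨summable_of_ne_finset_zero (s := {0, 1}) fun n hn => ?_, fun z _ => ?_⟩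
  · simp only [Finset.mem_insert, Finset.mem_singleton, not_or] at hn
    rw [hc, if_neg hn.1, if_neg hn.2, majL_zero]
  · rw [tsum_eq_sum (s := {0, 1}) fun n hn => by
      simp only [Finset.mem_insert, Finset.mem_singleton, not_or] at hn
      rw [hc, if_neg hn.1, if_neg hn.2, map_zero]]
    rw [Finset.sum_pair (by norm_num), hc, hc, if_pos rfl, if_neg one_ne_zero, if_pos rfl, map_neg,
      ← T_zero, evalL, laurentLift_T, laurentLift_monomial, neg_zero, zpow_zero, smul_eq_mul,
      ← sub_eq_add_neg]

lemma represents_letterSymInv {r : ℝ} (hr : 0 < r) (l : Letter)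
    (h : ‖l.2‖ * r ^ (-(if l.1 then -1 else 1) : ℤ) < 1) :
    Represents r (letterSymInv l) fun z =>
      (1 - l.2 * z ^ (-(if l.1 then -1 else 1) : ℤ))⁻¹ := by
  have hpow : ∀ {𝕜 : Type} [Field 𝕜] (x : 𝕜) (n : ℕ),
      x ^ (-((if l.1 then -1 else 1) * (n : ℤ))) = (x ^ (-(if l.1 then -1 else 1) : ℤ)) ^ n := by
    intro 𝕜 _ x n
    rw [← neg_mul, zpow_mul, zpow_natCast]
  refine ⟨?_, fun z hz => ?_⟩
  · simp only [letterSymInv, PowerSeries.coeff_mk, majL_monomial, hpow, norm_pow, ← mul_pow]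
    exact summable_geometric_of_lt_one (by positivity) h
  · simp only [letterSymInv, PowerSeries.coeff_mk, evalL, laurentLift_monomial, hpow, smul_eq_mul,
      ← mul_pow]
    refine tsum_geometric_of_norm_lt_one ?_
    rwa [norm_mul, norm_zpow, hz]

variable {P : SkewShape} {xp xm : ℤ → ℝ}

lemma filter_not_mem_Dplus (t : ℤ) :
    (Finset.Ico (-(P.a : ℤ)) (P.b : ℤ)).filter (fun n => n < t ∧ n ∉ P.Dplus) =
      (Finset.Ico (-(P.a : ℤ)) (P.b : ℤ)).filter (fun n => n < t ∧ n ∈ P.Dminus) := by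
  refine Finset.filter_congr fun n hn => and_congr_right fun _ => ?_
  rw [Finset.mem_Ico] at hn
  exact ⟨fun h => (P.mem_Dplus_or_mem_Dminus hn.1 hn.2).resolve_left h,
    not_mem_Dplus_of_mem_Dminus⟩

/-- Inside the poles of `1 / Φ₊(z, t)` the symbol of `ψ_j` converges to `z^{-j} Φ₋(z, t) / Φ₊(z, t)`. -/
lemma represents_fNormal {r : ℝ} (hr : 0 < r) {t j : ℤ}
    (h : ∀ n ∈ P.Dplus, t ≤ n → r < |xp n|⁻¹) :
    Represents r (fNormal P xp xm (t, j)) fun z =>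
      z ^ (-j) * (PhiMinus P xm z t * (PhiPlus P xp z t)⁻¹) := by
  rw [fNormal]
  refine ((represents_C r _).mul hr (((Represents.prod hr _ fun n _ =>
    represents_letterSym r _).mul hr (Represents.prod hr _ fun n hn =>
      represents_letterSymInv hr _ ?_)))).congr fun z _ => ?_
  · obtain ⟨_, h1, h2⟩ := Finset.mem_filter.1 hn
    have h3 := h n h2 h1
    have h4 : 0 < |xp n| := inv_pos.1 (hr.trans h3)
    rw [Complex.norm_real, Real.norm_eq_abs]
    simp only [if_true, neg_neg, zpow_one]
    have := mul_lt_mul_of_pos_left h3 h4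
    rwa [mul_inv_cancel₀ h4.ne'] at this
  · rw [evalL, laurentLift_T, PhiMinus, PhiPlus, filter_not_mem_Dplus, ← Finset.prod_inv_distrib]
    simp only [if_true, neg_neg, zpow_one, zpow_neg_one, Bool.false_eq_true, if_false]
    simp only [mul_comm]

/-- Outside the poles of `1 / Φ₋(w, t)` the symbol of `ψ*_j` converges to `w^j Φ₊(w, t) / Φ₋(w, t)`. -/
lemma represents_gNormal {s : ℝ} (hs : 0 < s) {t j : ℤ}
    (h : ∀ n ∈ P.Dminus, n < t → |xm n| < s) :
    Represents s (gNormal P xp xm (t, j)) fun w =>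
      w ^ j * ((PhiMinus P xm w t)⁻¹ * PhiPlus P xp w t) := by
  rw [gNormal, filter_not_mem_Dplus]
  refine ((represents_C s _).mul hs (((Represents.prod hs _ fun n hn =>
    represents_letterSymInv hs _ ?_).mul hs (Represents.prod hs _ fun n _ =>
      represents_letterSym s _)))).congr fun z _ => ?_
  · obtain ⟨_, h1, h2⟩ := Finset.mem_filter.1 hn
    rw [Complex.norm_real, Real.norm_eq_abs]
    simp only [zpow_neg_one, Bool.false_eq_true, if_false]
    rw [← div_eq_mul_inv, div_lt_one hs]
    exact h n h2 h1
  · rw [evalL, laurentLift_T, PhiMinus, PhiPlus, ← Finset.prod_inv_distrib]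
    simp only [if_true, neg_neg, zpow_one, zpow_neg_one, Bool.false_eq_true, if_false]
    simp only [mul_comm]

/-- The kernel is a constant term, with `χ` the function of `circleIntegral_cauchy`. -/
lemma AdmissibleRadii.hasValue_coeffMulH {p₁ p₂ : ℤ × ℚ} {r s : ℝ}
    (h : AdmissibleRadii P xp xm p₁.1 p₂.1 r s) {χ : ℤ → ℂ}
    (h0 : χ 0 = if r < s then -1 else 0)
    (hχ : ∀ l, χ (l + 1) = χ l + if l + 1 = 1 then 1 else 0)
    (hb : ∀ k, ‖χ k‖ * r ^ (-k) ≤ s ^ (-k)) :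
    HasValue (ctH (fNormal P xp xm (p₁.1, mode P p₁) *
      coeffMulH χ (gNormal P xp xm (p₂.1, mode P p₂)))) (kernel P xp xm p₁ p₂ r s) := by
  have hrs : r ≠ s := by
    rcases le_or_gt p₂.1 p₁.1 with h1 | h1
    · exact (h.s_lt_r h1).ne'
    · exact (h.r_lt_s h1).ne
  have hf := represents_fNormal (xm := xm) h.r_pos (j := mode P p₁) h.r_lt
  have hg := represents_gNormal (xp := xp) h.s_pos (j := mode P p₂) h.lt_s
  convert (hf.mul h.r_pos (hg.cauchy h.r_pos h.s_pos hrs h0 hχ hb)).hasValue_ctH h.r_pos using 1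
  rw [kernel, one_div, ← inv_pow, pow_two, mul_assoc, ← circleIntegral.integral_const_mul]
  congr 1
  refine circleIntegral.integral_congr h.r_pos.le fun z hz => ?_
  have hz0 : z ≠ 0 := Metric.ne_of_mem_sphere hz h.r_pos.ne'
  simp only [← circleIntegral.integral_const_mul]
  rw [mul_comm _ z⁻¹, ← circleIntegral.integral_const_mul]
  refine circleIntegral.integral_congr h.s_pos.le fun w _ => ?_
  simp only [neg_add, zpow_add₀ hz0, zpow_neg_one, div_eq_mul_inv, mul_inv]
  ring

/-- The constant term pairs opposite exponents, so a multiplier of the coefficients may be moved to the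
other factor. -/
lemma ctL_mul_coeffMulL {χ η : ℤ → ℂ} (h : ∀ k, χ (-k) = η k) (p q : LaurentPolynomial ℂ) :
    ctL (p * coeffMulL χ q) = ctL (coeffMulL η p * q) := by
  induction p using LaurentPolynomial.induction_on' with
  | add f f' hf hf' => simp only [map_add, add_mul, hf, hf']
  | C_mul_T k c =>
    induction q using LaurentPolynomial.induction_on' with
    | add f f' hf hf' => simp only [map_add, mul_add, hf, hf']
    | C_mul_T l d =>
      simp only [coeffMulL, laurentLift_monomial]
      simp only [← smul_eq_C_mul, mul_smul_comm, smul_mul_assoc, map_smul, ← T_add, ctL,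
        laurentLift_T, smul_eq_mul]
      by_cases hkl : k + l = 0
      · rw [← h k, show -k = l by omega]
        ring
      · rw [if_neg hkl]
        ring

lemma ctH_mul_coeffMulH {χ η : ℤ → ℂ} (h : ∀ k, χ (-k) = η k) (f g : SymSeries) :
    ctH (f * coeffMulH χ g) = ctH (coeffMulH η f * g) := by
  ext1 n
  rw [coeff_ctH, coeff_ctH, PowerSeries.coeff_mul, PowerSeries.coeff_mul, map_sum, map_sum]
  refine Finset.sum_congr rfl fun x _ => ?_
  rw [coeff_coeffMulH, coeff_coeffMulH, ctL_mul_coeffMulL h]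

lemma coeffMulH_neg_indicator (f : SymSeries) :
    coeffMulH (fun k => if k < 0 then 1 else 0) f = negH f := by
  ext1 n
  rw [coeff_coeffMulH, coeff_negH, coeffMulL, negL]
  congr 2
  ext1 k
  split_ifs <;> simp

lemma coeffMulH_nonneg_indicator (f : SymSeries) :
    coeffMulH (fun k => if k < 0 then 0 else -1) f = -posH f := by
  ext1 n
  have e : (coeffMulL fun k => if k < 0 then 0 else -1) = -posL := by
    rw [coeffMulL, posL, laurentLift, laurentLift, ← LinearMap.neg_comp]
    congr 1
    ext1 k
    rw [LinearMap.neg_comp]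
    ext1
    simp only [LinearMap.comp_apply, LinearMap.neg_apply, Finsupp.lsingle_apply,
      Finsupp.linearCombination_single]
    split_ifs <;> simp
  rw [coeff_coeffMulH, map_neg, coeff_posH, e, LinearMap.neg_apply]

/-- For `t₁ ≥ t₂` the kernel is the contraction with the annihilating part of the fermion. -/
lemma AdmissibleRadii.hasValue_of_le {p₁ p₂ : ℤ × ℚ} {r s : ℝ}
    (h : AdmissibleRadii P xp xm p₁.1 p₂.1 r s) (ht : p₂.1 ≤ p₁.1) :
    HasValue (ctH (negH (fNormal P xp xm (p₁.1, mode P p₁)) *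
      gNormal P xp xm (p₂.1, mode P p₂))) (kernel P xp xm p₁ p₂ r s) := by
  have hsr := h.s_lt_r ht
  rw [← coeffMulH_neg_indicator,
    ← ctH_mul_coeffMulH (χ := fun k => if 0 < k then 1 else 0) (fun k => by simp)]
  refine h.hasValue_coeffMulH ?_ (fun l => ?_) fun k => ?_
  · rw [if_neg (lt_irrefl _), if_neg hsr.not_gt]
  · rcases lt_trichotomy l 0 with hl | hl | hl
    · rw [if_neg (by omega), if_neg (by omega), if_neg (by omega), add_zero]
    · rw [if_pos (by omega), if_neg (by omega), if_pos (by omega), zero_add]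
    · rw [if_pos (by omega), if_pos (by omega), if_neg (by omega), add_zero]
  · split_ifs with hk
    · rw [norm_one, one_mul, zpow_neg, zpow_neg]
      exact inv_anti₀ (zpow_pos h.s_pos _) (zpow_le_zpow_left₀ hk.le h.s_pos.le hsr.le)
    · rw [norm_zero, zero_mul]
      exact (zpow_pos h.s_pos _).le

/-- For `t₁ < t₂` the kernel is minus the contraction with the creating part of the fermion. -/
lemma AdmissibleRadii.hasValue_of_lt {p₁ p₂ : ℤ × ℚ} {r s : ℝ}
    (h : AdmissibleRadii P xp xm p₁.1 p₂.1 r s) (ht : p₁.1 < p₂.1) :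
    HasValue (-ctH (posH (fNormal P xp xm (p₁.1, mode P p₁)) *
      gNormal P xp xm (p₂.1, mode P p₂))) (kernel P xp xm p₁ p₂ r s) := by
  have hrs := h.r_lt_s ht
  rw [← map_neg, ← neg_mul, ← coeffMulH_nonneg_indicator,
    ← ctH_mul_coeffMulH (χ := fun k => if 0 < k then 0 else -1) (fun k => by simp)]
  refine h.hasValue_coeffMulH ?_ (fun l => ?_) fun k => ?_
  · rw [if_neg (lt_irrefl _), if_pos hrs]
  · rcases lt_trichotomy l 0 with hl | hl | hl
    · rw [if_neg (by omega), if_neg (by omega), if_neg (by omega), add_zero]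
    · rw [if_pos (by omega), if_neg (by omega), if_pos (by omega), neg_add_cancel]
    · rw [if_pos (by omega), if_pos (by omega), if_neg (by omega), add_zero]
  · split_ifs with hk
    · rw [norm_zero, zero_mul]
      exact (zpow_pos h.s_pos _).le
    · rw [norm_neg, norm_one, one_mul]
      exact zpow_le_zpow_left₀ (by omega) h.r_pos.le hrs.le

variable (P xp xm)

/-- At equal times the symbols of `ψ` and `ψ*` are inverse to each other up to a monomial. -/
lemma ctH_fNormal_mul_gNormal {t j k : ℤ} (hjk : j ≠ k) :
    ctH (fNormal P xp xm (t, j) * gNormal P xp xm (t, k)) = 0 := by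
  have e : fNormal P xp xm (t, j) * gNormal P xp xm (t, k) = PowerSeries.C (T (j - k)) := by
    have h1 : ∀ (s : Finset ℤ) (l : ℤ → Letter),
        (∏ n ∈ s, letterSym (l n)) * ∏ n ∈ s, letterSymInv (l n) = 1 := fun s l => by
      rw [← Finset.prod_mul_distrib]
      exact Finset.prod_eq_one fun n _ => letterSym_mul_inv _
    have h2 : ∀ a b c d e f : SymSeries, a * (b * c) * (d * (e * f)) =
        a * d * (b * e) * (f * c) := fun a b c d e f => by ring
    rw [fNormal, gNormal, h2, h1, h1, mul_one, mul_one, ← map_mul, ← T_add, ← sub_eq_add_neg]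
  ext1 n
  rw [e, coeff_ctH, PowerSeries.coeff_C, map_zero]
  split_ifs
  · rw [ctL, laurentLift_T, if_neg (sub_ne_zero.2 hjk)]
  · rw [map_zero]

/-- At equal times and different modes the two expressions for the kernel agree. -/
lemma neg_ctH_posH_eq {t j k : ℤ} (hjk : j ≠ k) :
    -ctH (posH (fNormal P xp xm (t, j)) * gNormal P xp xm (t, k)) =
      ctH (negH (fNormal P xp xm (t, j)) * gNormal P xp xm (t, k)) := by
  rw [neg_eq_iff_add_eq_zero, ← map_add, ← add_mul, posH_add_negH, ctH_fNormal_mul_gNormal _ _ _ hjk]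

end Contours

/-! ### Partition function, correlation functions and contours -/

open scoped ENNReal

lemma tsum_ofReal {α : Type*} {f : α → ℝ} (hf : ∀ i, 0 ≤ f i)
    (h : ∑' i, ENNReal.ofReal (f i) ≠ ∞) :
    Summable f ∧ (∑' i, ENNReal.ofReal (f i)).toReal = ∑' i, f i := by
  have h1 : ∀ i, (ENNReal.ofReal (f i)).toReal = f i := fun i => ENNReal.toReal_ofReal (hf i)
  constructor
  · have := ENNReal.summable_toReal h
    simpa only [h1] using this
  · rw [ENNReal.tsum_toReal_eq fun i => ENNReal.ofReal_ne_top]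
    simp only [h1]

/-- Radii that separate two finite sets, the second of which may be empty. -/
lemma exists_radii (A B : Finset ℝ) (hA : A.Nonempty) (h : ∀ a ∈ A, ∀ b ∈ B, a < b) :
    ∃ s r : ℝ, s < r ∧ (∀ a ∈ A, a < s) ∧ ∀ b ∈ B, r < b := by
  rcases B.eq_empty_or_nonempty with rfl | hB
  · refine ⟨A.max' hA + 1, A.max' hA + 2, by linarith, fun a ha => ?_, by simp⟩
    linarith [A.le_max' a ha]
  · have hlt := h _ (A.max'_mem hA) _ (B.min'_mem hB)
    obtain ⟨s, h1, h2⟩ := exists_between hlt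
    obtain ⟨r, h3, h4⟩ := exists_between h2
    exact ⟨s, r, h3, fun a ha => (A.le_max' a ha).trans_lt h1,
      fun b hb => h4.trans_le (B.min'_le b hb)⟩

/-- Different sites at the same time have different modes, although `mode` rounds down. -/
lemma mode_ne {P : SkewShape} {p p' : ℤ × ℚ} (hp : IsSite p) (hp' : IsSite p') (ht : p.1 = p'.1)
    (hne : p ≠ p') : mode P p ≠ mode P p' := by
  obtain ⟨k, hk⟩ := hp
  obtain ⟨k', hk'⟩ := hp'
  intro h
  have h1 : p.2 + P.B p.1 = p'.2 + P.B p'.1 + ((k - k' : ℤ) : ℚ) := by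
    rw [ht] at hk ⊢
    push_cast
    linarith
  rw [mode, mode, h1, Int.floor_add_intCast] at h
  have h2 : k = k' := by omega
  rw [ht, h2] at hk
  exact hne (Prod.ext ht (by linarith))

section Main

variable {P : SkewShape} {q xp xm : ℤ → ℝ}

lemma weight_nonneg (hq : ∀ t : ℤ, -(P.a : ℤ) < t → t < (P.b : ℤ) → 0 ≤ q t ∧ q t < 1)
    (π : SkewPlanePartition P) : 0 ≤ weight q π :=
  Finset.prod_nonneg fun t ht => by
    rw [Finset.mem_Ioo] at ht
    exact pow_nonneg (hq t ht.1 ht.2).1 _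

lemma prod_localDensity_mem {n : ℕ} (p : Fin n → ℤ × ℚ) (π : SkewPlanePartition P) :
    0 ≤ ∏ i, localDensity (p i) π ∧ ∏ i, localDensity (p i) π ≤ 1 := by
  have h : ∀ i, 0 ≤ localDensity (p i) π ∧ localDensity (p i) π ≤ 1 := fun i => by
    rw [localDensity]
    split_ifs <;> norm_num
  exact ⟨Finset.prod_nonneg fun i _ => (h i).1,
    Finset.prod_le_one (fun i _ => (h i).1) fun i _ => (h i).2⟩

/-- In every charge the vacuum matrix element of all vertex operators is the sum of the weights. -/
lemma IsVertexParam.vertexWord (hx : IsVertexParam P q xp xm) :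
    NonnegWord (vertexWord P xp xm (-(P.a : ℤ)) P.b) ∧
      ∀ c, mass (SkewPP.vertexWord P xp xm (-(P.a : ℤ)) P.b) (vac c) (vac c) =
        ∑' π : SkewPlanePartition P, ENNReal.ofReal (weight q π) := by
  obtain ⟨h1, h2⟩ := hx.nonnegParam.correlationWord [] P.b (by simp) List.Pairwise.nil
  refine ⟨h1, fun c => (h2 _ _).trans ?_⟩
  rw [show clampPos P P.b = P.b by unfold clampPos; omega, hx.pathSum_eq]
  simp [modeIndicator]

/-- The vacuum matrix element with fermions is the sum of the weights of the skew plane partitions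
which contain the given tiles. -/
lemma IsVertexParam.correlationWord (hx : IsVertexParam P q xp xm) {n : ℕ} {p : Fin n → ℤ × ℚ}
    (hs : ∀ i, IsSite (p i)) (hp : ∀ i k, i < k → (p k).1 ≤ (p i).1) :
    NonnegWord (correlationWord P xp xm P.b (List.ofFn fun i => ((p i).1, mode P (p i)))) ∧
      mass (SkewPP.correlationWord P xp xm P.b (List.ofFn fun i => ((p i).1, mode P (p i))))
        (vac 0) (vac 0) =
        ∑' π : SkewPlanePartition P,
          ENNReal.ofReal ((∏ i, localDensity (p i) π) * weight q π) := by
  set L := List.ofFn fun i => ((p i).1, mode P (p i)) with hL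
  -- vertex operators beyond `b` are absent, so the word may start at a time `T` beyond all points
  obtain ⟨T, hT, hpT⟩ : ∃ T : ℤ, (P.b : ℤ) ≤ T ∧ ∀ i, (p i).1 ≤ T := by
    refine ⟨P.b + ∑ i, |(p i).1|, ?_, fun i => ?_⟩
    · have : 0 ≤ ∑ i, |(p i).1| := Finset.sum_nonneg fun i _ => abs_nonneg _
      omega
    · have h1 := Finset.single_le_sum (f := fun i => |(p i).1|) (fun i _ => abs_nonneg _)
        (Finset.mem_univ i)
      have h2 := le_abs_self (p i).1
      omega
  obtain ⟨h1, h2⟩ := hx.nonnegParam.correlationWord L T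
    (by
      intro y hy
      obtain ⟨i, rfl⟩ := (List.mem_ofFn' _ _).1 hy
      exact hpT i)
    (by
      rw [hL, List.pairwise_ofFn]
      exact fun i k hik => hp i k hik)
  rw [correlationWord_congr P xp xm (t := P.b) (t' := T) (by omega) L]
  refine ⟨h1, (h2 _ _).trans ?_⟩
  rw [show clampPos P T = P.b by unfold clampPos; omega, hx.pathSum_eq]
  refine tsum_congr fun π => ?_
  rw [hL, modeIndicator_path hs, mul_comm, ENNReal.ofReal_mul (prod_localDensity_mem p π).1]

/-- The geometric series of the product formula converge. -/
lemma IsVertexParam.norm_lt_one (hx : IsVertexParam P q xp xm)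
    (hq : ∀ t : ℤ, -(P.a : ℤ) < t → t < (P.b : ℤ) → 0 ≤ q t ∧ q t < 1) {m n : ℤ}
    (hm : -(P.a : ℤ) ≤ m) (hn : n < P.b) (hmn : m < n) (h1 : m ∉ P.Dplus) (h2 : n ∈ P.Dplus) :
    0 < 1 - xm m * xp n ∧ ‖(xp n : ℂ) * xm m‖ < 1 := by
  have h3 := hx.param_lt hq hm hn hmn
  have h4 := hx.param_pos hm (by omega)
  have h5 := hx.xp_pos n h2
  rw [param, if_neg h1] at h3 h4
  rw [param, if_pos h2] at h3
  have h6 : xm m * xp n < 1 := by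
    have h7 := mul_lt_mul_of_pos_right h3 h5
    rwa [inv_mul_cancel₀ h5.ne'] at h7
  refine ⟨by linarith, ?_⟩
  rw [← Complex.ofReal_mul, Complex.norm_real, Real.norm_eq_abs, abs_of_pos (mul_pos h5 h4),
    mul_comm]
  exact h6

/-- The product formula for the value of the vacuum factor. -/
lemma IsVertexParam.hasValue_vacFactor (hx : IsVertexParam P q xp xm)
    (hq : ∀ t : ℤ, -(P.a : ℤ) < t → t < (P.b : ℤ) → 0 ≤ q t ∧ q t < 1) :
    HasValue (vacFactor (fullWord P xp xm))
      ((∏ m ∈ orderedPairs P, (1 - xm m.1 * xp m.2)⁻¹ : ℝ) : ℂ) := by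
  rw [vacFactor_fullWord]
  have e : orderedPairs P = (Finset.Ico (-(P.a : ℤ)) (P.b : ℤ) ×ˢ
      Finset.Ico (-(P.a : ℤ)) (P.b : ℤ)).filter
        (fun m => m.1 < m.2 ∧ m.1 ∉ P.Dplus ∧ m.2 ∈ P.Dplus) := by
    refine Finset.filter_congr fun m hm => ?_
    rw [Finset.mem_product, Finset.mem_Ico, Finset.mem_Ico] at hm
    refine and_congr_right fun _ => and_congr_left fun _ =>
      ⟨not_mem_Dplus_of_mem_Dminus, fun h =>
        (P.mem_Dplus_or_mem_Dminus hm.1.1 hm.1.2).resolve_left h⟩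
  rw [e, Complex.ofReal_prod]
  refine HasValue.prod _ fun m hm => ?_
  obtain ⟨h1, h2, h3, h4⟩ := Finset.mem_filter.1 hm
  rw [Finset.mem_product, Finset.mem_Ico, Finset.mem_Ico] at h1
  have := hasValue_inv (hx.norm_lt_one hq h1.1.1 h1.2.2 h2 h3 h4).2
  push_cast
  rwa [mul_comm (xm m.1 : ℂ)]

lemma IsVertexParam.prod_ne_zero (hx : IsVertexParam P q xp xm)
    (hq : ∀ t : ℤ, -(P.a : ℤ) < t → t < (P.b : ℤ) → 0 ≤ q t ∧ q t < 1) :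
    ∏ m ∈ orderedPairs P, (1 - xm m.1 * xp m.2)⁻¹ ≠ 0 := by
  refine Finset.prod_ne_zero_iff.2 fun m hm => inv_ne_zero ?_
  obtain ⟨h1, h2, h3, h4⟩ := Finset.mem_filter.1 hm
  rw [Finset.mem_product, Finset.mem_Ico, Finset.mem_Ico] at h1
  exact (hx.norm_lt_one hq h1.1.1 h1.2.2 h2 (not_mem_Dplus_of_mem_Dminus h3) h4).1.ne'

lemma vev_vertexWord : vev (wordE (vertexWord P xp xm (-(P.a : ℤ)) P.b)) =
    vacFactor (fullWord P xp xm) := by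
  have h := vev_correlationWord P xp xm (n := 0) (fun i => i.elim0) (fun i => i.elim0)
  rw [Matrix.det_isEmpty, mul_one, List.ofFn_zero] at h
  exact h

/-- The sum of the weights is finite: its terms are nonnegative and their sum, by total degree in the
parameters, is the convergent product. -/
lemma IsVertexParam.tsum_ne_top (hx : IsVertexParam P q xp xm)
    (hq : ∀ t : ℤ, -(P.a : ℤ) < t → t < (P.b : ℤ) → 0 ≤ q t ∧ q t < 1) :
    ∑' π : SkewPlanePartition P, ENNReal.ofReal (weight q π) ≠ ∞ := by
  rw [← hx.vertexWord.2 0]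
  have h := hx.hasValue_vacFactor hq
  rw [← vev_vertexWord] at h
  exact h.mass_ne_top hx.vertexWord.1

lemma IsVertexParam.partitionFunction_eq_toReal (hx : IsVertexParam P q xp xm)
    (hq : ∀ t : ℤ, -(P.a : ℤ) < t → t < (P.b : ℤ) → 0 ≤ q t ∧ q t < 1) (c : ℤ) :
    (mass (SkewPP.vertexWord P xp xm (-(P.a : ℤ)) P.b) (vac c) (vac c)).toReal =
      partitionFunction P q := by
  rw [hx.vertexWord.2 c, (tsum_ofReal (weight_nonneg hq) (hx.tsum_ne_top hq)).2, partitionFunction]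

lemma IsVertexParam.partitionFunction_eq_prod (hx : IsVertexParam P q xp xm)
    (hq : ∀ t : ℤ, -(P.a : ℤ) < t → t < (P.b : ℤ) → 0 ≤ q t ∧ q t < 1) :
    partitionFunction P q = ∏ m ∈ orderedPairs P, (1 - xm m.1 * xp m.2)⁻¹ := by
  have h1 := hx.vertexWord.1.hasValue (by rw [hx.vertexWord.2]; exact hx.tsum_ne_top hq)
  rw [hx.partitionFunction_eq_toReal hq, vev_vertexWord] at h1
  exact Complex.ofReal_injective (h1.unique (hx.hasValue_vacFactor hq))

lemma IsVertexParam.correlation_eq_toReal (hx : IsVertexParam P q xp xm) {n : ℕ}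
    {p : Fin n → ℤ × ℚ}
    (hq : ∀ t : ℤ, -(P.a : ℤ) < t → t < (P.b : ℤ) → 0 ≤ q t ∧ q t < 1)
    (hs : ∀ i, IsSite (p i)) (hp : ∀ i k, i < k → (p k).1 ≤ (p i).1) :
    mass (SkewPP.correlationWord P xp xm P.b (List.ofFn fun i => ((p i).1, mode P (p i))))
        (vac 0) (vac 0) ≠ ∞ ∧
      correlation P q p = (1 / partitionFunction P q) *
        (mass (SkewPP.correlationWord P xp xm P.b (List.ofFn fun i => ((p i).1, mode P (p i))))
        (vac 0) (vac 0)).toReal := by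
  have h0 : ∑' π : SkewPlanePartition P,
      ENNReal.ofReal ((∏ i, localDensity (p i) π) * weight q π) ≠ ∞ := by
    refine ne_top_of_le_ne_top (hx.tsum_ne_top hq) (ENNReal.tsum_le_tsum fun π => ?_)
    exact ENNReal.ofReal_le_ofReal
      (mul_le_of_le_one_left (weight_nonneg hq π) (prod_localDensity_mem p π).2)
  rw [(hx.correlationWord hs hp).2]
  refine ⟨h0, ?_⟩
  rw [(tsum_ofReal (fun π => mul_nonneg (prod_localDensity_mem p π).1 (weight_nonneg hq π)) h0).2,
    correlation]

lemma IsVertexParam.exists_admissibleRadii (hx : IsVertexParam P q xp xm)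
    (hq : ∀ t : ℤ, -(P.a : ℤ) < t → t < (P.b : ℤ) → 0 ≤ q t ∧ q t < 1) (t₁ t₂ : ℤ) :
    ∃ r s : ℝ, AdmissibleRadii P xp xm t₁ t₂ r s := by
  set A : Finset ℝ := insert 0 (((Finset.Ico (-(P.a : ℤ)) (P.b : ℤ)).filter
    fun n => n < t₂ ∧ n ∈ P.Dminus).image (param P xp xm)) with hA
  set B : Finset ℝ := ((Finset.Ico (-(P.a : ℤ)) (P.b : ℤ)).filter
    fun n => t₁ ≤ n ∧ n ∈ P.Dplus).image (param P xp xm) with hB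
  have hBpos : ∀ b ∈ B, 0 < b := by
    intro b hb
    obtain ⟨n, hn, rfl⟩ := Finset.mem_image.1 hb
    rw [Finset.mem_filter, Finset.mem_Ico] at hn
    exact hx.param_pos hn.1.1 hn.1.2
  have hAmem : ∀ n ∈ P.Dminus, n < t₂ → |xm n| ∈ A := by
    intro n hn ht
    obtain ⟨h1, h2, _⟩ := P.mem_Dminus_iff.1 hn
    refine Finset.mem_insert_of_mem (Finset.mem_image.2 ⟨n, ?_, ?_⟩)
    · rw [Finset.mem_filter, Finset.mem_Ico]
      exact ⟨⟨h1, h2⟩, ht, hn⟩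
    · rw [param, if_neg (not_mem_Dplus_of_mem_Dminus hn), abs_of_pos (hx.xm_pos n hn)]
  have hBmem : ∀ n ∈ P.Dplus, t₁ ≤ n → |xp n|⁻¹ ∈ B := by
    intro n hn ht
    obtain ⟨h1, h2, _⟩ := P.mem_Dplus_iff.1 hn
    refine Finset.mem_image.2 ⟨n, ?_, ?_⟩
    · rw [Finset.mem_filter, Finset.mem_Ico]
      exact ⟨⟨h1, h2⟩, ht, hn⟩
    · rw [param, if_pos hn, abs_of_pos (hx.xp_pos n hn)]
  rcases le_or_gt t₂ t₁ with ht | ht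
  · obtain ⟨s, r, hsr, h1, h2⟩ := exists_radii A B ⟨0, Finset.mem_insert_self 0 _⟩ (by
      intro a ha b hb
      rcases Finset.mem_insert.1 ha with rfl | ha
      · exact hBpos b hb
      · obtain ⟨m, hm, rfl⟩ := Finset.mem_image.1 ha
        obtain ⟨n, hn, rfl⟩ := Finset.mem_image.1 hb
        rw [Finset.mem_filter, Finset.mem_Ico] at hm hn
        exact hx.param_lt hq hm.1.1 hn.1.2 (by omega))
    have hs := h1 0 (Finset.mem_insert_self 0 _)
    exact ⟨r, s, hs.trans hsr, hs, fun n hn h => h2 _ (hBmem n hn h),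
      fun n hn h => h1 _ (hAmem n hn h), fun _ => hsr, fun h => absurd h (not_lt.2 ht)⟩
  · obtain ⟨ε, r, hεr, h1, h2⟩ := exists_radii {0} B (Finset.singleton_nonempty 0) (by
      simpa using hBpos)
    obtain ⟨s, _, _, h3, _⟩ := exists_radii (insert r A) ∅ (Finset.insert_nonempty r A) (by simp)
    have hr := (h1 0 (Finset.mem_singleton_self 0)).trans hεr
    have hrs := h3 r (Finset.mem_insert_self r A)
    exact ⟨r, s, hr, hr.trans hrs, fun n hn h => h2 _ (hBmem n hn h),
      fun n hn h => h3 _ (Finset.mem_insert_of_mem (hAmem n hn h)),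
      fun h => absurd h (not_le.2 ht), fun _ => hrs⟩

/-- The determinant formula for weakly decreasing times. -/
lemma IsVertexParam.correlation_eq_det_of_antitone (hx : IsVertexParam P q xp xm)
    (hq : ∀ t : ℤ, -(P.a : ℤ) < t → t < (P.b : ℤ) → 0 ≤ q t ∧ q t < 1) {n : ℕ}
    {p : Fin n → ℤ × ℚ} (hs : ∀ i, IsSite (p i)) (hinj : Function.Injective p)
    (hp : ∀ i k, i ≤ k → (p k).1 ≤ (p i).1) {r s : Fin n → Fin n → ℝ}
    (hrs : ∀ i k, AdmissibleRadii P xp xm (p i).1 (p k).1 (r i k) (s i k)) :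
    (correlation P q p : ℂ) =
      (Matrix.of fun i k => kernel P xp xm (p i) (p k) (r i k) (s i k)).det := by
  have hp' : ∀ i k, i < k → (p k).1 ≤ (p i).1 := fun i k h => hp i k h.le
  obtain ⟨h1, h2⟩ := hx.correlation_eq_toReal hq hs hp'
  have h3 := (hx.correlationWord hs hp').1.hasValue h1
  rw [vev_correlationWord P xp xm (fun i => ((p i).1, mode P (p i))) hp'] at h3
  have h4 := h3.unique ((hx.hasValue_vacFactor hq).mul (HasValue.det
    (V := Matrix.of fun i k => kernel P xp xm (p i) (p k) (r i k) (s i k)) fun i k => by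
      simp only [Matrix.of_apply]
      split_ifs with hik
      · exact (hrs i k).hasValue_of_le (hp i k hik)
      · rw [not_le] at hik
        rcases (hp' k i hik).lt_or_eq with ht | ht
        · exact (hrs i k).hasValue_of_lt ht
        · have h5 := (hrs i k).hasValue_of_le ht.ge
          rw [← ht] at h5 ⊢
          rw [neg_ctH_posH_eq _ _ _ (mode_ne (hs i) (hs k) ht (hinj.ne hik.ne'))]
          exact h5))
  rw [← hx.partitionFunction_eq_prod hq] at h4
  have hZ : (partitionFunction P q : ℂ) ≠ 0 := by
    rw [hx.partitionFunction_eq_prod hq]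
    exact Complex.ofReal_ne_zero.2 (hx.prod_ne_zero hq)
  rw [h2, Complex.ofReal_mul, h4, Complex.ofReal_div, Complex.ofReal_one, one_div,
    inv_mul_cancel_left₀ hZ]

lemma correlation_comp_equiv {n : ℕ} (p : Fin n → ℤ × ℚ) (σ : Equiv.Perm (Fin n)) :
    correlation P q (p ∘ σ) = correlation P q p := by
  rw [correlation, correlation]
  congr 1
  refine tsum_congr fun π => ?_
  congr 1
  exact Equiv.prod_comp σ fun i => localDensity (p i) π

/-- Both sides are symmetric in the points, so the times may be assumed to decrease weakly. -/
lemma IsVertexParam.correlation_eq_det (hx : IsVertexParam P q xp xm)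
    (hq : ∀ t : ℤ, -(P.a : ℤ) < t → t < (P.b : ℤ) → 0 ≤ q t ∧ q t < 1) {n : ℕ}
    {p : Fin n → ℤ × ℚ} (hs : ∀ i, IsSite (p i)) (hinj : Function.Injective p)
    {r s : Fin n → Fin n → ℝ}
    (hrs : ∀ i k, AdmissibleRadii P xp xm (p i).1 (p k).1 (r i k) (s i k)) :
    (correlation P q p : ℂ) =
      (Matrix.of fun i k => kernel P xp xm (p i) (p k) (r i k) (s i k)).det := by
  -- sort the points by decreasing time
  set σ := Tuple.sort fun i => -(p i).1 with hσ
  have hmono : Monotone ((fun i => -(p i).1) ∘ σ) := Tuple.monotone_sort _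
  rw [← correlation_comp_equiv p σ, ← Matrix.det_submatrix_equiv_self σ]
  exact hx.correlation_eq_det_of_antitone hq (p := p ∘ σ) (fun i => hs _)
    (hinj.comp σ.injective) (fun i k hik => neg_le_neg_iff.1 (hmono hik)) fun i k => hrs _ _

end Main

end SkewPP

end

theorem mainTheorem4 (P : SkewPP.SkewShape) (q : ℤ → ℝ)
    (hq : ∀ t : ℤ, -(P.a : ℤ) < t → t < (P.b : ℤ) → 0 ≤ q t ∧ q t < 1)
    (xp xm : ℤ → ℝ) (hx : SkewPP.IsVertexParam P q xp xm) :
    -- the partition function converges, and is a vacuum matrix element, and a product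
    Summable (fun π : SkewPP.SkewPlanePartition P => SkewPP.weight q π) ∧
    (∀ c : ℤ,
      Summable (SkewPP.matrixTerm (SkewPP.vertexWord P xp xm (-(P.a : ℤ)) P.b)
        (SkewPP.vacuum c) (SkewPP.vacuum c)) ∧
      (SkewPP.partitionFunction P q : ℂ) =
        SkewPP.matrixElement (SkewPP.vertexWord P xp xm (-(P.a : ℤ)) P.b)
          (SkewPP.vacuum c) (SkewPP.vacuum c)) ∧
    SkewPP.partitionFunction P q =
      ∏ m ∈ SkewPP.orderedPairs P, (1 - xm m.1 * xp m.2)⁻¹ ∧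
    -- correlation functions at times `t_1 > ⋯ > t_n` as matrix elements
    (∀ (n : ℕ) (p : Fin n → ℤ × ℚ), (∀ i, SkewPP.IsSite (p i)) →
      (∀ i k, i < k → (p k).1 < (p i).1) →
      Summable (SkewPP.matrixTerm
        (SkewPP.correlationWord P xp xm P.b (List.ofFn fun i => ((p i).1, SkewPP.mode P (p i))))
        (SkewPP.vacuum 0) (SkewPP.vacuum 0)) ∧
      (SkewPP.correlation P q p : ℂ) = (1 / (SkewPP.partitionFunction P q : ℂ)) *
        SkewPP.matrixElement
          (SkewPP.correlationWord P xp xm P.b (List.ofFn fun i => ((p i).1, SkewPP.mode P (p i))))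
          (SkewPP.vacuum 0) (SkewPP.vacuum 0)) ∧
    -- contours exist, and for all of them the correlation functions are determinants
    (∀ t₁ t₂ : ℤ, ∃ r s : ℝ, SkewPP.AdmissibleRadii P xp xm t₁ t₂ r s) ∧
    (∀ (n : ℕ) (p : Fin n → ℤ × ℚ), (∀ i, SkewPP.IsSite (p i)) → Function.Injective p →
      ∀ r s : Fin n → Fin n → ℝ,
      (∀ i k, SkewPP.AdmissibleRadii P xp xm (p i).1 (p k).1 (r i k) (s i k)) →
      (SkewPP.correlation P q p : ℂ) =
        Matrix.det (Matrix.of fun i k : Fin n =>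
          SkewPP.kernel P xp xm (p i) (p k) (r i k) (s i k))) := by
  refine ⟨(SkewPP.tsum_ofReal (SkewPP.weight_nonneg hq) (hx.tsum_ne_top hq)).1, fun c => ?_,
    hx.partitionFunction_eq_prod hq, fun n p hs hp => ?_, hx.exists_admissibleRadii hq,
    fun n p hs hinj r s hrs => hx.correlation_eq_det hq hs hinj hrs⟩
  · obtain ⟨h1, h2⟩ := hx.vertexWord.1.matrixElement_eq c
      (by rw [hx.vertexWord.2]; exact hx.tsum_ne_top hq)
    refine ⟨h1, ?_⟩
    rw [h2, hx.partitionFunction_eq_toReal hq]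
  · have hp' := fun i k hik => (hp i k hik).le
    obtain ⟨h1, h2⟩ := hx.correlation_eq_toReal hq hs hp'
    obtain ⟨h3, h4⟩ := (hx.correlationWord hs hp').1.matrixElement_eq 0 h1
    refine ⟨h3, ?_⟩
    rw [h4, h2]
    push_cast
    rfl
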